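/- Let $p>q\ge 0$ and $D\ge p+q+2$ be integers. For $0\le i\le p-q$ and $0\le j\le q$ let $A^{(i,j)}_{\mu_1\dots\mu_{p-i}|\nu_1\dots\nu_{q-j}}$ (the gauge field $\phi=A^{(0,0)}$ and the ghosts) and $A^{*(i,j)\,\mu_1\dots\mu_{p-i}|\nu_1\dots\nu_{q-j}}$ (the antifields) be tensor variables in dimension $D$ with the symmetry of the two-column Young diagram $[p-i,q-j]$: they are antisymmetric in the $\mu$'s and in the $\nu$'s, and antisymmetrizing over $\mu_1,\dots,\mu_{p-i},\nu_1$ gives zero if $q-j\geq 1$. The Grassmann parity of $A^{(i,j)}$ is $i+j$ and that of $A^{*(i,j)}$ is $i+j+1$ modulo $2$. A local function is a real smooth function of these variables and of their partial derivatives up to some finite order; the odd variables anticommute (so that a local function is a polynomial in them). Square brackets denote antisymmetrization of strength one, and a comma denotes a partial derivative. Let $\gamma$ be the odd derivation of the algebra of local functions that commutes with the partial derivatives, vanishes on the antifields, and acts on the other variables by $$\gamma A^{(i,j)}_{\mu_1\dots\mu_{p-i}|\nu_1\dots\nu_{q-j}}=\partial_{[\mu_1}A^{(i+1,j)}_{\mu_2\dots\mu_{p-i}]|\nu_1\dots\nu_{q-j}}+b_{i,j}\Bigl(A^{(i,j+1)}_{\mu_1\dots\mu_{p-i}|[\nu_1\dots\nu_{q-j-1},\nu_{q-j}]}+a_{i,j}\,A^{(i,j+1)}_{\nu_1\dots\nu_{q-j}[\mu_{q-j+1}\dots\mu_{p-i}|\mu_1\dots\mu_{q-j-1},\mu_{q-j}]}\Bigr),$$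 $$a_{i,j}=\frac{(p-i)!}{(p-i-q+j+1)!\,(q-j)!},\qquad b_{i,j}=(-1)^i\,\frac{p-q+j+2}{p-i-q+j+2},$$ where $A^{(p-q+1,j)}=0=A^{(i,q+1)}$. Then $\gamma^2=0$. Consider the following four kinds of variables: - the antifields $A^{*(i,j)}$ and all their partial derivatives; - the curvature $K_{\mu_1\dots\mu_{p+1}|\nu_1\dots\nu_{q+1}}=\partial_{[\mu_1}\phi_{\mu_2\dots\mu_{p+1}]|[\nu_1\dots\nu_q,\nu_{q+1}]}$ and all its partial derivatives; - the undifferentiated $p$-th generation ghost $A^{(p-q,q)}_{\mu_1\dots\mu_q}$; - the curl $D^0_{\mu_1\dots\mu_{p+1}}=(-1)^q\,\partial_{[\mu_1}A^{(0,q)}_{\mu_2\dots\mu_{p+1}]}$ of the $q$-th generation ghost $A^{(0,q)}$. Every local function $f\bigl([A^{*(i,j)}],[K],A^{(p-q,q)},D^0\bigr)$ that depends only on variables of these four kinds is $\gamma$-closed, and the map that sends such a function to its cohomology class is an isomorphism from the space of these functions onto $H(\gamma)=\ker\gamma/\operatorname{im}\gamma$. -/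

import Mathlib

namespace SuperFunction

noncomputable section

open scoped TensorProduct ContDiff
variable {V₀ V₁ : Type*} [AddCommGroup V₀] [Module ℝ V₀] [AddCommGroup V₁] [Module ℝ V₁]

/-- Functions on a superspace. `V₀` and `V₁` are the real vector spaces of even and of odd linear
coordinates. A point is a value `x : Module.Dual ℝ V₀` of all even coordinates, and a superfunction
is a function of `x` with values in the exterior algebra on the odd coordinates. `space S₀ S₁`
consists of the finite sums of `g (l₁, …, lₙ) • w`, where `g` is smooth, `l₁, …, lₙ ∈ S₀` are
finitely many even coordinates and `w` is a polynomial in the (anticommuting) coordinates in `S₁`: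
the smooth functions that depend on the coordinates in `S₀` and `S₁` only. -/
def space (S₀ : Submodule ℝ V₀) (S₁ : Submodule ℝ V₁) :
    Submodule ℝ (Module.Dual ℝ V₀ → ExteriorAlgebra ℝ V₁) :=
  Submodule.span ℝ {F | ∃ (n : ℕ) (l : Fin n → V₀) (g : (Fin n → ℝ) → ℝ) (w : ExteriorAlgebra ℝ V₁),
    (∀ k, l k ∈ S₀) ∧ ContDiff ℝ ∞ g ∧ w ∈ Algebra.adjoin ℝ (ExteriorAlgebra.ι ℝ '' (S₁ : Set V₁)) ∧
    F = fun x => g (fun k => x (l k)) • w}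

/-- `τ` is the differential at `x` of `F` along the even variables: in every direction `v`, the
derivative of `F` is the contraction of `τ` with `v`. (For `F = g (l₁, …, lₙ) • w` it is
`∑ k, ∂ₖ g • lₖ ⊗ w`.) -/
def HasDifferential (F : Module.Dual ℝ V₀ → ExteriorAlgebra ℝ V₁) (x : Module.Dual ℝ V₀)
    (τ : V₀ ⊗[ℝ] ExteriorAlgebra ℝ V₁) : Prop :=
  ∀ (v : Module.Dual ℝ V₀) (e : Module.Dual ℝ (ExteriorAlgebra ℝ V₁)),
    HasDerivAt (fun t : ℝ => e (F (x + t • v)))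
      (e (TensorProduct.lid ℝ _ (v.rTensor (ExteriorAlgebra ℝ V₁) τ))) 0

theorem HasDifferential.unique {F : Module.Dual ℝ V₀ → ExteriorAlgebra ℝ V₁}
    {x : Module.Dual ℝ V₀} {τ τ' : V₀ ⊗[ℝ] ExteriorAlgebra ℝ V₁}
    (h : HasDifferential F x τ) (h' : HasDifferential F x τ') : τ = τ' := by
  classical
  let b := Module.Basis.ofVectorSpace ℝ V₀
  apply (TensorProduct.equivFinsuppOfBasisLeft (N := ExteriorAlgebra ℝ V₁) b).injective
  ext1 i
  rw [TensorProduct.equivFinsuppOfBasisLeft_apply, TensorProduct.equivFinsuppOfBasisLeft_apply,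
    ← sub_eq_zero, ← Module.forall_dual_apply_eq_zero_iff ℝ]
  intro e
  rw [map_sub, sub_eq_zero]
  exact (h _ e).unique (h' _ e)

open Classical in
/-- The differential of `F` at `x` (it exists for all elements of `space ⊤ ⊤`). -/
def differential (F : Module.Dual ℝ V₀ → ExteriorAlgebra ℝ V₁) (x : Module.Dual ℝ V₀) :
    V₀ ⊗[ℝ] ExteriorAlgebra ℝ V₁ :=
  if h : ∃ τ, HasDifferential F x τ then h.choose else 0

theorem HasDifferential.eq {F : Module.Dual ℝ V₀ → ExteriorAlgebra ℝ V₁}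
    {x : Module.Dual ℝ V₀} {τ : V₀ ⊗[ℝ] ExteriorAlgebra ℝ V₁}
    (h : HasDifferential F x τ) : differential F x = τ := by
  have h' : ∃ τ, HasDifferential F x τ := ⟨τ, h⟩
  rw [differential, dif_pos h']
  exact h'.choose_spec.unique h

theorem HasDifferential.add {F G : Module.Dual ℝ V₀ → ExteriorAlgebra ℝ V₁}
    {x : Module.Dual ℝ V₀} {τ τ' : V₀ ⊗[ℝ] ExteriorAlgebra ℝ V₁}
    (h : HasDifferential F x τ) (h' : HasDifferential G x τ') :
    HasDifferential (F + G) x (τ + τ') := by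
  intro v e
  have h'' := (h v e).add (h' v e)
  rw [← map_add, ← map_add, ← map_add] at h''
  refine h''.congr_of_eventuallyEq (Filter.Eventually.of_forall fun t => ?_)
  simp

theorem HasDifferential.smul {F : Module.Dual ℝ V₀ → ExteriorAlgebra ℝ V₁}
    {x : Module.Dual ℝ V₀} {τ : V₀ ⊗[ℝ] ExteriorAlgebra ℝ V₁}
    (h : HasDifferential F x τ) (c : ℝ) : HasDifferential (c • F) x (c • τ) := by
  intro v e
  simpa using (h v e).const_mul c

/-- The `k`-th partial derivative. -/
def pderiv {n : ℕ} (g : (Fin n → ℝ) → ℝ) (k : Fin n) (y : Fin n → ℝ) : ℝ :=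
  fderiv ℝ g y (Pi.single k 1)

theorem contDiff_pderiv {n : ℕ} {g : (Fin n → ℝ) → ℝ} (hg : ContDiff ℝ ∞ g) (k : Fin n) :
    ContDiff ℝ ∞ (pderiv g k) :=
  (hg.fderiv_right (m := ∞) (by simp)).clm_apply contDiff_const

theorem hasDifferential_gen {n : ℕ} (l : Fin n → V₀) {g : (Fin n → ℝ) → ℝ} (hg : ContDiff ℝ ∞ g)
    (w : ExteriorAlgebra ℝ V₁) (x : Module.Dual ℝ V₀) :
    HasDifferential (fun x => g (fun k => x (l k)) • w) x
      (∑ k, pderiv g k (fun k => x (l k)) • (l k ⊗ₜ[ℝ] w)) := by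
  intro v e
  have h1 : HasDerivAt (fun t : ℝ => (fun k => (x + t • v) (l k))) (fun k => v (l k)) 0 := by
    rw [hasDerivAt_pi]
    intro k
    simpa using ((hasDerivAt_id (0 : ℝ)).mul_const (v (l k))).const_add (x (l k))
  have h2 : HasFDerivAt g (fderiv ℝ g (fun k => x (l k))) (fun k => (x + (0 : ℝ) • v) (l k)) := by
    simpa using (hg.differentiable (by simp) (fun k => x (l k))).hasFDerivAt
  have h3 := (h2.comp_hasDerivAt (0 : ℝ) h1).mul_const (e w)
  simp only [map_smul, smul_eq_mul, map_sum, LinearMap.rTensor_tmul, TensorProduct.lid_tmul]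
  refine h3.congr_deriv ?_
  conv_lhs => rw [← Finset.univ_sum_single (fun k => v (l k))]
  rw [map_sum, Finset.sum_mul]
  refine Finset.sum_congr rfl fun k _ => ?_
  have : (Pi.single k (v (l k)) : Fin n → ℝ) = v (l k) • Pi.single k 1 := by
    rw [← Pi.single_smul, smul_eq_mul, mul_one]
  rw [this, map_smul, pderiv, smul_eq_mul]
  ring

theorem exists_hasDifferential {F : Module.Dual ℝ V₀ → ExteriorAlgebra ℝ V₁}
    (hF : F ∈ space (⊤ : Submodule ℝ V₀) (⊤ : Submodule ℝ V₁)) (x : Module.Dual ℝ V₀) :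
    ∃ τ, HasDifferential F x τ := by
  induction hF using Submodule.span_induction with
  | mem F h =>
    obtain ⟨n, l, g, w, -, hg, -, rfl⟩ := h
    exact ⟨_, hasDifferential_gen l hg w x⟩
  | zero => exact ⟨0, fun v e => by simpa using hasDerivAt_const (0 : ℝ) (0 : ℝ)⟩
  | add F G _ _ hF hG =>
    obtain ⟨τ, h⟩ := hF
    obtain ⟨τ', h'⟩ := hG
    exact ⟨_, h.add h'⟩
  | smul c F _ hF =>
    obtain ⟨τ, h⟩ := hF
    exact ⟨_, h.smul c⟩

variable (γ₀ : V₀ →ₗ[ℝ] V₁) (γ₁ : V₁ →ₗ[ℝ] V₀)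

/-- `l ⊗ w ↦ γ₀ l ∧ w`. -/
def wedge : V₀ ⊗[ℝ] ExteriorAlgebra ℝ V₁ →ₗ[ℝ] ExteriorAlgebra ℝ V₁ :=
  TensorProduct.lift ((LinearMap.mul ℝ (ExteriorAlgebra ℝ V₁)) ∘ₗ ExteriorAlgebra.ι ℝ ∘ₗ γ₀)

/-- The odd derivation that extends the linear maps `γ₀` (even to odd coordinates) and `γ₁` (odd to
even coordinates): `γ (g (l) • w) = ∑ k, ∂ₖ g (l) • (γ₀ lₖ ∧ w) + g (l) • γ w`, where `γ` acts on the
polynomials `w` in the odd coordinates as the left antiderivation with `γ c = γ₁ c`, which at the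
point `x` is the contraction with the linear form `c ↦ x (γ₁ c)`. -/
def odd (F : Module.Dual ℝ V₀ → ExteriorAlgebra ℝ V₁) (x : Module.Dual ℝ V₀) :
    ExteriorAlgebra ℝ V₁ :=
  wedge γ₀ (differential F x) + CliffordAlgebra.contractLeft (x ∘ₗ γ₁) (F x)

theorem odd_gen {n : ℕ} (l : Fin n → V₀) {g : (Fin n → ℝ) → ℝ} (hg : ContDiff ℝ ∞ g)
    (w : ExteriorAlgebra ℝ V₁) :
    odd γ₀ γ₁ (fun x => g (fun k => x (l k)) • w) = fun x =>
      (∑ k, pderiv g k (fun k => x (l k)) • (ExteriorAlgebra.ι ℝ (γ₀ (l k)) * w)) +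
      g (fun k => x (l k)) • CliffordAlgebra.contractLeft (x ∘ₗ γ₁) w := by
  funext x
  rw [odd, (hasDifferential_gen l hg w x).eq]
  simp [wedge]

theorem gen_mem {n : ℕ} (l : Fin n → V₀) {g : (Fin n → ℝ) → ℝ} (hg : ContDiff ℝ ∞ g)
    (w : ExteriorAlgebra ℝ V₁) :
    (fun x : Module.Dual ℝ V₀ => g (fun k => x (l k)) • w) ∈
      space (⊤ : Submodule ℝ V₀) (⊤ : Submodule ℝ V₁) := by
  refine Submodule.subset_span ⟨n, l, g, w, fun _ => trivial, hg, ?_, rfl⟩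
  have h : Algebra.adjoin ℝ (ExteriorAlgebra.ι ℝ '' ((⊤ : Submodule ℝ V₁) : Set V₁)) = ⊤ := by
    rw [Submodule.top_coe, Set.image_univ]
    exact CliffordAlgebra.adjoin_range_ι
  rw [h]
  trivial

theorem mul_left_mem {F : Module.Dual ℝ V₀ → ExteriorAlgebra ℝ V₁}
    (hF : F ∈ space (⊤ : Submodule ℝ V₀) (⊤ : Submodule ℝ V₁)) (a : ExteriorAlgebra ℝ V₁) :
    (fun x => a * F x) ∈ space (⊤ : Submodule ℝ V₀) (⊤ : Submodule ℝ V₁) := by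
  induction hF using Submodule.span_induction with
  | mem F h =>
    obtain ⟨n, l, g, w, -, hg, -, rfl⟩ := h
    simpa only [mul_smul_comm] using gen_mem l hg (a * w)
  | zero =>
    simp only [Pi.zero_apply, mul_zero]
    exact Submodule.zero_mem _
  | add F G _ _ hF hG =>
    simp only [Pi.add_apply, mul_add]
    exact Submodule.add_mem _ hF hG
  | smul c F _ hF =>
    simp only [Pi.smul_apply, mul_smul_comm]
    exact Submodule.smul_mem _ c hF

theorem contract_mem {n : ℕ} (l : Fin n → V₀) {g : (Fin n → ℝ) → ℝ} (hg : ContDiff ℝ ∞ g)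
    (w : ExteriorAlgebra ℝ V₁) :
    (fun x : Module.Dual ℝ V₀ =>
      g (fun k => x (l k)) • CliffordAlgebra.contractLeft (x ∘ₗ γ₁) w) ∈
      space (⊤ : Submodule ℝ V₀) (⊤ : Submodule ℝ V₁) := by
  induction w using CliffordAlgebra.left_induction with
  | algebraMap r =>
    simp only [CliffordAlgebra.contractLeft_algebraMap, smul_zero]
    exact Submodule.zero_mem (space (⊤ : Submodule ℝ V₀) (⊤ : Submodule ℝ V₁))
  | add a b ha hb =>
    simp only [map_add, smul_add]
    exact Submodule.add_mem _ ha hb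
  | ι_mul a v ha =>
    simp only [CliffordAlgebra.contractLeft_ι_mul, smul_sub]
    refine Submodule.sub_mem _ ?_ ?_
    · have h := gen_mem (Fin.cons (γ₁ v) l) (g := fun y => g (fun k => y k.succ) * y 0)
        ((hg.comp (contDiff_pi.2 fun k => contDiff_apply ℝ ℝ _)).mul (contDiff_apply ℝ ℝ _)) a
      simpa [mul_smul] using h
    · simpa only [mul_smul_comm] using mul_left_mem ha (CliffordAlgebra.ι _ v)

theorem odd_add {F G : Module.Dual ℝ V₀ → ExteriorAlgebra ℝ V₁}
    (hF : F ∈ space (⊤ : Submodule ℝ V₀) (⊤ : Submodule ℝ V₁))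
    (hG : G ∈ space (⊤ : Submodule ℝ V₀) (⊤ : Submodule ℝ V₁)) :
    odd γ₀ γ₁ (F + G) = odd γ₀ γ₁ F + odd γ₀ γ₁ G := by
  funext x
  obtain ⟨τ, h⟩ := exists_hasDifferential hF x
  obtain ⟨τ', h'⟩ := exists_hasDifferential hG x
  simp only [odd, (h.add h').eq, h.eq, h'.eq, Pi.add_apply, map_add]
  abel

theorem odd_smul (c : ℝ) {F : Module.Dual ℝ V₀ → ExteriorAlgebra ℝ V₁}
    (hF : F ∈ space (⊤ : Submodule ℝ V₀) (⊤ : Submodule ℝ V₁)) :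
    odd γ₀ γ₁ (c • F) = c • odd γ₀ γ₁ F := by
  funext x
  obtain ⟨τ, h⟩ := exists_hasDifferential hF x
  simp only [odd, (h.smul c).eq, h.eq, Pi.smul_apply, map_smul, smul_add]

theorem odd_mem {F : Module.Dual ℝ V₀ → ExteriorAlgebra ℝ V₁}
    (hF : F ∈ space (⊤ : Submodule ℝ V₀) (⊤ : Submodule ℝ V₁)) :
    odd γ₀ γ₁ F ∈ space (⊤ : Submodule ℝ V₀) (⊤ : Submodule ℝ V₁) := by
  induction hF using Submodule.span_induction with
  | mem F h =>
    obtain ⟨n, l, g, w, -, hg, -, rfl⟩ := h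
    rw [odd_gen γ₀ γ₁ l hg w]
    refine Submodule.add_mem _ ?_ (contract_mem γ₁ l hg w)
    have := Submodule.sum_mem (space (⊤ : Submodule ℝ V₀) (⊤ : Submodule ℝ V₁))
      (t := Finset.univ) fun k _ => gen_mem l (contDiff_pderiv hg k)
        (ExteriorAlgebra.ι ℝ (γ₀ (l k)) * w)
    convert this using 1
    funext x
    simp
  | zero =>
    have := odd_smul γ₀ γ₁ 0 (Submodule.zero_mem (space (⊤ : Submodule ℝ V₀) (⊤ : Submodule ℝ V₁)))
    rw [zero_smul, zero_smul] at this
    rw [this]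
    exact Submodule.zero_mem _
  | add F G hF' hG' hF hG => rw [odd_add γ₀ γ₁ hF' hG']; exact Submodule.add_mem _ hF hG
  | smul c F hF' hF => rw [odd_smul γ₀ γ₁ c hF']; exact Submodule.smul_mem _ c hF

/-- `odd γ₀ γ₁` as a linear map on the algebra of all smooth superfunctions. -/
def derivation : space (⊤ : Submodule ℝ V₀) (⊤ : Submodule ℝ V₁) →ₗ[ℝ]
    space (⊤ : Submodule ℝ V₀) (⊤ : Submodule ℝ V₁) where
  toFun F := ⟨odd γ₀ γ₁ F, odd_mem γ₀ γ₁ F.2⟩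
  map_add' F G := Subtype.ext (odd_add γ₀ γ₁ F.2 G.2)
  map_smul' c F := Subtype.ext (odd_smul γ₀ γ₁ c F.2)

end

end SuperFunction

namespace TwoColumn

noncomputable section

open Equiv (Perm swap)
open Equiv.Perm (sign)
open scoped Nat

set_option linter.unusedSectionVars false

variable {D P Q R : ℕ} {W : Type*} [AddCommGroup W] [Module ℝ W]

/-- The symmetry of a tensor `f_{μ₁…μ_P | ν₁…ν_Q}` whose Young diagram has two columns of lengths
`P` and `Q`: `f` is antisymmetric in the `μ`'s and in the `ν`'s, and `f_{[μ₁…μ_P | ν₁]ν₂…ν_Q} = 0`. -/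
structure IsYoung (f : (Fin P → Fin D) → (Fin Q → Fin D) → W) : Prop where
  alt_left : ∀ (σ : Perm (Fin P)) μ ν, f (μ ∘ σ) ν = sign σ • f μ ν
  alt_right : ∀ (τ : Perm (Fin Q)) μ ν, f μ (ν ∘ τ) = sign τ • f μ ν
  garnir : ∀ (h : 0 < Q) (κ : Fin (P + 1) → Fin D) (ν : Fin Q → Fin D),
    ∑ σ : Perm (Fin (P + 1)), sign σ • f (fun k => κ (σ k.castSucc))
      (Function.update ν ⟨0, h⟩ (κ (σ (Fin.last P)))) = 0

/-- `∂_{[μ₁} f_{μ₂…μ_{P+1}] | ν₁…ν_Q}`, where `f a μ ν` stands for `∂_a f_{μ | ν}` and the brackets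
denote antisymmetrization of strength one. -/
def curlLeft (f : Fin D → (Fin P → Fin D) → (Fin Q → Fin D) → W) {P' : ℕ} (h : P' = P + 1)
    (μ : Fin P' → Fin D) (ν : Fin Q → Fin D) : W :=
  (P' ! : ℝ)⁻¹ • ∑ σ : Perm (Fin P'), sign σ •
    f (μ (σ ⟨0, by omega⟩)) (fun k => μ (σ ⟨k + 1, by omega⟩)) ν

/-- `f_{μ₁…μ_P | [ν₁…ν_{Q-1}, ν_Q]} + a f_{ν₁…ν_Q [μ_{Q+1}…μ_P | μ₁…μ_{Q-1}, μ_Q]}` with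
`a = P! / ((P - Q + 1)! Q!)`, where `f a μ ν` stands for `f_{μ | ν, a} = ∂_a f_{μ | ν}`. -/
def curlRight (f : Fin D → (Fin P → Fin D) → (Fin R → Fin D) → W) (h : Q = R + 1) (hPQ : Q ≤ P)
    (μ : Fin P → Fin D) (ν : Fin Q → Fin D) : W :=
  (Q ! : ℝ)⁻¹ • ∑ τ : Perm (Fin Q), sign τ •
    f (ν (τ ⟨R, by omega⟩)) μ (fun k => ν (τ ⟨k, by omega⟩)) +
  ((P ! : ℝ) / ((P - Q + 1)! * Q !)) • (P ! : ℝ)⁻¹ • ∑ σ : Perm (Fin P), sign σ •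
    f (μ (σ ⟨R, by omega⟩)) (fun k => if hk : k < Q then ν ⟨k, hk⟩ else μ (σ k))
      (fun k => μ (σ ⟨k, by omega⟩))

theorem alt_shift {X : Type*} [Fintype X] [DecidableEq X] (t : Perm X → W) (h : Perm X) :
    ∑ ρ, sign ρ • t (ρ * h) = sign h • ∑ ρ, sign ρ • t ρ := by
  rw [← Equiv.sum_comp (Equiv.mulRight h) (fun ρ => sign ρ • t ρ), Finset.smul_sum]
  refine Finset.sum_congr rfl fun ρ _ => ?_
  simp only [Equiv.coe_mulRight, map_mul, smul_smul]
  congr 1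
  rw [mul_comm (sign ρ), ← mul_assoc, Int.units_mul_self, one_mul]

theorem alt_shift_left {X : Type*} [Fintype X] [DecidableEq X] (t : Perm X → W) (h : Perm X) :
    ∑ ρ, sign ρ • t (h * ρ) = sign h • ∑ ρ, sign ρ • t ρ := by
  rw [← Equiv.sum_comp (Equiv.mulLeft h) (fun ρ => sign ρ • t ρ), Finset.smul_sum]
  refine Finset.sum_congr rfl fun ρ _ => ?_
  simp only [Equiv.coe_mulLeft, map_mul, smul_smul]
  rw [← mul_assoc, Int.units_mul_self, one_mul]

theorem nsmul_cancel {n : ℕ} (hn : n ≠ 0) {w : W} (h : n • w = 0) : w = 0 := by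
  rw [← Nat.cast_smul_eq_nsmul ℝ] at h
  exact (smul_eq_zero.1 h).resolve_left (by exact_mod_cast hn)

theorem sum_merge {n : ℕ} {X : Type*} [Fintype X] [DecidableEq X] (e : Fin n ↪ X)
    (t : Perm X → W) :
    ∑ ρ : Perm X, sign ρ • ∑ σ : Perm (Fin n), sign σ • t (ρ * σ.viaFintypeEmbedding e) =
      n ! • ∑ ρ : Perm X, sign ρ • t ρ := by
  simp only [Finset.smul_sum]
  rw [Finset.sum_comm]
  have h : ∀ σ : Perm (Fin n), ∑ ρ : Perm X, sign ρ • sign σ • t (ρ * σ.viaFintypeEmbedding e) =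
      ∑ ρ : Perm X, sign ρ • t ρ := by
    intro σ
    simp only [smul_comm (sign _) (sign σ)]
    rw [← Finset.smul_sum, alt_shift, Equiv.Perm.viaFintypeEmbedding_sign, smul_smul,
      Int.units_mul_self, one_smul]
  rw [Finset.sum_congr rfl fun σ _ => h σ, Finset.sum_const, Finset.card_univ, Fintype.card_perm,
    Fintype.card_fin, Finset.smul_sum]

theorem IsYoung.add {f g : (Fin P → Fin D) → (Fin Q → Fin D) → W} (hf : IsYoung f)
    (hg : IsYoung g) : IsYoung (f + g) where
  alt_left σ μ ν := by simp [hf.alt_left, hg.alt_left]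
  alt_right τ μ ν := by simp [hf.alt_right, hg.alt_right]
  garnir h κ ν := by simp [Finset.sum_add_distrib, hf.garnir h, hg.garnir h]

theorem IsYoung.smul {f : (Fin P → Fin D) → (Fin Q → Fin D) → W} (hf : IsYoung f) (c : ℝ) :
    IsYoung (c • f) where
  alt_left σ μ ν := by simp [hf.alt_left, smul_comm c]
  alt_right τ μ ν := by simp [hf.alt_right, smul_comm c]
  garnir h κ ν := by
    simp only [Pi.smul_apply, smul_comm (sign _) c]
    rw [← Finset.smul_sum, hf.garnir h, smul_zero]

theorem IsYoung.zero : IsYoung (0 : (Fin P → Fin D) → (Fin Q → Fin D) → W) where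
  alt_left σ μ ν := by simp
  alt_right τ μ ν := by simp
  garnir h κ ν := by simp

theorem curlLeft_isYoung {f : Fin D → (Fin P → Fin D) → (Fin Q → Fin D) → W}
    (hf : ∀ a, IsYoung (f a)) {P' : ℕ} (h : P' = P + 1) : IsYoung (curlLeft f h) := by
  subst h
  refine ⟨fun σ μ ν => ?_, fun τ μ ν => ?_, fun h κ ν => ?_⟩
  · have := alt_shift_left (fun ρ : Perm (Fin (P + 1)) =>
      f (μ (ρ ⟨0, by omega⟩)) (fun k => μ (ρ ⟨k + 1, by omega⟩)) ν) σ
    simp only [Equiv.Perm.mul_apply] at this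
    simp only [curlLeft, Function.comp_apply, this]
    rw [smul_comm]
  · simp only [curlLeft, (hf _).alt_right]
    simp only [smul_comm (sign _) (sign τ)]
    rw [← Finset.smul_sum, smul_comm]
  · simp only [curlLeft]
    simp only [smul_comm (sign _) (_ : ℝ)]
    rw [← Finset.smul_sum]
    convert smul_zero _
    have h1 := sum_merge (W := W) (Fin.castSuccEmb (n := P + 1)) (fun ρ : Perm (Fin (P + 1 + 1)) =>
      f (κ (ρ (Fin.castSucc ⟨0, by omega⟩)))
        (fun k : Fin P => κ (ρ (Fin.castSucc ⟨k + 1, by omega⟩)))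
        (Function.update ν ⟨0, h⟩ (κ (ρ (Fin.last _)))))
    have hc : ∀ (σ : Perm (Fin (P + 1))) k, σ.viaFintypeEmbedding Fin.castSuccEmb (Fin.castSucc k)
        = Fin.castSucc (σ k) := fun σ k =>
      Equiv.Perm.viaFintypeEmbedding_apply_image σ Fin.castSuccEmb k
    have hl : ∀ (σ : Perm (Fin (P + 1))), σ.viaFintypeEmbedding Fin.castSuccEmb (Fin.last _)
        = Fin.last _ := fun σ =>
      Equiv.Perm.viaFintypeEmbedding_apply_notMem_range σ Fin.castSuccEmb (by
        rintro ⟨k, hk⟩; exact Fin.castSucc_ne_last k hk)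
    simp only [Equiv.Perm.mul_apply, hc, hl] at h1
    rw [h1]
    convert smul_zero _
    have h2 := sum_merge (W := W) (Fin.succEmb (P + 1)) (fun ρ : Perm (Fin (P + 1 + 1)) =>
      f (κ (ρ (Fin.castSucc ⟨0, by omega⟩)))
        (fun k : Fin P => κ (ρ (Fin.castSucc ⟨k + 1, by omega⟩)))
        (Function.update ν ⟨0, h⟩ (κ (ρ (Fin.last _)))))
    have hs : ∀ (σ : Perm (Fin (P + 1))) k, σ.viaFintypeEmbedding (Fin.succEmb _) (Fin.succ k)
        = Fin.succ (σ k) := fun σ k =>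
      Equiv.Perm.viaFintypeEmbedding_apply_image σ (Fin.succEmb _) k
    have h0 : ∀ (σ : Perm (Fin (P + 1))), σ.viaFintypeEmbedding (Fin.succEmb _) 0 = 0 := fun σ =>
      Equiv.Perm.viaFintypeEmbedding_apply_notMem_range σ (Fin.succEmb _) (by
        rintro ⟨k, hk⟩; exact Fin.succ_ne_zero k hk)
    have e0 : (Fin.castSucc (⟨0, by omega⟩ : Fin (P + 1))) = 0 := rfl
    have e1 : ∀ k : Fin P, (Fin.castSucc (⟨k + 1, by omega⟩ : Fin (P + 1))) =
      Fin.succ (Fin.castSucc k) := fun k => rfl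
    have e2 : Fin.last (P + 1) = Fin.succ (Fin.last P) := rfl
    simp only [e0, e1, e2, Equiv.Perm.mul_apply, hs, h0] at h2 ⊢
    apply nsmul_cancel (Nat.factorial_ne_zero (P + 1))
    rw [← h2]
    apply Finset.sum_eq_zero
    intro ρ _
    rw [(hf _).garnir h (fun k => κ (ρ k.succ)) ν, smul_zero]


theorem sum_decompose (t : Perm (Fin (P + 1)) → W) :
    ∑ ρ, sign ρ • t ρ = ∑ e : Perm (Fin P), sign e • t (Equiv.Perm.decomposeFin.symm (0, e)) -
      ∑ l : Fin P, ∑ e : Perm (Fin P), sign e • t (Equiv.Perm.decomposeFin.symm (l.succ, e)) := by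
  rw [← Equiv.sum_comp Equiv.Perm.decomposeFin.symm, Fintype.sum_prod_type, Fin.sum_univ_succ]
  simp [Equiv.Perm.decomposeFin.symm_sign, Fin.succ_ne_zero, sub_eq_add_neg]

theorem sum_rotate (t : Perm (Fin (P + 1)) → W) :
    ∑ ρ, sign ρ • t ρ = sign (finRotate (P + 1)) • ∑ ρ, sign ρ • t (ρ * finRotate (P + 1)) := by
  rw [alt_shift, smul_smul, Int.units_mul_self, one_smul]

theorem finRotate_castSucc (k : Fin P) : finRotate (P + 1) k.castSucc = k.succ := by
  rw [finRotate_apply, Fin.coeSucc_eq_succ]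

theorem IsYoung.exchange_zero {f : (Fin P → Fin D) → (Fin (R + 1) → Fin D) → W} (hf : IsYoung f)
    (μ : Fin P → Fin D) (ν : Fin (R + 1) → Fin D) :
    f μ ν = ∑ l, f (Function.update μ l (ν 0)) (Function.update ν 0 (μ l)) := by
  have h := hf.garnir (Nat.succ_pos R) (Fin.cons (ν 0) μ : Fin (P + 1) → Fin D) ν
  rw [sum_rotate, sum_decompose] at h
  simp only [Equiv.Perm.mul_apply, finRotate_castSucc, finRotate_last,
    Equiv.Perm.decomposeFin_symm_apply_zero, Equiv.Perm.decomposeFin_symm_apply_succ,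
    Fin.cons_zero, Fin.cons_succ, Equiv.swap_self, Equiv.refl_apply] at h
  have h2 : ∀ (l : Fin P) (e : Perm (Fin P)),
      (fun k : Fin P => (Fin.cons (ν 0) μ : Fin (P + 1) → Fin D) (swap 0 l.succ (e k).succ)) =
      (Function.update μ l (ν 0)) ∘ e := by
    intro l e
    funext k
    simp only [Function.comp_apply, Function.update_apply]
    split_ifs with hk
    · rw [hk, Equiv.swap_apply_right, Fin.cons_zero]
    · rw [Equiv.swap_apply_of_ne_of_ne (Fin.succ_ne_zero _) (fun h => hk (Fin.succ_injective _ h)),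
        Fin.cons_succ]
  have h3 : ∀ e : Perm (Fin P), (fun k : Fin P => μ (e k)) = μ ∘ e := fun e => rfl
  have h4 : (⟨0, Nat.succ_pos R⟩ : Fin (R + 1)) = 0 := rfl
  simp only [h2, h3, h4, hf.alt_left, smul_smul, Int.units_mul_self, one_smul, Finset.sum_const,
    Function.update_eq_self] at h
  rw [smul_eq_zero_iff_eq, ← Finset.smul_sum, ← smul_sub] at h
  exact sub_eq_zero.1 (nsmul_cancel (by simp [Fintype.card_perm, Nat.factorial_ne_zero]) h)

theorem update_comp_swap {n : ℕ} (ν : Fin n → Fin D) (m z : Fin n) (a : Fin D) :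
    Function.update (ν ∘ swap z m) z a ∘ swap z m = Function.update ν m a := by
  funext k
  simp only [Function.comp_apply, Function.update_apply]
  by_cases hk : k = m
  · subst hk; simp
  · rw [if_neg hk, if_neg, Equiv.swap_apply_self]
    intro h
    apply hk
    rw [Equiv.swap_apply_eq_iff, Equiv.swap_apply_left] at h
    exact h

theorem IsYoung.exchange {f : (Fin P → Fin D) → (Fin Q → Fin D) → W} (hf : IsYoung f)
    (μ : Fin P → Fin D) (ν : Fin Q → Fin D) (m : Fin Q) :
    f μ ν = ∑ l, f (Function.update μ l (ν m)) (Function.update ν m (μ l)) := by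
  cases Q with
  | zero => exact m.elim0
  | succ R =>
    have h := hf.exchange_zero μ (ν ∘ swap 0 m)
    rw [hf.alt_right] at h
    have h2 : ∀ l, f (Function.update μ l (ν m)) (Function.update ν m (μ l)) =
        sign (swap 0 m) • f (Function.update μ l (ν m))
          (Function.update (ν ∘ swap 0 m) 0 (μ l)) := by
      intro l
      rw [← hf.alt_right, update_comp_swap]
    simp only [h2, ← Finset.smul_sum]
    simp only [Function.comp_apply, Equiv.swap_apply_left] at h
    rw [← h, smul_smul, Int.units_mul_self, one_smul]

theorem IsYoung.garnir' {f : (Fin P → Fin D) → (Fin Q → Fin D) → W} (hf : IsYoung f)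
    (m : Fin Q) (κ : Fin (P + 1) → Fin D) (ν : Fin Q → Fin D) :
    ∑ σ : Perm (Fin (P + 1)), sign σ • f (fun k => κ (σ k.castSucc))
      (Function.update ν m (κ (σ (Fin.last P)))) = 0 := by
  have hQ : 0 < Q := m.pos
  have h := hf.garnir hQ κ (ν ∘ swap ⟨0, hQ⟩ m)
  have h2 := congrArg (fun w => sign (swap (⟨0, hQ⟩ : Fin Q) m) • w) h
  simp only [smul_zero, Finset.smul_sum, smul_comm (sign (swap (⟨0, hQ⟩ : Fin Q) m)) (sign _),
    ← hf.alt_right, update_comp_swap] at h2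
  exact h2


/-- Exchange the first `k` letters of the two columns. -/
def exch (hR : R ≤ P) (k : ℕ) : Fin (P + 1) ⊕ Fin R → Fin (P + 1) ⊕ Fin R :=
  Sum.elim (fun l => if h : l.1 < k ∧ l.1 < R then Sum.inr ⟨l, h.2⟩ else Sum.inl l)
    (fun m => if m.1 < k then Sum.inl ⟨m, by omega⟩ else Sum.inr m)

theorem exch_involutive (hR : R ≤ P) (k : ℕ) : Function.Involutive (exch hR k) := by
  rintro (l | m)
  · by_cases h : l.1 < k ∧ l.1 < R
    · simp [exch, h]
    · simp [exch, h]
  · by_cases h : m.1 < k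
    · simp [exch, h]
    · simp [exch, h]

/-- `exch` as a permutation. -/
def exchPerm (hR : R ≤ P) (k : ℕ) : Perm (Fin (P + 1) ⊕ Fin R) := (exch_involutive hR k).toPerm

theorem exchPerm_zero (hR : R ≤ P) : exchPerm hR 0 = 1 := by
  ext x
  rcases x with l | m <;> simp [exchPerm, exch]

theorem exchPerm_succ (hR : R ≤ P) (k : ℕ) (hk : k < R) :
    exchPerm hR (k + 1) = exchPerm hR k *
      swap (Sum.inl (Fin.castSucc ⟨k, by omega⟩)) (Sum.inr ⟨k, hk⟩) := by
  apply Equiv.ext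
  rintro (l | m)
  · by_cases h : l.1 = k
    · have : l = Fin.castSucc ⟨k, by omega⟩ := Fin.ext h
      rw [this]
      simp [exchPerm, exch, hk]
    · have : (Sum.inl l : Fin (P + 1) ⊕ Fin R) ≠ Sum.inl (Fin.castSucc ⟨k, by omega⟩) := by
        intro h'; exact h (congrArg Fin.val (Sum.inl_injective h'))
      rw [Equiv.Perm.mul_apply, Equiv.swap_apply_of_ne_of_ne this (by simp)]
      have h2 : l.1 ≤ k ↔ l.1 < k := by omega
      simp [exchPerm, exch, h2]
  · by_cases h : m.1 = k
    · have : m = ⟨k, hk⟩ := Fin.ext h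
      subst this
      simp [exchPerm, exch]
    · have : (Sum.inr m : Fin (P + 1) ⊕ Fin R) ≠ Sum.inr ⟨k, hk⟩ := by
        intro h'; exact h (congrArg Fin.val (Sum.inr_injective h'))
      rw [Equiv.Perm.mul_apply, Equiv.swap_apply_of_ne_of_ne (by simp) this]
      have h2 : m.1 ≤ k ↔ m.1 < k := by omega
      simp [exchPerm, exch, h2]

theorem sum_split (k : ℕ) (hk : k ≤ P) (a b : W) :
    (∑ l : Fin P, if l.1 < k then a else b) = k • a + (P - k) • b := by
  rw [Fin.sum_univ_eq_sum_range (fun i => if i < k then a else b) P,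
    ← Finset.sum_range_add_sum_Ico _ hk,
    Finset.sum_congr rfl (g := fun _ => a) (fun i hi => if_pos (Finset.mem_range.1 hi)),
    Finset.sum_congr (s₁ := Finset.Ico k P) rfl (g := fun _ => b)
      (fun i hi => if_neg (not_lt.2 (Finset.mem_Ico.1 hi).1))]
  simp

theorem exchange_chain (hR : R ≤ P) (F : Perm (Fin (P + 1) ⊕ Fin R) → W)
    (hK : ∀ a b : Fin (P + 1), a ≠ b → ∀ π, F (swap (Sum.inl a) (Sum.inl b) * π) = -F π)
    (hN : ∀ a b : Fin R, a ≠ b → ∀ π, F (swap (Sum.inr a) (Sum.inr b) * π) = -F π)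
    (hC : ∀ a b : Fin P, a ≠ b → ∀ π,
      F (π * swap (Sum.inl a.castSucc) (Sum.inl b.castSucc)) = -F π)
    (hE : ∀ π (m : Fin R), F π = ∑ l : Fin P, F (π * swap (Sum.inl l.castSucc) (Sum.inr m)))
    (k : ℕ) (hk : k ≤ R) : k ! • F 1 = P.descFactorial k • F (exchPerm hR k) := by
  induction k with
  | zero => simp [exchPerm_zero]
  | succ k ih =>
    have hk' : k < R := hk
    set π := exchPerm hR k with hπ
    set a : Fin P := ⟨k, by omega⟩
    set m : Fin R := ⟨k, hk'⟩
    have h1 : ∀ l : Fin P, F (π * swap (Sum.inl l.castSucc) (Sum.inr m)) =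
        if l.1 < k then -F π else F (exchPerm hR (k + 1)) := by
      intro l
      have hm : π (Sum.inr m) = Sum.inr m := by simp [hπ, exchPerm, exch, m]
      split_ifs with hl
      · have hl' : π (Sum.inl l.castSucc) = Sum.inr ⟨l, by omega⟩ := by
          have : l.1 < R := by omega
          simp [hπ, exchPerm, exch, hl, this]
        rw [Equiv.mul_swap_eq_swap_mul, hm, hl', hN]
        intro h
        have := congrArg Fin.val h
        simp [m] at this
        omega
      · rw [exchPerm_succ hR k hk']
        by_cases hla : l = a
        · rw [hla]
        · have e : π * swap (Sum.inl l.castSucc) (Sum.inr m) =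
              π * swap (Sum.inl l.castSucc) (Sum.inl a.castSucc) *
                swap (Sum.inl a.castSucc) (Sum.inr m) *
                swap (Sum.inl l.castSucc) (Sum.inl a.castSucc) := by
            have := Equiv.mul_swap_eq_swap_mul
              (swap (Sum.inl l.castSucc : Fin (P + 1) ⊕ Fin R) (Sum.inl a.castSucc))
              (Sum.inl l.castSucc) (Sum.inr m)
            rw [Equiv.swap_apply_left, Equiv.swap_apply_of_ne_of_ne (by simp) (by simp)] at this
            rw [mul_assoc, ← this, mul_assoc, ← mul_assoc (swap _ _) (swap _ _) (swap _ _),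
              Equiv.swap_mul_self, one_mul]
          have hll : π (Sum.inl l.castSucc) = Sum.inl l.castSucc := by
            simp [hπ, exchPerm, exch, hl]
          have haa : π (Sum.inl a.castSucc) = Sum.inl a.castSucc := by
            simp [hπ, exchPerm, exch, a]
          rw [e, hC _ _ hla, Equiv.mul_swap_eq_swap_mul π (Sum.inl l.castSucc), hll, haa, mul_assoc, hK, neg_neg]
          intro h
          exact hla (Fin.castSucc_injective _ h)
    have h2 := hE π m
    rw [Finset.sum_congr rfl fun l _ => h1 l, sum_split k (by omega)] at h2
    have h3 : (k + 1) • F π = (P - k) • F (exchPerm hR (k + 1)) := by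
      rw [add_smul, one_smul]
      nth_rw 2 [h2]
      simp
    rw [Nat.factorial_succ, mul_smul, ih (by omega), smul_comm, h3, Nat.descFactorial_succ,
      mul_comm, mul_smul]

theorem exchange_all {B : Fin D → (Fin P → Fin D) → (Fin R → Fin D) → W}
    (hB : ∀ a, IsYoung (B a)) (hR : R < P) (κ : Fin (P + 1) → Fin D) (ν : Fin R → Fin D) :
    R ! • ∑ ρ : Perm (Fin (P + 1)), sign ρ • B (κ (ρ (Fin.last P))) (fun k => κ (ρ k.castSucc)) ν =
    P.descFactorial R • ∑ ρ : Perm (Fin (P + 1)), sign ρ • B (κ (ρ (Fin.last P)))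
      (fun l => if h : l.1 < R then ν ⟨l, h⟩ else κ (ρ l.castSucc))
      (fun k => κ (ρ (Fin.castSucc ⟨k, by omega⟩))) := by
  let x : Fin (P + 1) ⊕ Fin R → Fin D := Sum.elim κ ν
  let c : Perm (Fin (P + 1) ⊕ Fin R) → W := fun π =>
    B (x (π (Sum.inl (Fin.last P)))) (fun k => x (π (Sum.inl k.castSucc)))
      (fun m => x (π (Sum.inr m)))
  let F : Perm (Fin (P + 1) ⊕ Fin R) → W := fun π =>
    ∑ ρ : Perm (Fin (P + 1)), sign ρ • ∑ τ : Perm (Fin R), sign τ • c (Equiv.Perm.sumCongr ρ τ * π)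
  have hleft : ∀ (ρ₀ : Perm (Fin (P + 1))) (τ₀ : Perm (Fin R)) π,
      F (Equiv.Perm.sumCongr ρ₀ τ₀ * π) = sign ρ₀ • sign τ₀ • F π := by
    intro ρ₀ τ₀ π
    simp only [F, ← mul_assoc, Equiv.Perm.sumCongr_mul]
    rw [alt_shift (fun ρ => ∑ τ : Perm (Fin R), sign τ • c (Equiv.Perm.sumCongr ρ (τ * τ₀) * π)) ρ₀]
    congr 1
    rw [Finset.smul_sum]
    refine Finset.sum_congr rfl fun ρ _ => ?_
    rw [alt_shift (fun τ => c (Equiv.Perm.sumCongr ρ τ * π)) τ₀, smul_comm]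
  have hcC : ∀ a b : Fin P, a ≠ b → ∀ π,
      c (π * swap (Sum.inl a.castSucc) (Sum.inl b.castSucc)) = -c π := by
    intro a b hab π
    have e := (hB (x (π (Sum.inl (Fin.last P))))).alt_left (swap a b)
      (fun k => x (π (Sum.inl k.castSucc))) (fun m => x (π (Sum.inr m)))
    rw [Equiv.Perm.sign_swap hab, Units.neg_smul, one_smul] at e
    rw [← e]
    simp only [c, Equiv.Perm.mul_apply]
    rw [Equiv.swap_apply_of_ne_of_ne]
    · congr 1
      funext k
      have : swap (Sum.inl a.castSucc : Fin (P + 1) ⊕ Fin R) (Sum.inl b.castSucc)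
          (Sum.inl k.castSucc) = Sum.inl (swap a b k).castSucc :=
        ((Sum.inl_injective.comp (Fin.castSucc_injective P)).swap_apply a b k)
      simp only [this, Function.comp_apply]
    · exact fun h => Fin.castSucc_ne_last a (Sum.inl_injective h).symm
    · exact fun h => Fin.castSucc_ne_last b (Sum.inl_injective h).symm
  have hcE : ∀ π (m : Fin R), c π =
      ∑ l : Fin P, c (π * swap (Sum.inl l.castSucc) (Sum.inr m)) := by
    intro π m
    simp only [c]
    rw [(hB (x (π (Sum.inl (Fin.last P))))).exchange _ _ m]
    refine Finset.sum_congr rfl fun l _ => ?_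
    simp only [Equiv.Perm.mul_apply]
    rw [Equiv.swap_apply_of_ne_of_ne]
    · congr 1
      · funext k
        by_cases hk : k = l
        · subst hk; simp
        · rw [Equiv.swap_apply_of_ne_of_ne, Function.update_of_ne hk]
          · exact fun h => hk (Fin.castSucc_injective _ (Sum.inl_injective h))
          · simp
      · funext k
        by_cases hk : k = m
        · subst hk; simp
        · rw [Equiv.swap_apply_of_ne_of_ne, Function.update_of_ne hk]
          · simp
          · exact fun h => hk (Sum.inr_injective h)
    · exact fun h => Fin.castSucc_ne_last l (Sum.inl_injective h).symm
    · simp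
  have key := exchange_chain hR.le F
    (by
      intro a b hab π
      rw [← Equiv.Perm.sumCongr_swap_refl, ← Equiv.Perm.one_def, hleft, Equiv.Perm.sign_swap hab]
      simp)
    (by
      intro a b hab π
      rw [← Equiv.Perm.sumCongr_refl_swap, ← Equiv.Perm.one_def, hleft, Equiv.Perm.sign_swap hab]
      simp)
    (by
      intro a b hab π
      simp only [F, ← mul_assoc, hcC a b hab, smul_neg, Finset.sum_neg_distrib])
    (by
      intro π m
      simp only [F]
      rw [Finset.sum_comm]
      refine Finset.sum_congr rfl fun ρ _ => ?_
      rw [← Finset.smul_sum, Finset.sum_comm]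
      refine congrArg _ (Finset.sum_congr rfl fun τ _ => ?_)
      rw [← Finset.smul_sum, hcE _ m]
      simp only [mul_assoc])
    R le_rfl
  have hF1 : F 1 = R ! • ∑ ρ : Perm (Fin (P + 1)), sign ρ •
      B (κ (ρ (Fin.last P))) (fun k => κ (ρ k.castSucc)) ν := by
    simp only [F]
    rw [Finset.smul_sum]
    refine Finset.sum_congr rfl fun ρ _ => ?_
    rw [smul_comm]
    congr 1
    have h : ∀ τ : Perm (Fin R), sign τ • c (Equiv.Perm.sumCongr ρ τ * 1) =
        B (κ (ρ (Fin.last P))) (fun k => κ (ρ k.castSucc)) ν := by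
      intro τ
      have := (hB (κ (ρ (Fin.last P)))).alt_right τ (fun k => κ (ρ k.castSucc)) ν
      have h2 : c (Equiv.Perm.sumCongr ρ τ * 1) =
        B (κ (ρ (Fin.last P))) (fun k => κ (ρ k.castSucc)) (ν ∘ τ) := rfl
      rw [h2, this, smul_smul, Int.units_mul_self, one_smul]
    rw [Finset.sum_congr rfl fun τ _ => h τ, Finset.sum_const, Finset.card_univ,
      Fintype.card_perm, Fintype.card_fin]
  have hF2 : F (exchPerm hR.le R) = R ! • ∑ ρ : Perm (Fin (P + 1)), sign ρ •
      B (κ (ρ (Fin.last P))) (fun l => if h : l.1 < R then ν ⟨l, h⟩ else κ (ρ l.castSucc))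
      (fun k => κ (ρ (Fin.castSucc ⟨k, by omega⟩))) := by
    simp only [F]
    rw [Finset.smul_sum]
    refine Finset.sum_congr rfl fun ρ _ => ?_
    rw [smul_comm]
    congr 1
    have h : ∀ τ : Perm (Fin R), sign τ • c (Equiv.Perm.sumCongr ρ τ * exchPerm hR.le R) =
        B (κ (ρ (Fin.last P))) (fun l => if h : l.1 < R then ν ⟨l, h⟩ else κ (ρ l.castSucc))
          (fun k => κ (ρ (Fin.castSucc ⟨k, by omega⟩))) := by
      intro τ
      have := (hB (κ (ρ (Fin.last P)))).alt_left
        (τ.viaFintypeEmbedding (Fin.castLEEmb hR.le))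
        (fun l => if h : l.1 < R then ν ⟨l, h⟩ else κ (ρ l.castSucc))
        (fun k => κ (ρ (Fin.castSucc ⟨k, by omega⟩)))
      rw [Equiv.Perm.viaFintypeEmbedding_sign] at this
      have h2 : c (Equiv.Perm.sumCongr ρ τ * exchPerm hR.le R) =
          B (κ (ρ (Fin.last P)))
            ((fun l : Fin P => if h : l.1 < R then ν ⟨l, h⟩ else κ (ρ l.castSucc)) ∘
              (τ.viaFintypeEmbedding (Fin.castLEEmb hR.le)))
            (fun k => κ (ρ (Fin.castSucc ⟨k, by omega⟩))) := by
        simp only [c, Equiv.Perm.mul_apply]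
        congr 1
        · simp [exchPerm, exch, x, hR.not_gt]
        · funext l
          by_cases hl : l.1 < R
          · have e1 : l = Fin.castLEEmb hR.le ⟨l, hl⟩ := rfl
            have e2 : τ.viaFintypeEmbedding (Fin.castLEEmb hR.le) l =
                Fin.castLEEmb hR.le (τ ⟨l, hl⟩) := by
              conv_lhs => rw [e1]
              exact Equiv.Perm.viaFintypeEmbedding_apply_image _ _ _
            simp [exchPerm, exch, x, hl, e2]
          · have e2 : τ.viaFintypeEmbedding (Fin.castLEEmb hR.le) l = l := by
              apply Equiv.Perm.viaFintypeEmbedding_apply_notMem_range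
              rintro ⟨k, rfl⟩
              exact hl (by simp)
            simp [exchPerm, exch, x, hl, e2]
        · funext k
          simp [exchPerm, exch, x]
      rw [h2, this, smul_smul, Int.units_mul_self, one_smul]
    rw [Finset.sum_congr rfl fun τ _ => h τ, Finset.sum_const, Finset.card_univ,
      Fintype.card_perm, Fintype.card_fin]
  rw [hF1, hF2, smul_comm (P.descFactorial R), ← sub_eq_zero, ← smul_sub] at key
  exact sub_eq_zero.1 (nsmul_cancel (Nat.factorial_ne_zero R) key)

theorem curlRight_isYoung {f : Fin D → (Fin P → Fin D) → (Fin R → Fin D) → W}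
    (hf : ∀ a, IsYoung (f a)) (h : Q = R + 1) (hPQ : Q ≤ P) : IsYoung (curlRight f h hPQ) := by
  subst h
  refine ⟨fun σ μ ν => ?_, fun τ μ ν => ?_, fun h κ ν => ?_⟩
  · have h3 := alt_shift_left (fun ρ : Perm (Fin P) =>
      f (μ (ρ ⟨R, by omega⟩)) (fun k => if hk : k < R + 1 then ν ⟨k, hk⟩ else μ (ρ k))
        (fun k => μ (ρ ⟨k, by omega⟩))) σ
    simp only [Equiv.Perm.mul_apply] at h3
    simp only [curlRight, Function.comp_apply, h3, (hf _).alt_left]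
    simp only [smul_add, smul_comm (sign _) (_ : ℝ), smul_comm (sign _) (sign σ)]
    simp only [← Finset.smul_sum]
  · have h2 := alt_shift_left (fun ρ : Perm (Fin (R + 1)) =>
      f (ν (ρ ⟨R, by omega⟩)) μ (fun k => ν (ρ ⟨k, by omega⟩))) τ
    simp only [Equiv.Perm.mul_apply] at h2
    have h3 : ∀ σ : Perm (Fin P),
        f (μ (σ ⟨R, by omega⟩)) (fun k => if hk : k < R + 1 then ν (τ ⟨k, hk⟩) else μ (σ k))
          (fun k => μ (σ ⟨k, by omega⟩)) = sign τ •
        f (μ (σ ⟨R, by omega⟩)) (fun k => if hk : k < R + 1 then ν ⟨k, hk⟩ else μ (σ k))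
          (fun k => μ (σ ⟨k, by omega⟩)) := by
      intro σ
      have := (hf (μ (σ ⟨R, by omega⟩))).alt_left
        (τ.viaFintypeEmbedding (Fin.castLEEmb hPQ))
        (fun k => if hk : k.1 < R + 1 then ν ⟨k, hk⟩ else μ (σ k)) (fun k => μ (σ ⟨k, by omega⟩))
      rw [Equiv.Perm.viaFintypeEmbedding_sign] at this
      rw [← this]
      congr 1
      funext l
      by_cases hl : l.1 < R + 1
      · have e1 : l = Fin.castLEEmb hPQ ⟨l, hl⟩ := rfl
        have e2 : τ.viaFintypeEmbedding (Fin.castLEEmb hPQ) l =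
            Fin.castLEEmb hPQ (τ ⟨l, hl⟩) := by
          conv_lhs => rw [e1]
          exact Equiv.Perm.viaFintypeEmbedding_apply_image _ _ _
        have e3 : (Fin.castLEEmb hPQ (τ ⟨l, hl⟩) : Fin P).1 < R + 1 := (τ ⟨l, hl⟩).2
        simp only [Function.comp_apply, e2, dif_pos hl, dif_pos e3]
        rfl
      · have e2 : τ.viaFintypeEmbedding (Fin.castLEEmb hPQ) l = l := by
          apply Equiv.Perm.viaFintypeEmbedding_apply_notMem_range
          rintro ⟨k, rfl⟩
          exact hl k.2
        simp only [Function.comp_apply, e2, dif_neg hl]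
    simp only [curlRight, Function.comp_apply, h2, h3]
    simp only [smul_add, smul_comm (sign _) (_ : ℝ), smul_comm (sign _) (sign τ)]
    simp only [← Finset.smul_sum]
  · have hRP : R < P := hPQ
    set G₁ := ∑ ρ : Perm (Fin (P + 1)), sign ρ •
      f (κ (ρ (Fin.last P))) (fun k => κ (ρ k.castSucc)) (fun k : Fin R => ν k.succ) with hG₁
    set G₂ := ∑ ρ : Perm (Fin (P + 1)), sign ρ • f (κ (ρ (Fin.last P)))
      (fun l => if h : l.1 < R then ν (Fin.succ ⟨l, h⟩) else κ (ρ l.castSucc))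
      (fun k => κ (ρ (Fin.castSucc ⟨k, by omega⟩))) with hG₂
    have hG : R ! • G₁ = P.descFactorial R • G₂ :=
      exchange_all hf hRP κ (fun k : Fin R => ν k.succ)
    have T1 : ∑ ρ : Perm (Fin (P + 1)), sign ρ • ∑ τ : Perm (Fin (R + 1)), sign τ •
        f (Function.update ν 0 (κ (ρ (Fin.last P))) (τ (Fin.last R))) (fun k => κ (ρ k.castSucc))
          (fun k : Fin R => Function.update ν 0 (κ (ρ (Fin.last P))) (τ k.castSucc)) =
        (-1 : ℤˣ) ^ R • R ! • G₁ := by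
      have e1 : ∀ ρ : Perm (Fin (P + 1)), ∑ τ : Perm (Fin (R + 1)), sign τ •
          f (Function.update ν 0 (κ (ρ (Fin.last P))) (τ (Fin.last R)))
            (fun k => κ (ρ k.castSucc))
            (fun k : Fin R => Function.update ν 0 (κ (ρ (Fin.last P))) (τ k.castSucc)) =
          (-1 : ℤˣ) ^ R • (R ! • f (κ (ρ (Fin.last P))) (fun k => κ (ρ k.castSucc))
            (fun k : Fin R => ν k.succ) - ∑ l : Fin R, R ! • f (ν l.succ)
              (fun k => κ (ρ k.castSucc))
              (Function.update (fun k : Fin R => ν k.succ) l (κ (ρ (Fin.last P))))) := by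
        intro ρ
        rw [sum_rotate, sum_decompose, sign_finRotate]
        simp only [Equiv.Perm.mul_apply, finRotate_castSucc, finRotate_last,
          Equiv.Perm.decomposeFin_symm_apply_zero, Equiv.Perm.decomposeFin_symm_apply_succ,
          Equiv.swap_self, Equiv.refl_apply, Function.update_self, Nat.add_sub_cancel,
          Function.update_of_ne (Fin.succ_ne_zero _)]
        have h0 : ∀ (e : Perm (Fin R)) (k : Fin R), Equiv.Perm.decomposeFin.symm (0, e)
            (finRotate (R + 1) k.castSucc) = (e k).succ := by
          intro e k
          rw [finRotate_castSucc, Equiv.Perm.decomposeFin_symm_apply_succ, Equiv.swap_self,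
            Equiv.refl_apply]
        simp only [h0, Function.update_of_ne (Fin.succ_ne_zero _)]
        have h2 : ∀ (l : Fin R) (e : Perm (Fin R)),
            (fun k : Fin R => Function.update ν 0 (κ (ρ (Fin.last P)))
              (swap 0 l.succ (e k).succ)) =
            Function.update (fun k : Fin R => ν k.succ) l (κ (ρ (Fin.last P))) ∘ e := by
          intro l e
          funext k
          simp only [Function.comp_apply]
          by_cases hk : e k = l
          · rw [hk, Equiv.swap_apply_right, Function.update_self, Function.update_self]
          · rw [Equiv.swap_apply_of_ne_of_ne (Fin.succ_ne_zero _)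
              (fun h => hk (Fin.succ_injective _ h)), Function.update_of_ne hk,
              Function.update_of_ne (Fin.succ_ne_zero _)]
        have h3 : ∀ e : Perm (Fin R), (fun k : Fin R => ν (e k).succ) =
            (fun k : Fin R => ν k.succ) ∘ e := fun e => rfl
        simp only [h2, h3, (hf _).alt_right, smul_smul, Int.units_mul_self, one_smul,
          Finset.sum_const, Finset.card_univ, Fintype.card_perm, Fintype.card_fin]
      simp only [e1]
      simp only [smul_comm (sign _) ((-1 : ℤˣ) ^ R), ← Finset.smul_sum]
      congr 1
      simp only [smul_sub, Finset.sum_sub_distrib, smul_comm (sign _) (R ! : ℕ), Finset.smul_sum]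
      rw [sub_eq_self.2, ← Finset.smul_sum]
      rw [Finset.sum_comm]
      refine Finset.sum_eq_zero fun l _ => ?_
      rw [← Finset.smul_sum, (hf _).garnir' l κ, smul_zero]
    have T2 : ∑ ρ : Perm (Fin (P + 1)), sign ρ • ∑ σ : Perm (Fin P), sign σ •
        f (κ (ρ (Fin.castSucc (σ ⟨R, hRP⟩))))
          (fun k => if hk : k.1 < R + 1 then Function.update ν 0 (κ (ρ (Fin.last P))) ⟨k, hk⟩
            else κ (ρ (σ k).castSucc))
          (fun k : Fin R => κ (ρ (Fin.castSucc (σ ⟨k, by omega⟩)))) =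
        -(P ! • (-1 : ℤˣ) ^ R • G₂) := by
      have h1 := sum_merge (W := W) (Fin.castSuccEmb (n := P)) (fun ρ : Perm (Fin (P + 1)) =>
        f (κ (ρ (Fin.castSucc ⟨R, hRP⟩)))
          (fun k => if hk : k.1 < R + 1 then Function.update ν 0 (κ (ρ (Fin.last P))) ⟨k, hk⟩
            else κ (ρ k.castSucc))
          (fun k : Fin R => κ (ρ (Fin.castSucc ⟨k, by omega⟩))))
      have hc : ∀ (σ : Perm (Fin P)) k, σ.viaFintypeEmbedding Fin.castSuccEmb (Fin.castSucc k)
          = Fin.castSucc (σ k) := fun σ k =>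
        Equiv.Perm.viaFintypeEmbedding_apply_image σ Fin.castSuccEmb k
      have hl : ∀ (σ : Perm (Fin P)), σ.viaFintypeEmbedding Fin.castSuccEmb (Fin.last _)
          = Fin.last _ := fun σ =>
        Equiv.Perm.viaFintypeEmbedding_apply_notMem_range σ Fin.castSuccEmb (by
          rintro ⟨k, hk⟩; exact Fin.castSucc_ne_last k hk)
      simp only [Equiv.Perm.mul_apply, hc, hl] at h1
      rw [h1, ← smul_neg]
      congr 1
      have hne : (Fin.castSucc ⟨R, hRP⟩ : Fin (P + 1)) ≠ Fin.last P := Fin.castSucc_ne_last _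
      have h2 := alt_shift (fun ρ : Perm (Fin (P + 1)) =>
        f (κ (ρ (Fin.castSucc ⟨R, hRP⟩)))
          (fun k => if hk : k.1 < R + 1 then Function.update ν 0 (κ (ρ (Fin.last P))) ⟨k, hk⟩
            else κ (ρ k.castSucc))
          (fun k : Fin R => κ (ρ (Fin.castSucc ⟨k, by omega⟩))))
          (swap (Fin.castSucc ⟨R, hRP⟩) (Fin.last P))
      rw [Equiv.Perm.sign_swap hne, Units.neg_smul, one_smul] at h2
      rw [← neg_eq_iff_eq_neg, ← h2, hG₂, Finset.smul_sum]
      refine Finset.sum_congr rfl fun ρ _ => ?_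
      rw [smul_comm]
      congr 1
      have h3 := (hf (κ (ρ (Fin.last P)))).alt_left (Fin.cycleRange ⟨R, hRP⟩)
        (fun k => if hk : k.1 < R + 1 then
            Function.update ν 0 (κ (ρ (Fin.castSucc ⟨R, hRP⟩))) ⟨k, hk⟩
          else κ (ρ k.castSucc))
        (fun k : Fin R => κ (ρ (Fin.castSucc ⟨k, by omega⟩)))
      rw [Fin.sign_cycleRange] at h3
      have hs : ∀ k : Fin P, k.1 ≠ R → swap (Fin.castSucc ⟨R, hRP⟩) (Fin.last P) k.castSucc =
          k.castSucc := by
        intro k hk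
        refine Equiv.swap_apply_of_ne_of_ne (fun h => hk ?_) (Fin.castSucc_ne_last k)
        rw [Fin.castSucc_inj.1 h]
      have hM : (fun k : Fin P => if hk : k.1 < R + 1 then
            Function.update ν 0 (κ (ρ (Fin.castSucc ⟨R, hRP⟩))) ⟨k, hk⟩
          else κ (ρ (swap (Fin.castSucc ⟨R, hRP⟩) (Fin.last P) k.castSucc))) =
          (fun k : Fin P => if hk : k.1 < R + 1 then
            Function.update ν 0 (κ (ρ (Fin.castSucc ⟨R, hRP⟩))) ⟨k, hk⟩
          else κ (ρ k.castSucc)) := by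
        funext k
        split_ifs with hk
        · rfl
        · rw [hs k (by omega)]
      have hcol : (fun k : Fin R => κ (ρ (swap (Fin.castSucc ⟨R, hRP⟩) (Fin.last P)
          (Fin.castSucc ⟨k, by omega⟩)))) =
          fun k : Fin R => κ (ρ (Fin.castSucc ⟨k, by omega⟩)) := by
        funext k
        rw [hs _ (by simpa using k.2.ne)]
      simp only [Equiv.Perm.mul_apply, Equiv.swap_apply_left, Equiv.swap_apply_right]
      rw [hM, hcol]
      suffices hc2 : ((fun k : Fin P => if hk : k.1 < R + 1 then
            Function.update ν 0 (κ (ρ (Fin.castSucc ⟨R, hRP⟩))) ⟨k, hk⟩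
          else κ (ρ k.castSucc)) ∘ (Fin.cycleRange ⟨R, hRP⟩)) =
          fun l : Fin P => if h : l.1 < R then ν (Fin.succ ⟨l, h⟩) else κ (ρ l.castSucc) by
        rw [← hc2, h3, smul_smul, Int.units_mul_self, one_smul]
      funext l
      rcases lt_trichotomy l.1 R with hl | hl | hl
      · have e : ((Fin.cycleRange ⟨R, hRP⟩ l : Fin P) : ℕ) = l + 1 :=
          Fin.coe_cycleRange_of_lt hl
        have e' : ((Fin.cycleRange ⟨R, hRP⟩ l : Fin P) : ℕ) < R + 1 := by omega
        simp only [Function.comp_apply, dif_pos hl, dif_pos e']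
        have e3 : (⟨(Fin.cycleRange ⟨R, hRP⟩ l : Fin P), e'⟩ : Fin (R + 1)) = Fin.succ ⟨l, hl⟩ :=
          Fin.ext e
        rw [e3, Function.update_of_ne (Fin.succ_ne_zero _)]
      · have hl' : l = ⟨R, hRP⟩ := Fin.ext hl
        have : NeZero P := ⟨by omega⟩
        subst hl'
        have e : ((Fin.cycleRange ⟨R, hRP⟩ (⟨R, hRP⟩ : Fin P) : Fin P) : ℕ) = 0 := by
          rw [Fin.cycleRange_self]; rfl
        have e' : ((Fin.cycleRange ⟨R, hRP⟩ (⟨R, hRP⟩ : Fin P) : Fin P) : ℕ) < R + 1 := by omega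
        simp only [Function.comp_apply, dif_neg (lt_irrefl R), dif_pos e']
        have e3 : (⟨(Fin.cycleRange ⟨R, hRP⟩ (⟨R, hRP⟩ : Fin P) : Fin P), e'⟩ : Fin (R + 1)) = 0 :=
          Fin.ext e
        rw [e3, Function.update_self]
      · have e : Fin.cycleRange ⟨R, hRP⟩ l = l := Fin.cycleRange_of_gt hl
        simp only [Function.comp_apply, e]
        rw [dif_neg (by omega), dif_neg (by omega)]
    have T : ∑ σ : Perm (Fin (P + 1)), sign σ • curlRight f rfl hPQ (fun k => κ (σ k.castSucc))
        (Function.update ν ⟨0, h⟩ (κ (σ (Fin.last P)))) =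
        ((R + 1)! : ℝ)⁻¹ • (-1 : ℤˣ) ^ R • R ! • G₁ +
        ((P ! : ℝ) / ((P - (R + 1) + 1)! * (R + 1)!)) • (P ! : ℝ)⁻¹ •
          -(P ! • (-1 : ℤˣ) ^ R • G₂) := by
      rw [← T1, ← T2]
      simp only [curlRight, smul_add, Finset.sum_add_distrib, Finset.smul_sum,
        smul_comm (sign _) (_ : ℝ)]
      rfl
    have hd : ((P - (R + 1) + 1)! : ℝ) * P.descFactorial R = P ! := by
      have e : P - (R + 1) + 1 = P - R := by omega
      rw [e]
      exact_mod_cast Nat.factorial_mul_descFactorial hRP.le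
    rw [T, hG, smul_neg, smul_neg, ← sub_eq_add_neg, sub_eq_zero,
      ← Nat.cast_smul_eq_nsmul ℝ, ← Nat.cast_smul_eq_nsmul ℝ (P !),
      smul_comm ((-1 : ℤˣ) ^ R), smul_smul, smul_smul, smul_smul, ← hd]
    congr 1
    have h1 : ((P - (R + 1) + 1)! : ℝ) ≠ 0 := by exact_mod_cast Nat.factorial_ne_zero _
    have h2 : ((R + 1)! : ℝ) ≠ 0 := by exact_mod_cast Nat.factorial_ne_zero _
    have h3 : (P.descFactorial R : ℝ) ≠ 0 := by
      intro h0
      rw [h0, mul_zero] at hd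
      exact (Nat.cast_ne_zero.2 (Nat.factorial_ne_zero P)) hd.symm
    field_simp

/-- The left-hand sides of the equations that say that `f` has the symmetry of the two-column Young
diagram. -/
def youngRelators (f : (Fin P → Fin D) → (Fin Q → Fin D) → W) : Set W :=
  {w | ∃ (σ : Perm (Fin P)) (μ : Fin P → Fin D) (ν : Fin Q → Fin D),
    w = f (μ ∘ σ) ν - sign σ • f μ ν} ∪
  {w | ∃ (τ : Perm (Fin Q)) (μ : Fin P → Fin D) (ν : Fin Q → Fin D),
    w = f μ (ν ∘ τ) - sign τ • f μ ν} ∪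
  {w | ∃ (h : 0 < Q) (κ : Fin (P + 1) → Fin D) (ν : Fin Q → Fin D),
    w = ∑ σ : Perm (Fin (P + 1)), sign σ • f (fun k => κ (σ k.castSucc))
      (Function.update ν ⟨0, h⟩ (κ (σ (Fin.last P))))}

theorem youngRelators_map {W' : Type*} [AddCommGroup W'] [Module ℝ W'] (g : W →ₗ[ℝ] W')
    {f : (Fin P → Fin D) → (Fin Q → Fin D) → W} (hf : IsYoung fun μ ν => g (f μ ν)) {w : W}
    (hw : w ∈ youngRelators f) : g w = 0 := by
  have hs : ∀ (s : ℤˣ) (w : W), g (s • w) = s • g w := fun s w => by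
    simp [Units.smul_def]
  rcases hw with (⟨σ, μ, ν, rfl⟩ | ⟨τ, μ, ν, rfl⟩) | ⟨h, κ, ν, rfl⟩
  · rw [map_sub, hs, sub_eq_zero]
    exact hf.alt_left σ μ ν
  · rw [map_sub, hs, sub_eq_zero]
    exact hf.alt_right τ μ ν
  · simp only [map_sum, hs]
    exact hf.garnir h κ ν

theorem isYoung_of_relators {f : (Fin P → Fin D) → (Fin Q → Fin D) → W}
    (hf : ∀ w ∈ youngRelators f, w = 0) : IsYoung f where
  alt_left σ μ ν := sub_eq_zero.1 (hf _ (Or.inl (Or.inl ⟨σ, μ, ν, rfl⟩)))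
  alt_right τ μ ν := sub_eq_zero.1 (hf _ (Or.inl (Or.inr ⟨τ, μ, ν, rfl⟩)))
  garnir h κ ν := hf _ (Or.inr ⟨h, κ, ν, rfl⟩)

/-- The symbols `∂_{der} A^{(i,j)}_{μ₁…μ_{p-i} | ν₁…ν_{q-j}}` (`star = false`) and
`∂_{der} A*^{(i,j) μ₁…μ_{p-i} | ν₁…ν_{q-j}}` (`star = true`), with `0 ≤ i ≤ p - q` and `0 ≤ j ≤ q`;
`der` is the multiset of the indices of the partial derivatives. -/
structure JetVar (D p q : ℕ) where
  star : Bool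
  i : ℕ
  j : ℕ
  hi : i + q ≤ p
  hj : j ≤ q
  der : Multiset (Fin D)
  μ : Fin (p - i) → Fin D
  ν : Fin (q - j) → Fin D

/-- The Grassmann parity: `i + j` for the fields and ghosts, `i + j + 1` for the antifields
(`true` is odd). -/
def JetVar.parity {D p q : ℕ} (v : JetVar D p q) : Bool :=
  if v.star then decide (Odd (v.i + v.j + 1)) else decide (Odd (v.i + v.j))

/-- The linear relations between the symbols: every `∂_{der} A^{(i,j)}` and `∂_{der} A*^{(i,j)}` has
the symmetry of the Young diagram with two columns of lengths `p - i` and `q - j`. -/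
def relations (D p q : ℕ) : Submodule ℝ (JetVar D p q →₀ ℝ) :=
  Submodule.span ℝ {w | ∃ (star : Bool) (i j : ℕ) (hi : i + q ≤ p) (hj : j ≤ q)
    (der : Multiset (Fin D)),
    w ∈ youngRelators fun μ ν => Finsupp.single (⟨star, i, j, hi, hj, der, μ, ν⟩ : JetVar D p q) 1}

/-- The space of linear functions of the fields, ghosts, antifields and their derivatives. -/
abbrev LinearFunction (D p q : ℕ) : Type := (JetVar D p q →₀ ℝ) ⧸ relations D p q

/-- The component `∂_{der} A^{(i,j)}_{μ | ν}` or `∂_{der} A*^{(i,j) μ | ν}`. -/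
def var {D p q : ℕ} (v : JetVar D p q) : LinearFunction D p q :=
  (relations D p q).mkQ (Finsupp.single v 1)

theorem isYoung_var {D p q : ℕ} (star : Bool) (i j : ℕ) (hi : i + q ≤ p) (hj : j ≤ q)
    (der : Multiset (Fin D)) :
    IsYoung fun μ ν => var (⟨star, i, j, hi, hj, der, μ, ν⟩ : JetVar D p q) := by
  have h : ∀ w ∈ youngRelators
      (fun μ ν => Finsupp.single (⟨star, i, j, hi, hj, der, μ, ν⟩ : JetVar D p q) (1 : ℝ)),
      (relations D p q).mkQ w = 0 := by
    intro w hw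
    rw [Submodule.mkQ_apply, Submodule.Quotient.mk_eq_zero]
    exact Submodule.subset_span ⟨star, i, j, hi, hj, der, hw⟩
  have hs : ∀ (s : ℤˣ) (w : JetVar D p q →₀ ℝ), (relations D p q).mkQ (s • w) =
      s • (relations D p q).mkQ w := fun s w => by
    simp [Units.smul_def]
  refine ⟨fun σ μ ν => ?_, fun τ μ ν => ?_, fun hQ κ ν => ?_⟩
  · have := h _ (Or.inl (Or.inl ⟨σ, μ, ν, rfl⟩))
    rwa [map_sub, hs, sub_eq_zero] at this
  · have := h _ (Or.inl (Or.inr ⟨τ, μ, ν, rfl⟩))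
    rwa [map_sub, hs, sub_eq_zero] at this
  · have := h _ (Or.inr ⟨hQ, κ, ν, rfl⟩)
    rw [map_sum] at this
    simp only [hs] at this
    exact this

/-- The coefficient `b_{i,j} = (-1)^i (p - q + j + 2) / (p - i - q + j + 2)`. -/
def coeffB (p q i j : ℕ) : ℝ := (-1) ^ i * ((p : ℝ) - q + j + 2) / ((p : ℝ) - i - q + j + 2)

/-- The action of `γ` on the variables. On the antifields it is zero, and `γ A^{(i,j)}_{μ | ν}` is
`∂_{[μ₁} A^{(i+1,j)}_{μ₂…μ_{p-i}] | ν} + b_{i,j} (A^{(i,j+1)}_{μ | [ν₁…ν_{q-j-1}, ν_{q-j}]}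
+ a_{i,j} A^{(i,j+1)}_{ν₁…ν_{q-j}[μ_{q-j+1}…μ_{p-i} | μ₁…μ_{q-j-1}, μ_{q-j}]})`
with `a_{i,j} = (p-i)! / ((p-i-q+j+1)! (q-j)!)` and the convention
`A^{(p-q+1,j)} = 0 = A^{(i,q+1)}`; `γ` commutes with the partial derivatives. -/
def gammaVar {D p q : ℕ} : JetVar D p q → LinearFunction D p q
  | ⟨true, _, _, _, _, _, _, _⟩ => 0
  | ⟨false, i, j, hi, hj, der, μ, ν⟩ =>
    (if h : i + q < p then
      curlLeft (fun a μ' ν' =>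
        var (⟨false, i + 1, j, by omega, hj, a ::ₘ der, μ', ν'⟩ : JetVar D p q))
        (show p - i = p - (i + 1) + 1 by omega) μ ν
    else 0) +
    (if h : j < q then
      coeffB p q i j • curlRight (fun a μ' ν' =>
        var (⟨false, i, j + 1, hi, by omega, a ::ₘ der, μ', ν'⟩ : JetVar D p q))
        (show q - j = q - (j + 1) + 1 by omega) (show q - j ≤ p - i by omega) μ ν
    else 0)

theorem isYoung_gammaVar {D p q : ℕ} (star : Bool) (i j : ℕ) (hi : i + q ≤ p) (hj : j ≤ q)
    (der : Multiset (Fin D)) :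
    IsYoung fun μ ν => gammaVar (⟨star, i, j, hi, hj, der, μ, ν⟩ : JetVar D p q) := by
  cases star with
  | true => exact IsYoung.zero
  | false =>
    simp only [gammaVar]
    refine IsYoung.add (f := fun μ ν => _) (g := fun μ ν => _) ?_ ?_
    · by_cases h : i + q < p
      · simp only [dif_pos h]
        exact curlLeft_isYoung (fun a => isYoung_var _ _ _ _ _ _) _
      · simp only [dif_neg h]
        exact IsYoung.zero
    · by_cases h : j < q
      · simp only [dif_pos h]
        exact (curlRight_isYoung (fun a => isYoung_var _ _ _ _ _ _) _ _).smul _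
      · simp only [dif_neg h]
        exact IsYoung.zero

theorem relations_le (D p q : ℕ) :
    relations D p q ≤ LinearMap.ker (Finsupp.linearCombination ℝ (gammaVar (D := D))) := by
  refine Submodule.span_le.2 ?_
  rintro w ⟨star, i, j, hi, hj, der, hw⟩
  refine youngRelators_map _ ?_ hw
  simpa using isYoung_gammaVar star i j hi hj der

/-- The action of `γ` on the linear functions. -/
def gammaLinear (D p q : ℕ) : LinearFunction D p q →ₗ[ℝ] LinearFunction D p q :=
  (relations D p q).liftQ (Finsupp.linearCombination ℝ gammaVar) (relations_le D p q)

theorem gammaLinear_var {D p q : ℕ} (v : JetVar D p q) :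
    gammaLinear D p q (var v) = gammaVar v := by
  simp [gammaLinear, var]

/-- The linear functions of Grassmann parity `b`. -/
def sector (D p q : ℕ) (b : Bool) : Submodule ℝ (LinearFunction D p q) :=
  Submodule.span ℝ (var '' {v | v.parity = b})

theorem sign_smul_mem (S : Submodule ℝ W) (s : ℤˣ) {w : W} (hw : w ∈ S) : s • w ∈ S := by
  rw [Units.smul_def]
  exact S.toAddSubgroup.zsmul_mem hw _

theorem gammaVar_mem {D p q : ℕ} (v : JetVar D p q) : gammaVar v ∈ sector D p q (!v.parity) := by
  obtain ⟨star, i, j, hi, hj, der, μ, ν⟩ := v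
  cases star with
  | true => exact Submodule.zero_mem _
  | false =>
    have h : ∀ v : JetVar D p q, v.star = false → v.i + v.j = i + j + 1 →
        var v ∈ sector D p q
          (!(⟨false, i, j, hi, hj, der, μ, ν⟩ : JetVar D p q).parity) := by
      intro v hv hij
      refine Submodule.subset_span ⟨v, ?_, rfl⟩
      simp [JetVar.parity, hv, hij, Nat.odd_add_one]
      by_cases he : Odd (i + j)
      · have he' : ¬ Even (i + j) := Nat.not_even_iff_odd.2 he
        simp [he, he']
      · have he' : Even (i + j) := Nat.not_odd_iff_even.1 he
        simp [he, he']
    refine Submodule.add_mem _ ?_ ?_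
    · split_ifs
      · refine Submodule.smul_mem _ _ (Submodule.sum_mem _ fun σ _ => sign_smul_mem _ _ (h _ rfl ?_))
        simp only
        omega
      · exact Submodule.zero_mem _
    · split_ifs
      · refine Submodule.smul_mem _ _ (Submodule.add_mem _
          (Submodule.smul_mem _ _ (Submodule.sum_mem _ fun σ _ => sign_smul_mem _ _ (h _ rfl ?_)))
          (Submodule.smul_mem _ _ (Submodule.smul_mem _ _
            (Submodule.sum_mem _ fun σ _ => sign_smul_mem _ _ (h _ rfl ?_)))))
        · simp only
          omega
        · simp only
          omega
      · exact Submodule.zero_mem _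

theorem gammaLinear_mem {D p q : ℕ} (b : Bool) :
    ∀ w ∈ sector D p q b, gammaLinear D p q w ∈ sector D p q (!b) := by
  intro w hw
  have h : sector D p q b ≤ (sector D p q (!b)).comap (gammaLinear D p q) := by
    rw [sector, Submodule.span_le]
    rintro _ ⟨v, rfl, rfl⟩
    change gammaLinear D p q (var v) ∈ sector D p q (!v.parity)
    rw [gammaLinear_var]
    exact gammaVar_mem v
  exact h hw

/-- The local functions: smooth functions of the fields, ghosts, antifields and their derivatives up
to some finite order, with anticommuting odd variables. -/
def LocalFunction (D p q : ℕ) : Type :=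
  SuperFunction.space (⊤ : Submodule ℝ (sector D p q false)) (⊤ : Submodule ℝ (sector D p q true))

instance (D p q : ℕ) : AddCommGroup (LocalFunction D p q) :=
  inferInstanceAs (AddCommGroup (SuperFunction.space (⊤ : Submodule ℝ (sector D p q false))
    (⊤ : Submodule ℝ (sector D p q true))))

instance (D p q : ℕ) : Module ℝ (LocalFunction D p q) :=
  inferInstanceAs (Module ℝ (SuperFunction.space (⊤ : Submodule ℝ (sector D p q false))
    (⊤ : Submodule ℝ (sector D p q true))))

/-- The longitudinal differential: the odd derivation of the algebra of local functions that acts on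
the variables by `gammaVar`. -/
def gamma (D p q : ℕ) : LocalFunction D p q →ₗ[ℝ] LocalFunction D p q :=
  SuperFunction.derivation ((gammaLinear D p q).restrict (gammaLinear_mem false))
    ((gammaLinear D p q).restrict (gammaLinear_mem true))

/-- The cohomology `ker γ / im γ` (one has `im γ ⊆ ker γ` as soon as `γ ∘ γ = 0`). -/
abbrev GammaCohomology (D p q : ℕ) : Type :=
  LinearMap.ker (gamma D p q) ⧸
    (LinearMap.range (gamma D p q)).submoduleOf (LinearMap.ker (gamma D p q))

/-- The derivative `∂_{der}` of the curvature
`K_{μ₁…μ_{p+1} | ν₁…ν_{q+1}} = ∂_{[μ₁} A^{(0,0)}_{μ₂…μ_{p+1}] | [ν₁…ν_q, ν_{q+1}]}`. -/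
def curvature {D p q : ℕ} (h : q ≤ p) (der : Multiset (Fin D)) (μ : Fin (p + 1) → Fin D)
    (ν : Fin (q + 1) → Fin D) : LinearFunction D p q :=
  ((p + 1)! : ℝ)⁻¹ • ((q + 1)! : ℝ)⁻¹ •
    ∑ σ : Perm (Fin (p + 1)), ∑ τ : Perm (Fin (q + 1)), sign σ • sign τ •
      var (⟨false, 0, 0, by omega, by omega, μ (σ 0) ::ₘ ν (τ (Fin.last q)) ::ₘ der,
        fun k => μ (σ k.succ), fun k => ν (τ k.castSucc)⟩ : JetVar D p q)

/-- The curl `D⁰_{μ₁…μ_{p+1}} = (-1)^q ∂_{[μ₁} A^{(0,q)}_{μ₂…μ_{p+1}]}`. -/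
def ghostCurl {D p q : ℕ} (h : q ≤ p) (μ : Fin (p + 1) → Fin D) : LinearFunction D p q :=
  (-1 : ℝ) ^ q • ((p + 1)! : ℝ)⁻¹ • ∑ σ : Perm (Fin (p + 1)), sign σ •
    var (⟨false, 0, q, by omega, le_rfl, {μ (σ 0)}, fun k => μ (σ k.succ),
      fun k => absurd k.2 (by omega)⟩ : JetVar D p q)

/-- The four kinds of variables: the antifields and their derivatives, the curvature and its
derivatives, the undifferentiated ghost `A^{(p-q,q)}`, and the curl `D⁰` of the ghost `A^{(0,q)}`. -/
def invariantVariables (D p q : ℕ) : Set (LinearFunction D p q) :=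
  {w | ∃ v : JetVar D p q, v.star = true ∧ w = var v} ∪
  {w | ∃ (h : q ≤ p) (der : Multiset (Fin D)) (μ : Fin (p + 1) → Fin D) (ν : Fin (q + 1) → Fin D),
    w = curvature h der μ ν} ∪
  {w | ∃ v : JetVar D p q, v.star = false ∧ v.i = p - q ∧ v.j = q ∧ v.der = 0 ∧ w = var v} ∪
  {w | ∃ (h : q ≤ p) (μ : Fin (p + 1) → Fin D), w = ghostCurl h μ}

/-- The span of those of the four kinds of variables that have Grassmann parity `b`. -/
def invariantSector (D p q : ℕ) (b : Bool) : Submodule ℝ (sector D p q b) :=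
  Submodule.span ℝ {w | (w : LinearFunction D p q) ∈ invariantVariables D p q}

/-- The local functions that depend only on the four kinds of variables. -/
def invariantFunctions (D p q : ℕ) : Submodule ℝ (LocalFunction D p q) :=
  (SuperFunction.space (invariantSector D p q false) (invariantSector D p q true)).submoduleOf
    (SuperFunction.space (⊤ : Submodule ℝ (sector D p q false))
      (⊤ : Submodule ℝ (sector D p q true)))

end

end TwoColumn

/-! The derivation `gamma` maps variables to linear combinations of variables. The theorem therefore
splits into the cohomology of `gammaLinear` on linear functions and a Poincaré lemma that passes
from linear to smooth functions.

From linear to smooth. Let I be the span of the invariant variables. If I consists of closed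
elements, represents all linear cohomology and meets the exact elements only in 0, then there is a
contracting homotopy ρ with ρ² = 0, ρ = 0 on I, and 1 - (γρ + ργ) a projection onto I
(`SuperFunction.exists_isContraction`). Extend ρ to an odd derivation, put π = γρ + ργ on the
coordinates, and let F_t be F after the substitution that multiplies the image of π by t. Both t
dF_t/dt and (γρ + ργ)F_t are given by the even derivation that extends π, hence they agree. Moreover
ρF_t vanishes at t = 0 and is divisible by t. For closed F this gives F = F_0 + γ ∫₀¹ t⁻¹ ρF_t dt,
where F_0 depends on I alone. Conversely, if F depends on I alone and F = γG, then F = F_0 = γG_0 =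
0 (`IsContraction.poincare`).

Linear cohomology. Derivatives and the two columns are encoded in the Fock space S ⊗ Λ ⊗ Λ over ℝ^D,
graded by the number n of derivatives and the column lengths a, b. The Young symmetry is the
quotient by the range of `T`, which moves an index from the first column to the second (`proj_T`,
`exists_T_of_proj`). In this language γ is a⁻¹ `dL` + β `G` with `G` = `dR` + (a-b+1)⁻¹ `T'` `dL`
(`gamma_proj`). The pair `T`, `T'` generates an sl₂, so `T` is injective on degrees with b < a and
onto degrees with a < b. Together with the Koszul homotopies for `dL` and `dR` this yields two
exactness statements modulo the range of `T`, `Fock.row` and `Fock.column`.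

A closed linear function is cut into lines: tensors of shapes [p-i, q-s+i] with fixed ghost number s
and fixed n. The tensor with the shortest first column is removed first. By `row`, or by `column`
when a = q and the first part of γ is truncated, it is exact up to a change of its neighbour; the
one exception is the undifferentiated ghost A^(p-q,q) (`line_reduce`). What remains is one tensor
with a = p. It is `dL` y, which is the curl D⁰ if n = 1 and b = 0, and otherwise `dL` `dR` y', which
is exact if b < q and a derivative of the curvature if b = q (`closed_bottom`). No invariant is
exact: γv contains a ghost and a derivative, so it could only be a combination of D⁰ with q > 0, and
the same reduction applied to the undifferentiated line s = q-1 leaves zero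
(`gammaLinear_eq_zero_of_mem`). -/

namespace SuperFunction

noncomputable section

open scoped TensorProduct ContDiff

/-! ### Smooth integrals over a parameter and Hadamard's lemma -/

section Parametric

open MeasureTheory Set Topology

variable {H F : Type} [NormedAddCommGroup H] [NormedSpace ℝ H] [FiniteDimensional ℝ H]
  [NormedAddCommGroup F] [NormedSpace ℝ F]

/-- Differentiation under the integral sign is justified by domination: the partial derivative is
continuous, hence bounded on the compact product of a closed ball and [0, 1]. -/
theorem hasFDerivAt_parametric_integral {g : H × ℝ → F} (hg : ContDiff ℝ 1 g) (y₀ : H) :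
    HasFDerivAt (fun y => ∫ t in (0 : ℝ)..1, g (y, t))
      (∫ t in (0 : ℝ)..1, (fderiv ℝ g (y₀, t)).comp (ContinuousLinearMap.inl ℝ H ℝ)) y₀ := by
  have hc : Continuous fun z : H × ℝ =>
      (fderiv ℝ g z).comp (ContinuousLinearMap.inl ℝ H ℝ) :=
    (hg.continuous_fderiv (by simp)).clm_comp continuous_const
  have hK : IsCompact (Metric.closedBall y₀ 1 ×ˢ Icc (0 : ℝ) 1) :=
    (isCompact_closedBall y₀ 1).prod isCompact_Icc
  obtain ⟨M, hM⟩ := hK.bddAbove_image hc.norm.continuousOn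
  refine intervalIntegral.hasFDerivAt_integral_of_dominated_of_fderiv_le
    (F := fun y t => g (y, t))
    (F' := fun y t => (fderiv ℝ g (y, t)).comp (ContinuousLinearMap.inl ℝ H ℝ))
    (bound := fun _ => M) (Metric.closedBall_mem_nhds y₀ one_pos) ?_ ?_ ?_ ?_ ?_ ?_
  · exact Filter.Eventually.of_forall fun y =>
      (hg.continuous.comp (Continuous.prodMk_right y)).aestronglyMeasurable
  · exact (hg.continuous.comp (Continuous.prodMk_right y₀)).intervalIntegrable _ _
  · exact (hc.comp (Continuous.prodMk_right y₀)).aestronglyMeasurable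
  · refine Filter.Eventually.of_forall fun t ht y hy => ?_
    rw [uIoc_of_le zero_le_one] at ht
    exact hM ⟨(y, t), ⟨hy, Ioc_subset_Icc_self ht⟩, rfl⟩
  · exact intervalIntegrable_const
  · refine Filter.Eventually.of_forall fun t _ y _ => ?_
    exact ((hg.differentiable (by simp) (y, t)).hasFDerivAt).comp y (hasFDerivAt_prodMk_left y t)

/-- Induction on the order. The target space is quantified inside because the derivative is again
such an integral, with values in `H →L[ℝ] F`. -/
theorem contDiff_parametric_integral_nat (n : ℕ) : ∀ {F : Type} [NormedAddCommGroup F]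
    [NormedSpace ℝ F] {g : H × ℝ → F}, ContDiff ℝ ∞ g →
    ContDiff ℝ n (fun y => ∫ t in (0 : ℝ)..1, g (y, t)) := by
  induction n with
  | zero =>
    intro F _ _ g hg
    rw [Nat.cast_zero, contDiff_zero]
    exact intervalIntegral.continuous_parametric_intervalIntegral_of_continuous'
      (f := fun y t => g (y, t)) hg.continuous 0 1
  | succ n ih =>
    intro F _ _ g hg
    rw [Nat.cast_succ, contDiff_succ_iff_hasFDerivAt]
    refine ⟨_, ih (F := H →L[ℝ] F) (g := fun z =>
      (fderiv ℝ g z).comp (ContinuousLinearMap.inl ℝ H ℝ)) ?_, fun y =>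
      hasFDerivAt_parametric_integral (hg.of_le (by exact_mod_cast le_top)) y⟩
    exact (hg.fderiv_right (m := ∞) (by simp)).clm_comp contDiff_const

theorem contDiff_parametric_integral {g : H × ℝ → F} (hg : ContDiff ℝ ∞ g) :
    ContDiff ℝ ∞ (fun y => ∫ t in (0 : ℝ)..1, g (y, t)) :=
  contDiff_infty.2 fun n => contDiff_parametric_integral_nat n hg

theorem pderiv_parametric_integral {n : ℕ} {g : (Fin n → ℝ) × ℝ → ℝ} (hg : ContDiff ℝ ∞ g)
    (k : Fin n) (y : Fin n → ℝ) :
    pderiv (fun y => ∫ t in (0 : ℝ)..1, g (y, t)) k y =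
      ∫ t in (0 : ℝ)..1, pderiv (fun y => g (y, t)) k y := by
  have h1 : ContDiff ℝ 1 g := hg.of_le (by exact_mod_cast le_top)
  have hc : Continuous fun t : ℝ =>
      (fderiv ℝ g (y, t)).comp (ContinuousLinearMap.inl ℝ (Fin n → ℝ) ℝ) :=
    ((h1.continuous_fderiv (by simp)).comp (Continuous.prodMk_right y)).clm_comp continuous_const
  rw [pderiv, (hasFDerivAt_parametric_integral h1 y).fderiv,
    ContinuousLinearMap.intervalIntegral_apply (hc.intervalIntegrable 0 1)]
  refine intervalIntegral.integral_congr fun t _ => ?_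
  simp only [pderiv]
  have h2 : HasFDerivAt (fun y => g (y, t))
      ((fderiv ℝ g (y, t)).comp (ContinuousLinearMap.inl ℝ (Fin n → ℝ) ℝ)) y :=
    ((h1.differentiable (by simp) (y, t)).hasFDerivAt).comp y (hasFDerivAt_prodMk_left y t)
  rw [h2.fderiv]

/-- Hadamard's lemma in the last variable. -/
theorem exists_eq_add_mul {n : ℕ} {g : (Fin n → ℝ) × ℝ → ℝ} (hg : ContDiff ℝ ∞ g) :
    ∃ g' : (Fin n → ℝ) × ℝ → ℝ, ContDiff ℝ ∞ g' ∧ ∀ y t, g (y, t) = g (y, 0) + t * g' (y, t) := by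
  -- The quotient is the mean of the t-derivative along the segment from (y, 0) to (y, t).
  refine ⟨fun z => ∫ s in (0 : ℝ)..1, fderiv ℝ g (z.1, s * z.2) (0, 1), ?_, fun y t => ?_⟩
  · have h : ContDiff ℝ ∞ fun w : ((Fin n → ℝ) × ℝ) × ℝ =>
        fderiv ℝ g (w.1.1, w.2 * w.1.2) (0, 1) := by
      refine ((hg.fderiv_right (m := ∞) (by simp)).comp ?_).clm_apply contDiff_const
      fun_prop
    exact contDiff_parametric_integral h
  · have hd : ∀ s : ℝ, HasDerivAt (fun s => g (y, s * t)) (t * fderiv ℝ g (y, s * t) (0, 1)) s := by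
      intro s
      have h1 := (hg.differentiable (by simp) (y, s * t)).hasFDerivAt
      have h2 : HasDerivAt (fun s : ℝ => (y, s * t)) ((0 : Fin n → ℝ), t) s := by
        refine (hasDerivAt_const s y).prodMk ?_
        simpa using (hasDerivAt_id s).mul_const t
      refine (h1.comp_hasDerivAt s h2).congr_deriv ?_
      have e : ((0 : Fin n → ℝ), t) = t • ((0 : Fin n → ℝ), (1 : ℝ)) := by simp
      rw [e, map_smul, smul_eq_mul]
    have hc : Continuous fun s : ℝ => t * fderiv ℝ g (y, s * t) (0, 1) := by
      refine continuous_const.mul (((hg.continuous_fderiv (by simp)).comp ?_).clm_apply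
        continuous_const)
      fun_prop
    have := intervalIntegral.integral_eq_sub_of_hasDerivAt (fun s _ => hd s)
      (hc.intervalIntegrable 0 1)
    simp only [zero_mul, one_mul, intervalIntegral.integral_const_mul] at this
    rw [this]
    ring

end Parametric

end

end SuperFunction

/-! ### Odd derivations and their anticommutators -/

namespace SuperFunction

noncomputable section

open scoped TensorProduct ContDiff

variable {V₀ V₁ : Type*} [AddCommGroup V₀] [Module ℝ V₀] [AddCommGroup V₁] [Module ℝ V₁]

local notation "𝓢" => space (⊤ : Submodule ℝ V₀) (⊤ : Submodule ℝ V₁)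

/-- Every polynomial in the odd coordinates is built by sums and left multiplications by
coordinates. Statements about derivations thus need to be checked only on smooth functions of the
even coordinates and under multiplication by one odd coordinate. -/
theorem space_induction {P : (Module.Dual ℝ V₀ → ExteriorAlgebra ℝ V₁) → Prop}
    (base : ∀ (n : ℕ) (l : Fin n → V₀) (g : (Fin n → ℝ) → ℝ), ContDiff ℝ ∞ g →
      P fun x => g (fun k => x (l k)) • 1)
    (smul : ∀ (c : ℝ) F, F ∈ 𝓢 → P F → P (c • F))
    (add : ∀ F G, F ∈ 𝓢 → G ∈ 𝓢 → P F → P G → P (F + G))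
    (ι_mul : ∀ v F, F ∈ 𝓢 → P F → P fun x => ExteriorAlgebra.ι ℝ v * F x)
    {F : Module.Dual ℝ V₀ → ExteriorAlgebra ℝ V₁} (hF : F ∈ 𝓢) : P F := by
  induction hF using Submodule.span_induction with
  | mem F h =>
    obtain ⟨n, l, g, w, -, hg, -, rfl⟩ := h
    induction w using CliffordAlgebra.left_induction with
    | algebraMap r =>
      have h := smul r _ (gen_mem l hg 1) (base n l g hg)
      convert h using 1
      funext x
      rw [Pi.smul_apply, smul_comm, Algebra.algebraMap_eq_smul_one]
    | add a b ha hb =>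
      have h := add _ _ (gen_mem l hg a) (gen_mem l hg b) ha hb
      convert h using 1
      funext x
      rw [smul_add]
      rfl
    | ι_mul a v ha =>
      have h := ι_mul v _ (gen_mem l hg a) ha
      convert h using 1
      funext x
      rw [mul_smul_comm]
  | zero =>
    have h := smul 0 _ (gen_mem (Fin.elim0 : Fin 0 → V₀) (contDiff_const (c := (0 : ℝ))) 1)
      (base 0 Fin.elim0 (fun _ => 0) contDiff_const)
    rwa [zero_smul] at h
  | add F G hF hG h h' => exact add F G hF hG h h'
  | smul c F hF h => exact smul c F hF h

theorem HasDifferential.mul_left {F : Module.Dual ℝ V₀ → ExteriorAlgebra ℝ V₁}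
    {x : Module.Dual ℝ V₀} {τ : V₀ ⊗[ℝ] ExteriorAlgebra ℝ V₁} (h : HasDifferential F x τ)
    (a : ExteriorAlgebra ℝ V₁) :
    HasDifferential (fun x => a * F x) x (LinearMap.lTensor V₀ (LinearMap.mulLeft ℝ a) τ) := by
  intro v e
  refine (h v (e ∘ₗ LinearMap.mulLeft ℝ a)).congr_deriv ?_
  clear h
  induction τ using TensorProduct.induction_on with
  | zero => simp
  | tmul l w => simp
  | add τ τ' hτ hτ' => simp only [map_add, hτ, hτ']

theorem HasDifferential.coord_smul {F : Module.Dual ℝ V₀ → ExteriorAlgebra ℝ V₁}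
    {x : Module.Dual ℝ V₀} {τ : V₀ ⊗[ℝ] ExteriorAlgebra ℝ V₁} (h : HasDifferential F x τ) (l : V₀) :
    HasDifferential (fun x => x l • F x) x (l ⊗ₜ F x + x l • τ) := by
  intro v e
  have h1 : HasDerivAt (fun t : ℝ => (x + t • v) l) (v l) 0 := by
    simpa using ((hasDerivAt_id (0 : ℝ)).mul_const (v l)).const_add (x l)
  have h2 := (h1.mul (h v e)).congr_of_eventuallyEq
    (f₁ := fun t : ℝ => e ((x + t • v) l • F (x + t • v)))
    (Filter.Eventually.of_forall fun t => by simp)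
  refine h2.congr_deriv ?_
  simp

theorem ι_mul_mem {F : Module.Dual ℝ V₀ → ExteriorAlgebra ℝ V₁} (hF : F ∈ 𝓢) (v : V₁) :
    (fun x => ExteriorAlgebra.ι ℝ v * F x) ∈ 𝓢 :=
  mul_left_mem hF _

theorem coord_smul_mem {F : Module.Dual ℝ V₀ → ExteriorAlgebra ℝ V₁} (hF : F ∈ 𝓢) (l : V₀) :
    (fun x => x l • F x) ∈ 𝓢 := by
  refine space_induction (P := fun F => (fun x => x l • F x) ∈ 𝓢) ?_ ?_ ?_ ?_ hF
  · intro n l' g hg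
    have h := gen_mem (V₁ := V₁) (Fin.cons l l') (g := fun y => y 0 * g (fun k => y k.succ))
      ((contDiff_apply ℝ ℝ _).mul (hg.comp (contDiff_pi.2 fun k => contDiff_apply ℝ ℝ _))) 1
    simpa [mul_smul] using h
  · intro c F _ h
    have := Submodule.smul_mem _ c h
    convert this using 1
    funext x
    simp [smul_comm c]
  · intro F G _ _ h h'
    have := Submodule.add_mem _ h h'
    convert this using 1
    funext x
    simp
  · intro v F _ h
    simpa only [mul_smul_comm] using ι_mul_mem h v

section Odd

variable (γ₀ : V₀ →ₗ[ℝ] V₁) (γ₁ : V₁ →ₗ[ℝ] V₀)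

theorem wedge_lTensor_ι (v : V₁) (τ : V₀ ⊗[ℝ] ExteriorAlgebra ℝ V₁) :
    wedge γ₀ (LinearMap.lTensor V₀ (LinearMap.mulLeft ℝ (ExteriorAlgebra.ι ℝ v)) τ) =
      -(ExteriorAlgebra.ι ℝ v * wedge γ₀ τ) := by
  induction τ using TensorProduct.induction_on with
  | zero => simp
  | tmul l w =>
    simp only [wedge, LinearMap.lTensor_tmul, TensorProduct.lift.tmul, LinearMap.comp_apply,
      LinearMap.mul_apply', LinearMap.mulLeft_apply, ← mul_assoc]
    rw [eq_neg_iff_add_eq_zero, ← add_mul, ExteriorAlgebra.ι_add_mul_swap, zero_mul]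
  | add τ τ' h h' => simp only [map_add, h, h', mul_add, neg_add]

/-- The graded Leibniz rule. Both halves of the derivation contribute the sign: the differential
produces a one-form that anticommutes with `v`, and the contraction is an antiderivation. -/
theorem odd_ι_mul {F : Module.Dual ℝ V₀ → ExteriorAlgebra ℝ V₁} (hF : F ∈ 𝓢) (v : V₁) :
    odd γ₀ γ₁ (fun x => ExteriorAlgebra.ι ℝ v * F x) =
      fun x => x (γ₁ v) • F x - ExteriorAlgebra.ι ℝ v * odd γ₀ γ₁ F x := by
  funext x
  obtain ⟨τ, h⟩ := exists_hasDifferential hF x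
  rw [odd, (h.mul_left _).eq, odd, h.eq, wedge_lTensor_ι, CliffordAlgebra.contractLeft_ι_mul,
    mul_add]
  simp only [LinearMap.comp_apply]
  abel

theorem odd_coord_smul {F : Module.Dual ℝ V₀ → ExteriorAlgebra ℝ V₁} (hF : F ∈ 𝓢) (l : V₀) :
    odd γ₀ γ₁ (fun x => x l • F x) =
      fun x => ExteriorAlgebra.ι ℝ (γ₀ l) * F x + x l • odd γ₀ γ₁ F x := by
  funext x
  obtain ⟨τ, h⟩ := exists_hasDifferential hF x
  rw [odd, (h.coord_smul l).eq, odd, h.eq]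
  simp [wedge, smul_add, add_assoc]

theorem odd_neg {F : Module.Dual ℝ V₀ → ExteriorAlgebra ℝ V₁} (hF : F ∈ 𝓢) :
    odd γ₀ γ₁ (-F) = -odd γ₀ γ₁ F := by
  have := odd_smul γ₀ γ₁ (-1) hF
  simpa using this

theorem odd_sub {F G : Module.Dual ℝ V₀ → ExteriorAlgebra ℝ V₁} (hF : F ∈ 𝓢) (hG : G ∈ 𝓢) :
    odd γ₀ γ₁ (F - G) = odd γ₀ γ₁ F - odd γ₀ γ₁ G := by
  rw [sub_eq_add_neg, odd_add γ₀ γ₁ hF (Submodule.neg_mem _ hG), odd_neg γ₀ γ₁ hG, sub_eq_add_neg]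

theorem odd_sum {ι : Type*} (s : Finset ι) {F : ι → Module.Dual ℝ V₀ → ExteriorAlgebra ℝ V₁}
    (hF : ∀ i ∈ s, F i ∈ 𝓢) : odd γ₀ γ₁ (∑ i ∈ s, F i) = ∑ i ∈ s, odd γ₀ γ₁ (F i) := by
  classical
  induction s using Finset.induction_on with
  | empty =>
    have := odd_smul γ₀ γ₁ 0 (Submodule.zero_mem 𝓢)
    simpa using this
  | insert a s ha ih =>
    rw [Finset.sum_insert ha, Finset.sum_insert ha, odd_add γ₀ γ₁ (hF a (by simp))
      (Submodule.sum_mem _ fun i hi => hF i (by simp [hi])), ih fun i hi => hF i (by simp [hi])]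

theorem pderiv_comm {n : ℕ} {g : (Fin n → ℝ) → ℝ} (hg : ContDiff ℝ ∞ g) (j k : Fin n)
    (y : Fin n → ℝ) : pderiv (pderiv g k) j y = pderiv (pderiv g j) k y := by
  have h : ∀ j k : Fin n, pderiv (pderiv g k) j y =
      fderiv ℝ (fderiv ℝ g) y (Pi.single j 1) (Pi.single k 1) := by
    intro j k
    have hd : DifferentiableAt ℝ (fderiv ℝ g) y :=
      (hg.fderiv_right (m := ∞) (by simp)).differentiable (by simp) y
    have h := hd.hasFDerivAt.clm_apply (hasFDerivAt_const (Pi.single k (1 : ℝ) : Fin n → ℝ) y)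
    have h' : pderiv g k = fun y => fderiv ℝ g y (Pi.single k 1) := rfl
    rw [pderiv, h', h.fderiv]
    simp
  rw [h, h]
  exact (hg.contDiffAt.isSymmSndFDerivAt (by
    simp only [minSmoothness_of_isRCLikeNormedField]
    exact WithTop.coe_le_coe.2 le_top)).eq _ _

variable (ρ₀ : V₀ →ₗ[ℝ] V₁) (ρ₁ : V₁ →ₗ[ℝ] V₀)

/-- The anticommutator of two odd derivations. -/
def anticomm (F : Module.Dual ℝ V₀ → ExteriorAlgebra ℝ V₁) :
    Module.Dual ℝ V₀ → ExteriorAlgebra ℝ V₁ :=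
  odd γ₀ γ₁ (odd ρ₀ ρ₁ F) + odd ρ₀ ρ₁ (odd γ₀ γ₁ F)

theorem anticomm_add {F G : Module.Dual ℝ V₀ → ExteriorAlgebra ℝ V₁} (hF : F ∈ 𝓢) (hG : G ∈ 𝓢) :
    anticomm γ₀ γ₁ ρ₀ ρ₁ (F + G) = anticomm γ₀ γ₁ ρ₀ ρ₁ F + anticomm γ₀ γ₁ ρ₀ ρ₁ G := by
  rw [anticomm, odd_add _ _ hF hG, odd_add _ _ hF hG, odd_add _ _ (odd_mem _ _ hF) (odd_mem _ _ hG),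
    odd_add _ _ (odd_mem _ _ hF) (odd_mem _ _ hG), anticomm, anticomm]
  abel

theorem anticomm_smul (c : ℝ) {F : Module.Dual ℝ V₀ → ExteriorAlgebra ℝ V₁} (hF : F ∈ 𝓢) :
    anticomm γ₀ γ₁ ρ₀ ρ₁ (c • F) = c • anticomm γ₀ γ₁ ρ₀ ρ₁ F := by
  rw [anticomm, odd_smul _ _ c hF, odd_smul _ _ c hF, odd_smul _ _ c (odd_mem _ _ hF),
    odd_smul _ _ c (odd_mem _ _ hF), anticomm, smul_add]

/-- The cross terms, in which one derivation hits `v` and the other hits `F`, cancel between the two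
orders. The anticommutator is thus an even derivation, acting on coordinates by γρ + ργ. -/
theorem anticomm_ι_mul {F : Module.Dual ℝ V₀ → ExteriorAlgebra ℝ V₁} (hF : F ∈ 𝓢) (v : V₁) :
    anticomm γ₀ γ₁ ρ₀ ρ₁ (fun x => ExteriorAlgebra.ι ℝ v * F x) = fun x =>
      ExteriorAlgebra.ι ℝ (γ₀ (ρ₁ v) + ρ₀ (γ₁ v)) * F x +
        ExteriorAlgebra.ι ℝ v * anticomm γ₀ γ₁ ρ₀ ρ₁ F x := by
  have key : ∀ (γ₀ : V₀ →ₗ[ℝ] V₁) (γ₁ : V₁ →ₗ[ℝ] V₀) (ρ₀ : V₀ →ₗ[ℝ] V₁) (ρ₁ : V₁ →ₗ[ℝ] V₀),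
      odd γ₀ γ₁ (odd ρ₀ ρ₁ fun x => ExteriorAlgebra.ι ℝ v * F x) = fun x =>
        ExteriorAlgebra.ι ℝ (γ₀ (ρ₁ v)) * F x + x (ρ₁ v) • odd γ₀ γ₁ F x -
          (x (γ₁ v) • odd ρ₀ ρ₁ F x - ExteriorAlgebra.ι ℝ v * odd γ₀ γ₁ (odd ρ₀ ρ₁ F) x) := by
    intro γ₀ γ₁ ρ₀ ρ₁
    rw [odd_ι_mul ρ₀ ρ₁ hF]
    have := odd_sub γ₀ γ₁ (coord_smul_mem hF (ρ₁ v)) (ι_mul_mem (odd_mem ρ₀ ρ₁ hF) v)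
    rw [odd_coord_smul γ₀ γ₁ hF, odd_ι_mul γ₀ γ₁ (odd_mem ρ₀ ρ₁ hF)] at this
    exact this
  funext x
  rw [anticomm, key, key, anticomm]
  simp only [Pi.add_apply, map_add, add_mul, mul_add]
  abel

theorem odd_gen_one {n : ℕ} (l : Fin n → V₀) {g : (Fin n → ℝ) → ℝ} (hg : ContDiff ℝ ∞ g) :
    odd ρ₀ ρ₁ (fun x => g (fun k => x (l k)) • 1) =
      ∑ k, fun x => pderiv g k (fun k => x (l k)) • ExteriorAlgebra.ι ℝ (ρ₀ (l k)) := by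
  rw [odd_gen ρ₀ ρ₁ l hg]
  funext x
  simp [CliffordAlgebra.contractLeft_one]

/-- The terms with second derivatives cancel, since the Hessian is symmetric and odd coordinates
anticommute. What is left is the chain rule for an even derivation. -/
theorem anticomm_gen_one {n : ℕ} (l : Fin n → V₀) {g : (Fin n → ℝ) → ℝ} (hg : ContDiff ℝ ∞ g) :
    anticomm γ₀ γ₁ ρ₀ ρ₁ (fun x => g (fun k => x (l k)) • 1) = fun x =>
      (∑ k, pderiv g k (fun k => x (l k)) * x (γ₁ (ρ₀ (l k)) + ρ₁ (γ₀ (l k)))) • 1 := by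
  have key : ∀ (γ₀ : V₀ →ₗ[ℝ] V₁) (γ₁ : V₁ →ₗ[ℝ] V₀) (ρ₀ : V₀ →ₗ[ℝ] V₁) (ρ₁ : V₁ →ₗ[ℝ] V₀) x,
      odd γ₀ γ₁ (odd ρ₀ ρ₁ fun x => g (fun k => x (l k)) • 1) x =
        (∑ k, ∑ j, pderiv (pderiv g k) j (fun k => x (l k)) •
          (ExteriorAlgebra.ι ℝ (γ₀ (l j)) * ExteriorAlgebra.ι ℝ (ρ₀ (l k)))) +
        (∑ k, pderiv g k (fun k => x (l k)) * x (γ₁ (ρ₀ (l k)))) • 1 := by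
    intro γ₀ γ₁ ρ₀ ρ₁ x
    rw [odd_gen_one ρ₀ ρ₁ l hg, odd_sum _ _ _ fun k _ => gen_mem l (contDiff_pderiv hg k) _,
      Finset.sum_apply, Finset.sum_smul, ← Finset.sum_add_distrib]
    refine Finset.sum_congr rfl fun k _ => ?_
    rw [odd_gen γ₀ γ₁ l (contDiff_pderiv hg k)]
    simp only [CliffordAlgebra.contractLeft_ι, LinearMap.comp_apply, mul_smul]
    rw [Algebra.algebraMap_eq_smul_one]
  funext x
  rw [anticomm, Pi.add_apply, key, key]
  have h : (∑ k, ∑ j, pderiv (pderiv g k) j (fun k => x (l k)) •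
        (ExteriorAlgebra.ι ℝ (γ₀ (l j)) * ExteriorAlgebra.ι ℝ (ρ₀ (l k)))) =
      -∑ k, ∑ j, pderiv (pderiv g k) j (fun k => x (l k)) •
        (ExteriorAlgebra.ι ℝ (ρ₀ (l j)) * ExteriorAlgebra.ι ℝ (γ₀ (l k))) := by
    rw [Finset.sum_comm, ← Finset.sum_neg_distrib]
    refine Finset.sum_congr rfl fun k _ => ?_
    rw [← Finset.sum_neg_distrib]
    refine Finset.sum_congr rfl fun j _ => ?_
    rw [pderiv_comm hg, ← smul_neg]
    congr 1
    exact eq_neg_of_add_eq_zero_left (ExteriorAlgebra.ι_add_mul_swap _ _)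
  rw [h]
  simp only [map_add, mul_add, Finset.sum_add_distrib, add_smul]
  abel

/-- Twice the square is the anticommutator of γ with itself, an even derivation that vanishes on the
coordinates. -/
theorem odd_odd (h₀ : γ₁ ∘ₗ γ₀ = 0) (h₁ : γ₀ ∘ₗ γ₁ = 0)
    {F : Module.Dual ℝ V₀ → ExteriorAlgebra ℝ V₁} (hF : F ∈ 𝓢) : odd γ₀ γ₁ (odd γ₀ γ₁ F) = 0 := by
  have e₀ : ∀ v, γ₁ (γ₀ v) = 0 := LinearMap.congr_fun h₀
  have e₁ : ∀ v, γ₀ (γ₁ v) = 0 := LinearMap.congr_fun h₁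
  have h : anticomm γ₀ γ₁ γ₀ γ₁ F = 0 := by
    refine space_induction (P := fun F => anticomm γ₀ γ₁ γ₀ γ₁ F = 0) ?_ ?_ ?_ ?_ hF
    · intro n l g hg
      rw [anticomm_gen_one _ _ _ _ l hg]
      funext x
      simp [e₀]
    · intro c F hF h
      rw [anticomm_smul _ _ _ _ c hF, h, smul_zero]
    · intro F G hF hG h h'
      rw [anticomm_add _ _ _ _ hF hG, h, h', add_zero]
    · intro v F hF h
      rw [anticomm_ι_mul _ _ _ _ hF, h]
      funext x
      simp [e₁]
  rw [anticomm, ← two_smul ℝ] at h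
  exact (smul_eq_zero.1 h).resolve_left two_ne_zero

end Odd

end

end SuperFunction

/-! ### The Poincaré lemma for superfunctions -/

namespace SuperFunction

noncomputable section

open scoped TensorProduct ContDiff

variable {V₀ V₁ : Type*} [AddCommGroup V₀] [Module ℝ V₀] [AddCommGroup V₁] [Module ℝ V₁]

local notation "𝓢" => space (⊤ : Submodule ℝ V₀) (⊤ : Submodule ℝ V₁)

theorem contractLeft_map {M N : Type*} [AddCommGroup M] [Module ℝ M] [AddCommGroup N] [Module ℝ N]
    (f : M →ₗ[ℝ] N) (d : Module.Dual ℝ N) (w : ExteriorAlgebra ℝ M) :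
    CliffordAlgebra.contractLeft (Q := (0 : QuadraticForm ℝ N)) d (ExteriorAlgebra.map f w) =
      ExteriorAlgebra.map f
        (CliffordAlgebra.contractLeft (Q := (0 : QuadraticForm ℝ M)) (d ∘ₗ f) w) := by
  induction w using CliffordAlgebra.left_induction with
  | algebraMap r => simp [CliffordAlgebra.contractLeft_algebraMap]
  | add a b ha hb => simp only [map_add, ha, hb]
  | ι_mul a v ha =>
    have h := ExteriorAlgebra.map_apply_ι f v
    rw [ExteriorAlgebra.ι] at h
    rw [map_mul, h, CliffordAlgebra.contractLeft_ι_mul, CliffordAlgebra.contractLeft_ι_mul, ha,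
      map_sub, map_mul, h, map_smul, LinearMap.comp_apply]

/-- Polynomials in the odd coordinates of `S` come from the exterior algebra of `S`, where
contraction and substitution are natural. -/
theorem mem_adjoin_iff (S : Submodule ℝ V₁) (w : ExteriorAlgebra ℝ V₁) :
    w ∈ Algebra.adjoin ℝ (ExteriorAlgebra.ι ℝ '' (S : Set V₁)) ↔
      ∃ w', ExteriorAlgebra.map S.subtype w' = w := by
  have h : Algebra.adjoin ℝ (ExteriorAlgebra.ι ℝ '' (S : Set V₁)) =
      (ExteriorAlgebra.map S.subtype).range := by
    rw [← Algebra.map_top, ← CliffordAlgebra.adjoin_range_ι, AlgHom.map_adjoin]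
    congr 1
    ext w
    constructor
    · rintro ⟨v, hv, rfl⟩
      exact ⟨_, ⟨⟨v, hv⟩, rfl⟩, ExteriorAlgebra.map_apply_ι _ _⟩
    · rintro ⟨_, ⟨v, rfl⟩, rfl⟩
      exact ⟨v, v.2, (ExteriorAlgebra.map_apply_ι S.subtype v).symm⟩
  rw [h]
  rfl

theorem space_mono {S₀ T₀ : Submodule ℝ V₀} {S₁ T₁ : Submodule ℝ V₁} (h₀ : S₀ ≤ T₀) (h₁ : S₁ ≤ T₁) :
    space S₀ S₁ ≤ space T₀ T₁ := by
  refine Submodule.span_mono ?_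
  rintro F ⟨n, l, g, w, hl, hg, hw, rfl⟩
  exact ⟨n, l, g, w, fun k => h₀ (hl k), hg,
    Algebra.adjoin_mono (Set.image_mono h₁) hw, rfl⟩

/-- The pullback of superfunctions along a linear change of the coordinates. -/
def pullback (s₀ : V₀ →ₗ[ℝ] V₀) (s₁ : V₁ →ₗ[ℝ] V₁) :
    (Module.Dual ℝ V₀ → ExteriorAlgebra ℝ V₁) →ₗ[ℝ] (Module.Dual ℝ V₀ → ExteriorAlgebra ℝ V₁) where
  toFun F x := ExteriorAlgebra.map s₁ (F (x ∘ₗ s₀))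
  map_add' F G := by funext x; simp
  map_smul' c F := by funext x; simp

theorem pullback_gen (s₀ : V₀ →ₗ[ℝ] V₀) (s₁ : V₁ →ₗ[ℝ] V₁) {n : ℕ} (l : Fin n → V₀)
    (g : (Fin n → ℝ) → ℝ) (w : ExteriorAlgebra ℝ V₁) :
    pullback s₀ s₁ (fun x => g (fun k => x (l k)) • w) =
      fun x => g (fun k => x (s₀ (l k))) • ExteriorAlgebra.map s₁ w := by
  funext x
  simp [pullback]

theorem pullback_ι_mul (s₀ : V₀ →ₗ[ℝ] V₀) (s₁ : V₁ →ₗ[ℝ] V₁) (v : V₁)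
    (F : Module.Dual ℝ V₀ → ExteriorAlgebra ℝ V₁) :
    pullback s₀ s₁ (fun x => ExteriorAlgebra.ι ℝ v * F x) =
      fun x => ExteriorAlgebra.ι ℝ (s₁ v) * pullback s₀ s₁ F x := by
  funext x
  simp [pullback]

theorem pullback_mem (s₀ : V₀ →ₗ[ℝ] V₀) (s₁ : V₁ →ₗ[ℝ] V₁) {S₀ : Submodule ℝ V₀}
    {S₁ : Submodule ℝ V₁} (h₀ : ∀ v, s₀ v ∈ S₀) (h₁ : ∀ v, s₁ v ∈ S₁)
    {F : Module.Dual ℝ V₀ → ExteriorAlgebra ℝ V₁} (hF : F ∈ 𝓢) :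
    pullback s₀ s₁ F ∈ space S₀ S₁ := by
  induction hF using Submodule.span_induction with
  | mem F h =>
    obtain ⟨n, l, g, w, -, hg, -, rfl⟩ := h
    rw [pullback_gen]
    refine Submodule.subset_span ⟨n, fun k => s₀ (l k), g, _, fun k => h₀ _, hg, ?_, rfl⟩
    rw [mem_adjoin_iff]
    refine ⟨ExteriorAlgebra.map (s₁.codRestrict S₁ h₁) w, ?_⟩
    rw [← AlgHom.comp_apply, ExteriorAlgebra.map_comp_map]
    rfl
  | zero => rw [map_zero]; exact Submodule.zero_mem _
  | add F G _ _ hF hG => rw [map_add]; exact Submodule.add_mem _ hF hG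
  | smul c F _ hF => rw [map_smul]; exact Submodule.smul_mem _ c hF

theorem pullback_mem_top (s₀ : V₀ →ₗ[ℝ] V₀) (s₁ : V₁ →ₗ[ℝ] V₁)
    {F : Module.Dual ℝ V₀ → ExteriorAlgebra ℝ V₁} (hF : F ∈ 𝓢) : pullback s₀ s₁ F ∈ 𝓢 :=
  pullback_mem s₀ s₁ (fun _ => Submodule.mem_top) (fun _ => Submodule.mem_top) hF

theorem pullback_eq_self {s₀ : V₀ →ₗ[ℝ] V₀} {s₁ : V₁ →ₗ[ℝ] V₁} {S₀ : Submodule ℝ V₀}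
    {S₁ : Submodule ℝ V₁} (h₀ : ∀ v ∈ S₀, s₀ v = v) (h₁ : ∀ v ∈ S₁, s₁ v = v)
    {F : Module.Dual ℝ V₀ → ExteriorAlgebra ℝ V₁} (hF : F ∈ space S₀ S₁) :
    pullback s₀ s₁ F = F := by
  induction hF using Submodule.span_induction with
  | mem F h =>
    obtain ⟨n, l, g, w, hl, hg, hw, rfl⟩ := h
    rw [pullback_gen]
    obtain ⟨w', rfl⟩ := (mem_adjoin_iff S₁ w).1 hw
    have : s₁ ∘ₗ S₁.subtype = S₁.subtype := LinearMap.ext fun v => h₁ _ v.2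
    rw [← AlgHom.comp_apply, ExteriorAlgebra.map_comp_map, this]
    simp only [h₀ _ (hl _)]
  | zero => rw [map_zero]
  | add F G _ _ hF hG => rw [map_add, hF, hG]
  | smul c F _ hF => rw [map_smul, hF]

/-- A derivation is determined by its action on the coordinates, so a linear substitution that
commutes with γ there commutes with it on all functions. -/
theorem pullback_odd {γ₀ : V₀ →ₗ[ℝ] V₁} {γ₁ : V₁ →ₗ[ℝ] V₀} {s₀ : V₀ →ₗ[ℝ] V₀} {s₁ : V₁ →ₗ[ℝ] V₁}
    (h₀ : ∀ v, s₁ (γ₀ v) = γ₀ (s₀ v)) (h₁ : ∀ v, s₀ (γ₁ v) = γ₁ (s₁ v))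
    {F : Module.Dual ℝ V₀ → ExteriorAlgebra ℝ V₁} (hF : F ∈ 𝓢) :
    odd γ₀ γ₁ (pullback s₀ s₁ F) = pullback s₀ s₁ (odd γ₀ γ₁ F) := by
  induction hF using Submodule.span_induction with
  | mem F h =>
    obtain ⟨n, l, g, w, -, hg, -, rfl⟩ := h
    rw [pullback_gen, odd_gen γ₀ γ₁ _ hg, odd_gen γ₀ γ₁ _ hg]
    funext x
    have : (x ∘ₗ γ₁) ∘ₗ s₁ = (x ∘ₗ s₀) ∘ₗ γ₁ := LinearMap.ext fun v => by simp [h₁]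
    simp only [pullback, LinearMap.coe_mk, AddHom.coe_mk, map_add, map_sum, map_smul, map_mul,
      ExteriorAlgebra.map_apply_ι, h₀, LinearMap.comp_apply, ← this]
    congr 2
    exact contractLeft_map s₁ (x ∘ₗ γ₁) w
  | zero =>
    have := odd_smul γ₀ γ₁ 0 (Submodule.zero_mem 𝓢)
    rw [zero_smul, zero_smul] at this
    rw [map_zero, this, map_zero]
  | add F G hF' hG' hF hG =>
    rw [map_add, odd_add _ _ (pullback_mem_top _ _ hF') (pullback_mem_top _ _ hG'), hF, hG,
      odd_add _ _ hF' hG', map_add]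
  | smul c F hF' hF =>
    rw [map_smul, odd_smul _ _ _ (pullback_mem_top _ _ hF'), hF, odd_smul _ _ _ hF', map_smul]

/-- This serves twice: for γ, functions of the invariant variables are closed; for ρ, the function
ρF_t vanishes at t = 0. -/
theorem odd_eq_zero {γ₀ : V₀ →ₗ[ℝ] V₁} {γ₁ : V₁ →ₗ[ℝ] V₀} {S₀ : Submodule ℝ V₀}
    {S₁ : Submodule ℝ V₁} (h₀ : ∀ v ∈ S₀, γ₀ v = 0) (h₁ : ∀ v ∈ S₁, γ₁ v = 0)
    {F : Module.Dual ℝ V₀ → ExteriorAlgebra ℝ V₁} (hF : F ∈ space S₀ S₁) : odd γ₀ γ₁ F = 0 := by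
  have hle : space S₀ S₁ ≤ 𝓢 := space_mono le_top le_top
  induction hF using Submodule.span_induction with
  | mem F h =>
    obtain ⟨n, l, g, w, hl, hg, hw, rfl⟩ := h
    rw [odd_gen γ₀ γ₁ _ hg]
    obtain ⟨w', rfl⟩ := (mem_adjoin_iff S₁ w).1 hw
    funext x
    have : (x ∘ₗ γ₁) ∘ₗ S₁.subtype = 0 := LinearMap.ext fun v => by simp [h₁ _ v.2]
    have h2 := contractLeft_map S₁.subtype (x ∘ₗ γ₁) w'
    rw [this, map_zero, LinearMap.zero_apply, map_zero] at h2
    simp only [h₀ _ (hl _), map_zero, zero_mul, smul_zero, Finset.sum_const_zero, zero_add,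
      Pi.zero_apply]
    erw [h2]
    rw [smul_zero]
  | zero =>
    have := odd_smul γ₀ γ₁ 0 (Submodule.zero_mem 𝓢)
    rwa [zero_smul, zero_smul] at this
  | add F G hF' hG' hF hG => rw [odd_add _ _ (hle hF') (hle hG'), hF, hG, add_zero]
  | smul c F hF' hF => rw [odd_smul _ _ _ (hle hF'), hF, smul_zero]

variable (V₀ V₁) in
/-- Smooth one-parameter families of superfunctions. -/
def families : Submodule ℝ (ℝ → Module.Dual ℝ V₀ → ExteriorAlgebra ℝ V₁) :=
  Submodule.span ℝ {Φ | ∃ (n : ℕ) (l : Fin n → V₀) (g : (Fin n → ℝ) × ℝ → ℝ)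
    (w : ExteriorAlgebra ℝ V₁), ContDiff ℝ ∞ g ∧ Φ = fun t x => g (fun k => x (l k), t) • w}

theorem families_apply_mem {Φ : ℝ → Module.Dual ℝ V₀ → ExteriorAlgebra ℝ V₁}
    (hΦ : Φ ∈ families V₀ V₁) (t : ℝ) : Φ t ∈ 𝓢 := by
  induction hΦ using Submodule.span_induction with
  | mem Φ h =>
    obtain ⟨n, l, g, w, hg, rfl⟩ := h
    exact gen_mem l (g := fun y => g (y, t)) (hg.comp (contDiff_prodMk_left t)) w
  | zero => exact Submodule.zero_mem _
  | add F G _ _ hF hG => exact Submodule.add_mem _ hF hG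
  | smul c F _ hF => exact Submodule.smul_mem _ c hF

theorem families_mul_left {Φ : ℝ → Module.Dual ℝ V₀ → ExteriorAlgebra ℝ V₁}
    (hΦ : Φ ∈ families V₀ V₁) (a : ExteriorAlgebra ℝ V₁) :
    (fun t x => a * Φ t x) ∈ families V₀ V₁ := by
  induction hΦ using Submodule.span_induction with
  | mem Φ h =>
    obtain ⟨n, l, g, w, hg, rfl⟩ := h
    refine Submodule.subset_span ⟨n, l, g, a * w, hg, ?_⟩
    simp only [mul_smul_comm]
  | zero =>
    convert Submodule.zero_mem (families V₀ V₁) using 1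
    funext t x
    simp
  | add F G _ _ hF hG =>
    convert Submodule.add_mem _ hF hG using 1
    funext t x
    simp [mul_add]
  | smul c F _ hF =>
    convert Submodule.smul_mem _ c hF using 1
    funext t x
    simp

theorem families_smul {Φ : ℝ → Module.Dual ℝ V₀ → ExteriorAlgebra ℝ V₁}
    (hΦ : Φ ∈ families V₀ V₁) : (fun t => t • Φ t) ∈ families V₀ V₁ := by
  induction hΦ using Submodule.span_induction with
  | mem Φ h =>
    obtain ⟨n, l, g, w, hg, rfl⟩ := h
    refine Submodule.subset_span ⟨n, l, fun z => z.2 * g z, w, contDiff_snd.mul hg, ?_⟩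
    funext t x
    simp [mul_smul]
  | zero =>
    convert Submodule.zero_mem (families V₀ V₁) using 1
    funext t
    simp
  | add F G _ _ hF hG =>
    convert Submodule.add_mem _ hF hG using 1
    funext t x
    simp [smul_add]
  | smul c F _ hF =>
    convert Submodule.smul_mem _ c hF using 1
    funext t x
    simp [smul_comm _ c]

/-- Division by t inside smooth families; it absorbs the factor t⁻¹ that appears in the derivative
of a rescaling. -/
theorem families_hadamard {Φ : ℝ → Module.Dual ℝ V₀ → ExteriorAlgebra ℝ V₁}
    (hΦ : Φ ∈ families V₀ V₁) : ∃ Φ' ∈ families V₀ V₁, ∀ t, Φ t = Φ 0 + t • Φ' t := by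
  induction hΦ using Submodule.span_induction with
  | mem Φ h =>
    obtain ⟨n, l, g, w, hg, rfl⟩ := h
    obtain ⟨g', hg', h⟩ := exists_eq_add_mul hg
    refine ⟨_, Submodule.subset_span ⟨n, l, g', w, hg', rfl⟩, fun t => ?_⟩
    funext x
    simp only [Pi.add_apply, Pi.smul_apply, smul_smul, ← add_smul, ← h]
  | zero => exact ⟨0, Submodule.zero_mem _, fun t => by simp⟩
  | add F G _ _ hF hG =>
    obtain ⟨F', hF', h⟩ := hF
    obtain ⟨G', hG', h'⟩ := hG
    refine ⟨F' + G', Submodule.add_mem _ hF' hG', fun t => ?_⟩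
    rw [Pi.add_apply, h t, h' t, Pi.add_apply, Pi.add_apply, smul_add]
    abel
  | smul c F _ hF =>
    obtain ⟨F', hF', h⟩ := hF
    refine ⟨c • F', Submodule.smul_mem _ c hF', fun t => ?_⟩
    rw [Pi.smul_apply, h t, Pi.smul_apply, Pi.smul_apply, smul_add, smul_comm]

/-- The integral over t is formed on the coefficient functions. Since no norm on the exterior
algebra is used, the result is described by testing against linear functionals `e`. -/
theorem families_integral (γ₀ : V₀ →ₗ[ℝ] V₁) (γ₁ : V₁ →ₗ[ℝ] V₀)
    {Φ : ℝ → Module.Dual ℝ V₀ → ExteriorAlgebra ℝ V₁} (hΦ : Φ ∈ families V₀ V₁) :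
    ∃ H ∈ 𝓢, ∀ (x : Module.Dual ℝ V₀) (e : Module.Dual ℝ (ExteriorAlgebra ℝ V₁)),
      Continuous (fun t => e (Φ t x)) ∧ Continuous (fun t => e (odd γ₀ γ₁ (Φ t) x)) ∧
      e (odd γ₀ γ₁ H x) = ∫ t in (0 : ℝ)..1, e (odd γ₀ γ₁ (Φ t) x) := by
  have hmem := fun {Φ} (hΦ : Φ ∈ families V₀ V₁) (t : ℝ) => families_apply_mem hΦ t
  induction hΦ using Submodule.span_induction with
  | mem Φ h =>
    obtain ⟨n, l, g, w, hg, rfl⟩ := h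
    refine ⟨_, gen_mem l (contDiff_parametric_integral hg) w, fun x e => ?_⟩
    have hg' : ∀ t : ℝ, ContDiff ℝ ∞ fun y => g (y, t) := fun t => hg.comp (contDiff_prodMk_left t)
    have hodd := fun t : ℝ => odd_gen γ₀ γ₁ l (hg' t) w
    have hc : ∀ k y, Continuous fun t : ℝ => pderiv (fun y => g (y, t)) k y := by
      intro k y
      have h1 : ContDiff ℝ 1 g := hg.of_le (by exact_mod_cast le_top)
      have h : ∀ t, pderiv (fun y => g (y, t)) k y = fderiv ℝ g (y, t) (Pi.single k 1, 0) := by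
        intro t
        have h2 : HasFDerivAt (fun y => g (y, t))
            ((fderiv ℝ g (y, t)).comp (ContinuousLinearMap.inl ℝ (Fin n → ℝ) ℝ)) y :=
          ((h1.differentiable (by simp) (y, t)).hasFDerivAt).comp y (hasFDerivAt_prodMk_left y t)
        rw [pderiv, h2.fderiv]
        simp
      simp only [h]
      exact ((h1.continuous_fderiv (by simp)).comp (Continuous.prodMk_right y)).clm_apply
        continuous_const
    have hc0 : ∀ y : Fin n → ℝ, Continuous fun t : ℝ => g (y, t) := fun y =>
      hg.continuous.comp (Continuous.prodMk_right y)
    refine ⟨?_, ?_, ?_⟩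
    · simp only [map_smul, smul_eq_mul]
      exact (hc0 _).mul continuous_const
    · simp only [hodd, map_add, map_sum, map_smul, smul_eq_mul]
      exact (continuous_finsetSum _ fun k _ => (hc k _).mul continuous_const).add
        ((hc0 _).mul continuous_const)
    · rw [odd_gen γ₀ γ₁ l (contDiff_parametric_integral hg)]
      simp only [hodd, map_add, map_sum, map_smul, smul_eq_mul]
      rw [intervalIntegral.integral_add, intervalIntegral.integral_finsetSum]
      · simp only [intervalIntegral.integral_mul_const, pderiv_parametric_integral hg]
      · exact fun k _ => ((hc k _).mul continuous_const).intervalIntegrable _ _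
      · exact (continuous_finsetSum _ fun k _ => (hc k _).mul
          continuous_const).intervalIntegrable _ _
      · exact ((hc0 _).mul continuous_const).intervalIntegrable _ _
  | zero =>
    refine ⟨0, Submodule.zero_mem _, fun x e => ?_⟩
    have := odd_smul γ₀ γ₁ 0 (Submodule.zero_mem 𝓢)
    rw [zero_smul, zero_smul] at this
    simp [this, continuous_const]
  | add F G hF' hG' hF hG =>
    obtain ⟨H, hH, h⟩ := hF
    obtain ⟨K, hK, h'⟩ := hG
    refine ⟨H + K, Submodule.add_mem _ hH hK, fun x e => ?_⟩
    have hadd := fun t => odd_add γ₀ γ₁ (hmem hF' t) (hmem hG' t)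
    simp only [Pi.add_apply, map_add, hadd, odd_add γ₀ γ₁ hH hK]
    refine ⟨(h x e).1.add (h' x e).1, (h x e).2.1.add (h' x e).2.1, ?_⟩
    rw [intervalIntegral.integral_add ((h x e).2.1.intervalIntegrable _ _)
      ((h' x e).2.1.intervalIntegrable _ _), (h x e).2.2, (h' x e).2.2]
  | smul c F hF' hF =>
    obtain ⟨H, hH, h⟩ := hF
    refine ⟨c • H, Submodule.smul_mem _ c hH, fun x e => ?_⟩
    have hs := fun t => odd_smul γ₀ γ₁ c (hmem hF' t)
    simp only [Pi.smul_apply, map_smul, hs, odd_smul γ₀ γ₁ c hH, smul_eq_mul]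
    refine ⟨continuous_const.mul (h x e).1, continuous_const.mul (h x e).2.1, ?_⟩
    rw [intervalIntegral.integral_const_mul, (h x e).2.2]

/-- The endomorphism that multiplies the image of the projector `π` by `t`. -/
def scaling {V : Type*} [AddCommGroup V] [Module ℝ V] (π : V →ₗ[ℝ] V) (t : ℝ) : V →ₗ[ℝ] V :=
  LinearMap.id - π + t • π

theorem families_pullback (π₀ : V₀ →ₗ[ℝ] V₀) (π₁ : V₁ →ₗ[ℝ] V₁)
    {F : Module.Dual ℝ V₀ → ExteriorAlgebra ℝ V₁} (hF : F ∈ 𝓢) :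
    (fun t => pullback (scaling π₀ t) (scaling π₁ t) F) ∈ families V₀ V₁ := by
  refine space_induction (P := fun F =>
    (fun t => pullback (scaling π₀ t) (scaling π₁ t) F) ∈ families V₀ V₁) ?_ ?_ ?_ ?_ hF
  · intro n l g hg
    -- The rescaled coordinate is (l - π l) + t π l. Taking the two summands as separate coordinates
    -- moves the dependence on t into the smooth function.
    refine Submodule.subset_span ⟨n + n, Fin.append (fun k => l k - π₀ (l k)) fun k => π₀ (l k),
      fun z => g fun k => z.1 (Fin.castAdd n k) + z.2 * z.1 (Fin.natAdd n k), 1, ?_, ?_⟩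
    · refine hg.comp (contDiff_pi.2 fun k => ?_)
      fun_prop
    · funext t
      rw [pullback_gen]
      simp only [map_one, Fin.append_left, Fin.append_right]
      simp [scaling]
  · intro c F _ h
    simp only [map_smul]
    exact Submodule.smul_mem _ c h
  · intro F G _ _ h h'
    simp only [map_add]
    exact Submodule.add_mem _ h h'
  · intro v F _ h
    have h1 := families_mul_left h (ExteriorAlgebra.ι ℝ (v - π₁ v))
    have h2 := families_smul (families_mul_left h (ExteriorAlgebra.ι ℝ (π₁ v)))
    convert Submodule.add_mem _ h1 h2 using 1
    funext t x
    rw [pullback_ι_mul]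
    simp [scaling, add_mul]

/-- `ρ` is a contracting homotopy for the linear complex `γ` onto the subspaces `I₀` and `I₁`. -/
structure IsContraction (γ₀ : V₀ →ₗ[ℝ] V₁) (γ₁ : V₁ →ₗ[ℝ] V₀) (ρ₀ : V₀ →ₗ[ℝ] V₁)
    (ρ₁ : V₁ →ₗ[ℝ] V₀) (I₀ : Submodule ℝ V₀) (I₁ : Submodule ℝ V₁) : Prop where
  sq₀ : ∀ v, γ₁ (γ₀ v) = 0
  sq₁ : ∀ v, γ₀ (γ₁ v) = 0
  hsq₀ : ∀ v, ρ₁ (ρ₀ v) = 0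
  hsq₁ : ∀ v, ρ₀ (ρ₁ v) = 0
  closed₀ : ∀ v ∈ I₀, γ₀ v = 0
  closed₁ : ∀ v ∈ I₁, γ₁ v = 0
  vanish₀ : ∀ v ∈ I₀, ρ₀ v = 0
  vanish₁ : ∀ v ∈ I₁, ρ₁ v = 0
  mem₀ : ∀ v, v - (γ₁ (ρ₀ v) + ρ₁ (γ₀ v)) ∈ I₀
  mem₁ : ∀ v, v - (γ₀ (ρ₁ v) + ρ₀ (γ₁ v)) ∈ I₁

/-- The rescaling flow is generated by the even derivation that acts on coordinates as π, and by
hypothesis this is the anticommutator. Both sides obey the same Leibniz rule, so the generators of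
`space_induction` suffice. -/
theorem hasDerivAt_pullback {γ₀ : V₀ →ₗ[ℝ] V₁} {γ₁ : V₁ →ₗ[ℝ] V₀} {ρ₀ : V₀ →ₗ[ℝ] V₁}
    {ρ₁ : V₁ →ₗ[ℝ] V₀} {π₀ : V₀ →ₗ[ℝ] V₀} {π₁ : V₁ →ₗ[ℝ] V₁}
    (hπ₀ : ∀ v, γ₁ (ρ₀ v) + ρ₁ (γ₀ v) = π₀ v) (hπ₁ : ∀ v, γ₀ (ρ₁ v) + ρ₀ (γ₁ v) = π₁ v)
    (i₀ : ∀ v, π₀ (π₀ v) = π₀ v) (i₁ : ∀ v, π₁ (π₁ v) = π₁ v)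
    {F : Module.Dual ℝ V₀ → ExteriorAlgebra ℝ V₁} (hF : F ∈ 𝓢) (x : Module.Dual ℝ V₀)
    {t : ℝ} (ht : t ≠ 0) (e : Module.Dual ℝ (ExteriorAlgebra ℝ V₁)) :
    HasDerivAt (fun t => e (pullback (scaling π₀ t) (scaling π₁ t) F x))
      (t⁻¹ * e (anticomm γ₀ γ₁ ρ₀ ρ₁ (pullback (scaling π₀ t) (scaling π₁ t) F) x)) t := by
  have s₀ : ∀ v, π₀ (scaling π₀ t v) = t • π₀ v := fun v => by simp [scaling, i₀]
  have s₁ : ∀ v, π₁ (scaling π₁ t v) = t • π₁ v := fun v => by simp [scaling, i₁]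
  have hm : ∀ {F : Module.Dual ℝ V₀ → ExteriorAlgebra ℝ V₁}, F ∈ 𝓢 →
    pullback (scaling π₀ t) (scaling π₁ t) F ∈ 𝓢 := fun h => pullback_mem_top _ _ h
  revert e
  refine space_induction (P := fun F => ∀ e : Module.Dual ℝ (ExteriorAlgebra ℝ V₁),
    HasDerivAt (fun t => e (pullback (scaling π₀ t) (scaling π₁ t) F x))
      (t⁻¹ * e (anticomm γ₀ γ₁ ρ₀ ρ₁ (pullback (scaling π₀ t) (scaling π₁ t) F) x)) t)
      ?_ ?_ ?_ ?_ hF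
  · intro n l g hg e
    simp only [pullback_gen, map_one]
    rw [anticomm_gen_one _ _ _ _ _ hg]
    simp only [hπ₀, s₀, map_smul, smul_eq_mul]
    have h1 : HasDerivAt (fun t : ℝ => fun k => x (scaling π₀ t (l k))) (fun k => x (π₀ (l k))) t := by
      rw [hasDerivAt_pi]
      intro k
      simpa [scaling] using ((hasDerivAt_id t).mul_const (x (π₀ (l k)))).const_add
        (x (l k) - x (π₀ (l k)))
    have h2 := ((hg.differentiable (by simp) _).hasFDerivAt.comp_hasDerivAt t h1).mul_const (e 1)
    refine h2.congr_deriv ?_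
    rw [← mul_assoc, Finset.mul_sum]
    congr 1
    conv_lhs => rw [← Finset.univ_sum_single (fun k => x (π₀ (l k)))]
    rw [map_sum]
    refine Finset.sum_congr rfl fun k _ => ?_
    have : (Pi.single k (x (π₀ (l k))) : Fin n → ℝ) = x (π₀ (l k)) • Pi.single k 1 := by
      rw [← Pi.single_smul, smul_eq_mul, mul_one]
    rw [this, map_smul, pderiv, smul_eq_mul]
    field_simp
  · intro c F hF h e
    simp only [map_smul, Pi.smul_apply, anticomm_smul _ _ _ _ c (hm hF), smul_eq_mul]
    refine ((h e).const_mul c).congr_deriv ?_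
    ring
  · intro F G hF hG h h' e
    simp only [map_add, Pi.add_apply, anticomm_add _ _ _ _ (hm hF) (hm hG)]
    refine ((h e).add (h' e)).congr_deriv ?_
    ring
  · intro v F hF h e
    simp only [pullback_ι_mul]
    rw [anticomm_ι_mul _ _ _ _ (hm hF)]
    simp only [hπ₁, s₁, map_smul, map_add, smul_mul_assoc, smul_eq_mul]
    have e1 : ∀ t, e (ExteriorAlgebra.ι ℝ (scaling π₁ t v) *
        pullback (scaling π₀ t) (scaling π₁ t) F x) =
        (e ∘ₗ LinearMap.mulLeft ℝ (ExteriorAlgebra.ι ℝ (v - π₁ v)))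
          (pullback (scaling π₀ t) (scaling π₁ t) F x) +
        t * (e ∘ₗ LinearMap.mulLeft ℝ (ExteriorAlgebra.ι ℝ (π₁ v)))
          (pullback (scaling π₀ t) (scaling π₁ t) F x) := by
      intro t
      simp [scaling, add_mul, sub_mul]
    simp only [e1]
    refine ((h _).add ((hasDerivAt_id t).mul (h _))).congr_deriv ?_
    simp only [LinearMap.comp_apply, LinearMap.mulLeft_apply, id, scaling, LinearMap.add_apply,
      LinearMap.sub_apply, LinearMap.id_apply, LinearMap.smul_apply, map_add, map_sub, map_smul,
      add_mul, sub_mul, smul_mul_assoc, smul_eq_mul]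
    field_simp
    ring

variable {γ₀ : V₀ →ₗ[ℝ] V₁} {γ₁ : V₁ →ₗ[ℝ] V₀} {ρ₀ : V₀ →ₗ[ℝ] V₁} {ρ₁ : V₁ →ₗ[ℝ] V₀}
  {I₀ : Submodule ℝ V₀} {I₁ : Submodule ℝ V₁}

/-- Choose a complement of the range of `f` that contains `I`, project along it onto the range, and
compose with a section of `f`. -/
theorem exists_partial_inverse {V W : Type*} [AddCommGroup V] [Module ℝ V] [AddCommGroup W]
    [Module ℝ W] (f : W →ₗ[ℝ] V) {I : Submodule ℝ V} (hd : Disjoint I (LinearMap.range f)) :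
    ∃ g : V →ₗ[ℝ] W, (∀ w, f (g (f w)) = f w) ∧ (∀ v, g (f (g v)) = g v) ∧ ∀ v ∈ I, g v = 0 := by
  obtain ⟨M, hIM, hM⟩ := hd.exists_isCompl
  obtain ⟨g, hg⟩ := LinearMap.exists_rightInverse_of_surjective f.rangeRestrict
    (LinearMap.range_rangeRestrict f)
  have hg' : ∀ u, f.rangeRestrict (g u) = u := LinearMap.congr_fun hg
  have hc : ∀ w, (f.rangeRestrict w : V) = f w := fun _ => rfl
  have hp := fun u : LinearMap.range f => Submodule.projectionOnto_apply_left hM.symm u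
  refine ⟨g ∘ₗ Submodule.projectionOnto _ _ hM.symm, fun w => ?_, fun v => ?_, fun v hv => ?_⟩
  · have h := hp (f.rangeRestrict w)
    rw [hc] at h
    rw [LinearMap.comp_apply, h, ← hc, hg', hc]
  · have h := hp (f.rangeRestrict (g (Submodule.projectionOnto _ _ hM.symm v)))
    rw [hc] at h
    simp only [LinearMap.comp_apply]
    rw [h, hg']
  · rw [LinearMap.comp_apply, (Submodule.projectionOnto_apply_eq_zero_iff hM.symm).2 (hIM hv),
      map_zero]

/-- Splitting a complex over a field, with the representatives `I₀`, `I₁` of the cohomology kept in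
the kernel of the homotopy. -/
theorem exists_isContraction (sq₀ : ∀ v, γ₁ (γ₀ v) = 0) (sq₁ : ∀ v, γ₀ (γ₁ v) = 0)
    (closed₀ : ∀ v ∈ I₀, γ₀ v = 0) (closed₁ : ∀ v ∈ I₁, γ₁ v = 0)
    (exact₀ : ∀ v, γ₀ v = 0 → ∃ i ∈ I₀, ∃ w, v = i + γ₁ w)
    (exact₁ : ∀ v, γ₁ v = 0 → ∃ i ∈ I₁, ∃ w, v = i + γ₀ w)
    (d₀ : ∀ w, γ₁ w ∈ I₀ → γ₁ w = 0) (d₁ : ∀ w, γ₀ w ∈ I₁ → γ₀ w = 0) :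
    ∃ ρ₀ ρ₁, IsContraction γ₀ γ₁ ρ₀ ρ₁ I₀ I₁ := by
  obtain ⟨g₁, a₁, c₁, b₁⟩ := exists_partial_inverse γ₁ (I := I₀) (by
    rw [Submodule.disjoint_def]
    rintro _ hv ⟨w, rfl⟩
    exact d₀ w hv)
  obtain ⟨g₀, a₀, c₀, b₀⟩ := exists_partial_inverse γ₀ (I := I₁) (by
    rw [Submodule.disjoint_def]
    rintro _ hv ⟨w, rfl⟩
    exact d₁ w hv)
  -- Since γ₀ g₀ γ₀ = γ₀, the factor 1 - g₀γ₀ maps into closed elements, on which exactness up to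
  -- `I₀` applies. Since g₁γ₁g₁ = g₁, the factor 1 - g₁γ₁ also forces ρ² = 0.
  refine ⟨g₁ ∘ₗ (LinearMap.id - g₀ ∘ₗ γ₀), g₀ ∘ₗ (LinearMap.id - g₁ ∘ₗ γ₁), sq₀, sq₁, ?_, ?_,
    closed₀, closed₁, ?_, ?_, ?_, ?_⟩
  · intro v
    simp [c₁]
  · intro v
    simp [c₀]
  · intro v hv
    simp [closed₀ v hv, b₁ v hv]
  · intro v hv
    simp [closed₁ v hv, b₀ v hv]
  · intro v
    obtain ⟨i, hi, w, h⟩ := exact₀ (v - g₀ (γ₀ v)) (by rw [map_sub, a₀, sub_self])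
    have e : v - (γ₁ (g₁ (v - g₀ (γ₀ v))) + g₀ (γ₀ v)) = i := by
      rw [← sub_sub, sub_right_comm, h, map_add, map_add, b₁ i hi, map_zero, zero_add, a₁,
        add_sub_cancel_right]
    rw [← e] at hi
    simpa [sq₀] using hi
  · intro v
    obtain ⟨i, hi, w, h⟩ := exact₁ (v - g₁ (γ₁ v)) (by rw [map_sub, a₁, sub_self])
    have e : v - (γ₀ (g₀ (v - g₁ (γ₁ v))) + g₁ (γ₁ v)) = i := by
      rw [← sub_sub, sub_right_comm, h, map_add, map_add, b₀ i hi, map_zero, zero_add, a₀,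
        add_sub_cancel_right]
    rw [← e] at hi
    simpa [sq₁] using hi

/-- The Poincaré lemma: closed superfunctions are exact up to functions of the coordinates in `I₀`
and `I₁`, and these are never exact. -/
theorem IsContraction.poincare (h : IsContraction γ₀ γ₁ ρ₀ ρ₁ I₀ I₁) :
    (∀ F ∈ 𝓢, odd γ₀ γ₁ F = 0 → ∃ F₀ ∈ space I₀ I₁, ∃ H ∈ 𝓢, F = F₀ + odd γ₀ γ₁ H) ∧
    ∀ F ∈ space I₀ I₁, ∀ G ∈ 𝓢, F = odd γ₀ γ₁ G → F = 0 := by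
  set π₀ : V₀ →ₗ[ℝ] V₀ := γ₁ ∘ₗ ρ₀ + ρ₁ ∘ₗ γ₀ with hπ₀
  set π₁ : V₁ →ₗ[ℝ] V₁ := γ₀ ∘ₗ ρ₁ + ρ₀ ∘ₗ γ₁ with hπ₁
  have z₀ : ∀ v ∈ I₀, π₀ v = 0 := fun v hv => by simp [hπ₀, h.closed₀ v hv, h.vanish₀ v hv]
  have z₁ : ∀ v ∈ I₁, π₁ v = 0 := fun v hv => by simp [hπ₁, h.closed₁ v hv, h.vanish₁ v hv]
  have m₀ : ∀ v, v - π₀ v ∈ I₀ := h.mem₀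
  have m₁ : ∀ v, v - π₁ v ∈ I₁ := h.mem₁
  have i₀ : ∀ v, π₀ (π₀ v) = π₀ v := fun v => by
    have := z₀ _ (m₀ v); rw [map_sub, sub_eq_zero] at this; exact this.symm
  have i₁ : ∀ v, π₁ (π₁ v) = π₁ v := fun v => by
    have := z₁ _ (m₁ v); rw [map_sub, sub_eq_zero] at this; exact this.symm
  have s₀ : ∀ t v, scaling π₁ t (γ₀ v) = γ₀ (scaling π₀ t v) := fun t v => by
    simp [scaling, hπ₀, hπ₁, h.sq₀, h.sq₁]
  have s₁ : ∀ t v, scaling π₀ t (γ₁ v) = γ₁ (scaling π₁ t v) := fun t v => by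
    simp [scaling, hπ₀, hπ₁, h.sq₀, h.sq₁]
  have r₀ : ∀ t v, scaling π₁ t (ρ₀ v) = ρ₀ (scaling π₀ t v) := fun t v => by
    simp [scaling, hπ₀, hπ₁, h.hsq₀, h.hsq₁]
  have r₁ : ∀ t v, scaling π₀ t (ρ₁ v) = ρ₁ (scaling π₁ t v) := fun t v => by
    simp [scaling, hπ₀, hπ₁, h.hsq₀, h.hsq₁]
  have zm₀ : ∀ v, scaling π₀ 0 v ∈ I₀ := fun v => by simpa [scaling] using m₀ v
  have zm₁ : ∀ v, scaling π₁ 0 v ∈ I₁ := fun v => by simpa [scaling] using m₁ v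
  have hle : space I₀ I₁ ≤ 𝓢 := space_mono le_top le_top
  constructor
  · intro F hF hc
    refine ⟨pullback (scaling π₀ 0) (scaling π₁ 0) F, pullback_mem _ _ zm₀ zm₁ hF, ?_⟩
    -- Hadamard's lemma is applied to the rescaled ρF, which equals ρF_t and vanishes at t = 0; so
    -- ρF_t = t Φ_t.
    obtain ⟨Φ, hΦ, hΦ'⟩ := families_hadamard (families_pullback π₀ π₁ (odd_mem ρ₀ ρ₁ hF))
    have hΦt : ∀ t, odd ρ₀ ρ₁ (pullback (scaling π₀ t) (scaling π₁ t) F) = t • Φ t := by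
      intro t
      have h0 := hΦ' t
      simp only [← pullback_odd (r₀ _) (r₁ _) hF] at h0
      rw [h0, odd_eq_zero h.vanish₀ h.vanish₁ (pullback_mem _ _ zm₀ zm₁ hF), zero_add]
    obtain ⟨H, hH, hint⟩ := families_integral γ₀ γ₁ hΦ
    refine ⟨H, hH, ?_⟩
    -- As F_t is closed, only the half γρ of the anticommutator survives.
    have hA : ∀ t, anticomm γ₀ γ₁ ρ₀ ρ₁ (pullback (scaling π₀ t) (scaling π₁ t) F) =
        t • odd γ₀ γ₁ (Φ t) := by
      intro t
      have h0 := odd_smul ρ₀ ρ₁ 0 (Submodule.zero_mem 𝓢)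
      rw [zero_smul, zero_smul] at h0
      rw [anticomm, hΦt, pullback_odd (s₀ t) (s₁ t) hF, hc, map_zero, h0, add_zero,
        odd_smul _ _ _ (families_apply_mem hΦ t)]
    funext x
    rw [Pi.add_apply, ← sub_eq_iff_eq_add', ← sub_eq_zero, ← Module.forall_dual_apply_eq_zero_iff ℝ]
    intro e
    have hcont : Continuous fun t => e (pullback (scaling π₀ t) (scaling π₁ t) F x) := by
      obtain ⟨K, -, hK⟩ := families_integral γ₀ γ₁ (families_pullback π₀ π₁ hF)
      exact (hK x e).1
    -- The derivative is known only for t ≠ 0, so the fundamental theorem is used in the form that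
    -- needs continuity on [0, 1] and a derivative in the interior.
    have key := intervalIntegral.integral_eq_sub_of_hasDerivAt_of_le zero_le_one
      hcont.continuousOn (f' := fun t => e (odd γ₀ γ₁ (Φ t) x)) (fun t ht => by
        have := hasDerivAt_pullback (fun v => rfl) (fun v => rfl) i₀ i₁ hF x ht.1.ne' e
          (γ₀ := γ₀) (γ₁ := γ₁) (ρ₀ := ρ₀) (ρ₁ := ρ₁)
        refine this.congr_deriv ?_
        rw [hA, Pi.smul_apply, map_smul, smul_eq_mul, inv_mul_cancel_left₀ ht.1.ne'])
      ((hint x e).2.1.intervalIntegrable _ _)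
    rw [map_sub, (hint x e).2.2, key, map_sub]
    rw [pullback_eq_self (s₀ := scaling π₀ 1) (s₁ := scaling π₁ 1) (S₀ := ⊤) (S₁ := ⊤) (fun v _ => by simp [scaling])
      (fun v _ => by simp [scaling]) hF]
    ring
  · intro F hF G hG hFG
    -- The substitution at t = 0 fixes F and commutes with γ, so F = γ(G_0), and G_0 depends on
    -- closed coordinates only.
    have h1 : pullback (scaling π₀ 0) (scaling π₁ 0) F = F :=
      pullback_eq_self (fun v hv => by simp [scaling, z₀ v hv])
        (fun v hv => by simp [scaling, z₁ v hv]) hF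
    rw [← h1, hFG, ← pullback_odd (s₀ 0) (s₁ 0) hG]
    exact odd_eq_zero h.closed₀ h.closed₁ (pullback_mem _ _ zm₀ zm₁ hG)

end

end SuperFunction

/-! ### The Fock space of derivatives and columns, and its bilinear operators -/

namespace Fock

noncomputable section

open scoped TensorProduct

variable (D : ℕ)

/-- The exterior algebra of `ℝ^D`. -/
abbrev Ext : Type := ExteriorAlgebra ℝ (Fin D → ℝ)

/-- The Fock space of one bosonic and two (mutually commuting) fermionic oscillators with `D`
components. -/
abbrev Space : Type := (Multiset (Fin D) →₀ ℝ) ⊗[ℝ] (Ext D ⊗[ℝ] Ext D)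

variable {D}

instance : AddCommGroup (Space D) := TensorProduct.addCommGroup

instance : Ring (Module.End ℝ (Space D)) := Module.End.instRing

/-- The bosonic creation operator. -/
def bosonUp (c : Fin D) : Module.End ℝ (Multiset (Fin D) →₀ ℝ) :=
  Finsupp.lmapDomain ℝ ℝ (c ::ₘ ·)

/-- The bosonic annihilation operator. -/
def bosonDown (c : Fin D) : Module.End ℝ (Multiset (Fin D) →₀ ℝ) :=
  Finsupp.linearCombination ℝ fun m => (m.count c : ℝ) • Finsupp.single (m.erase c) 1

/-- The fermionic creation operator. -/
def fermionUp (c : Fin D) : Module.End ℝ (Ext D) :=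
  LinearMap.mulLeft ℝ (ExteriorAlgebra.ι ℝ (Pi.single c 1))

/-- The fermionic annihilation operator. -/
def fermionDown (c : Fin D) : Module.End ℝ (Ext D) :=
  CliffordAlgebra.contractLeft (Q := (0 : QuadraticForm ℝ (Fin D → ℝ))) (LinearMap.proj c)

theorem bosonUp_single (c : Fin D) (m : Multiset (Fin D)) (r : ℝ) :
    bosonUp c (Finsupp.single m r) = Finsupp.single (c ::ₘ m) r := by
  simp [bosonUp]

theorem bosonDown_single (c : Fin D) (m : Multiset (Fin D)) :
    bosonDown c (Finsupp.single m 1) = (m.count c : ℝ) • Finsupp.single (m.erase c) 1 := by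
  simp [bosonDown]

theorem bosonUp_mul_bosonUp (c d : Fin D) : bosonUp c * bosonUp d = bosonUp d * bosonUp c := by
  refine Finsupp.lhom_ext fun m r => ?_
  simp only [Module.End.mul_apply, bosonUp_single, Multiset.cons_swap]

theorem bosonDown_mul_bosonDown (c d : Fin D) :
    bosonDown c * bosonDown d = bosonDown d * bosonDown c := by
  by_cases h : c = d
  · rw [h]
  refine Finsupp.lhom_ext' fun m => LinearMap.ext_ring ?_
  simp only [LinearMap.comp_apply, Finsupp.lsingle_apply, Module.End.mul_apply, bosonDown_single,
    map_smul, smul_smul, Multiset.count_erase_of_ne h, Multiset.count_erase_of_ne (Ne.symm h)]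
  rw [Multiset.erase_comm, mul_comm]

theorem bosonDown_mul_bosonUp (c d : Fin D) :
    bosonDown c * bosonUp d = bosonUp d * bosonDown c + if c = d then 1 else 0 := by
  refine Finsupp.lhom_ext' fun m => LinearMap.ext_ring ?_
  simp only [LinearMap.comp_apply, Finsupp.lsingle_apply, Module.End.mul_apply, bosonDown_single,
    bosonUp_single, map_smul, LinearMap.add_apply]
  by_cases h : c = d
  · subst h
    simp only [Multiset.count_cons_self, Multiset.erase_cons_head, if_true, Module.End.one_apply]
    by_cases hm : c ∈ m
    · rw [Multiset.cons_erase hm, Nat.cast_add, Nat.cast_one, add_smul, one_smul]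
    · rw [Multiset.count_eq_zero_of_notMem hm]
      simp
  · rw [if_neg h, Multiset.count_cons_of_ne h, Multiset.erase_cons_tail _ (Ne.symm h)]
    simp

theorem fermionUp_mul_fermionUp (c d : Fin D) :
    fermionUp c * fermionUp d = (-1 : ℝ) • (fermionUp d * fermionUp c) := by
  refine LinearMap.ext fun w => ?_
  simp only [fermionUp, Module.End.mul_apply, LinearMap.mulLeft_apply, LinearMap.smul_apply,
    neg_smul, one_smul, ← mul_assoc]
  rw [eq_neg_iff_add_eq_zero, ← add_mul, ExteriorAlgebra.ι_add_mul_swap, zero_mul]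

theorem fermionDown_mul_fermionDown (c d : Fin D) :
    fermionDown c * fermionDown d = (-1 : ℝ) • (fermionDown d * fermionDown c) := by
  refine LinearMap.ext fun w => ?_
  simp only [fermionDown, Module.End.mul_apply, LinearMap.smul_apply, neg_smul, one_smul]
  exact CliffordAlgebra.contractLeft_comm _ _ _

theorem fermionDown_mul_fermionUp (c d : Fin D) :
    fermionDown c * fermionUp d =
      (-1 : ℝ) • (fermionUp d * fermionDown c) + if c = d then 1 else 0 := by
  refine LinearMap.ext fun w => ?_
  simp only [fermionDown, fermionUp, Module.End.mul_apply, LinearMap.smul_apply,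
    LinearMap.mulLeft_apply, neg_smul, one_smul, LinearMap.add_apply]
  refine (CliffordAlgebra.contractLeft_ι_mul _ _ _).trans ?_
  rw [sub_eq_neg_add]
  congr 1
  by_cases h : c = d
  · subst h; simp
  · simp [h]

theorem rTensor_mul_lTensor {M N : Type*} [AddCommGroup M] [Module ℝ M] [AddCommGroup N]
    [Module ℝ N] (f : Module.End ℝ M) (g : Module.End ℝ N) :
    Module.End.rTensorAlgHom ℝ M N f * Module.End.lTensorAlgHom ℝ N M g =
      Module.End.lTensorAlgHom ℝ N M g * Module.End.rTensorAlgHom ℝ M N f := by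
  refine TensorProduct.ext' fun x y => ?_
  rfl

/-- The operators that act on the bosonic factor. -/
def inBoson : Module.End ℝ (Multiset (Fin D) →₀ ℝ) →ₐ[ℝ] Module.End ℝ (Space D) :=
  Module.End.rTensorAlgHom ℝ _ _

/-- The operators that act on the first fermionic factor. -/
def inLeft : Module.End ℝ (Ext D) →ₐ[ℝ] Module.End ℝ (Space D) :=
  (Module.End.lTensorAlgHom ℝ _ _).comp (Module.End.rTensorAlgHom ℝ _ _)

/-- The operators that act on the second fermionic factor. -/
def inRight : Module.End ℝ (Ext D) →ₐ[ℝ] Module.End ℝ (Space D) :=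
  (Module.End.lTensorAlgHom ℝ _ _).comp (Module.End.lTensorAlgHom ℝ _ _)

theorem inBoson_mul_inLeft (f : Module.End ℝ (Multiset (Fin D) →₀ ℝ)) (g : Module.End ℝ (Ext D)) :
    inBoson f * inLeft g = inLeft g * inBoson f := rTensor_mul_lTensor _ _

theorem inBoson_mul_inRight (f : Module.End ℝ (Multiset (Fin D) →₀ ℝ)) (g : Module.End ℝ (Ext D)) :
    inBoson f * inRight g = inRight g * inBoson f := rTensor_mul_lTensor _ _

theorem inLeft_mul_inRight (f g : Module.End ℝ (Ext D)) :
    inLeft f * inRight g = inRight g * inLeft f := by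
  simp only [inLeft, inRight, AlgHom.comp_apply, ← map_mul, rTensor_mul_lTensor]

/-- The creation operators; the index is `0` for the boson and `1`, `2` for the fermions. -/
def up : Fin 3 → Fin D → Module.End ℝ (Space D)
  | 0, c => inBoson (bosonUp c)
  | 1, c => inLeft (fermionUp c)
  | 2, c => inRight (fermionUp c)

/-- The annihilation operators. -/
def down : Fin 3 → Fin D → Module.End ℝ (Space D)
  | 0, c => inBoson (bosonDown c)
  | 1, c => inLeft (fermionDown c)
  | 2, c => inRight (fermionDown c)

/-- The sign of the exchange of two oscillators. -/
def sgn (u v : Fin 3) : ℝ := if u = v ∧ u ≠ 0 then -1 else 1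

theorem up_mul_up (u v : Fin 3) (c d : Fin D) :
    up u c * up v d = sgn u v • (up v d * up u c) := by
  fin_cases u <;> fin_cases v <;>
    simp [up, sgn, ← map_mul, bosonUp_mul_bosonUp c d, fermionUp_mul_fermionUp c d,
      inBoson_mul_inLeft, inBoson_mul_inRight, inLeft_mul_inRight]

theorem down_mul_down (u v : Fin 3) (c d : Fin D) :
    down u c * down v d = sgn u v • (down v d * down u c) := by
  fin_cases u <;> fin_cases v <;>
    simp [down, sgn, ← map_mul, bosonDown_mul_bosonDown c d, fermionDown_mul_fermionDown c d,
      inBoson_mul_inLeft, inBoson_mul_inRight, inLeft_mul_inRight]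

theorem down_mul_up (u v : Fin 3) (c d : Fin D) :
    down u c * up v d = sgn u v • (up v d * down u c) + if u = v ∧ c = d then 1 else 0 := by
  fin_cases u <;> fin_cases v <;>
    simp [down, up, sgn, ← map_mul, bosonDown_mul_bosonUp c d, fermionDown_mul_fermionUp c d,
      inBoson_mul_inLeft, inBoson_mul_inRight, inLeft_mul_inRight]

theorem sgn_mul_self (u v : Fin 3) : sgn u v * sgn u v = 1 := by
  unfold sgn; split_ifs <;> norm_num

theorem sgn_comm (u v : Fin 3) : sgn u v = sgn v u := by
  unfold sgn
  by_cases h : u = v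
  · rw [h]
  · rw [if_neg (by tauto), if_neg (by tauto)]

/-- The bilinears of the oscillators, which span a Lie superalgebra `gl(1|2)`. -/
def bil (u v : Fin 3) : Module.End ℝ (Space D) := ∑ c, up u c * down v c

theorem bil_mul_up (u v w : Fin 3) (d : Fin D) :
    bil u v * up w d = (sgn v w * sgn u w) • (up w d * bil u v) + if v = w then up u d else 0 := by
  have h : ∀ c, up u c * down v c * up w d = (sgn v w * sgn u w) • (up w d * (up u c * down v c)) +
      if v = w ∧ c = d then up u c else 0 := by
    intro c
    rw [mul_assoc, down_mul_up, mul_add, mul_smul_comm, ← mul_assoc, up_mul_up u w, smul_mul_assoc,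
      smul_smul, mul_assoc]
    split_ifs <;> simp
  simp only [bil, Finset.sum_mul, h, Finset.sum_add_distrib, Finset.mul_sum, Finset.smul_sum]
  congr 1
  by_cases hv : v = w <;> simp [hv]

theorem bil_mul_down (u v z : Fin 3) (d : Fin D) :
    bil u v * down z d = (sgn u z * sgn v z) • (down z d * bil u v) -
      (sgn u z * sgn v z) • if u = z then down v d else 0 := by
  have h : ∀ c, up u c * down v c * down z d =
      (sgn u z * sgn v z) • (down z d * (up u c * down v c)) -
      (sgn u z * sgn v z) • if u = z ∧ c = d then down v c else 0 := by
    intro c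
    have e : down z d * up u c = sgn u z • (up u c * down z d) + if u = z ∧ c = d then 1 else 0 := by
      rw [down_mul_up, sgn_comm]
      simp only [eq_comm (a := z), eq_comm (a := d)]
    rw [← mul_assoc, e, mul_assoc, down_mul_down v z, mul_smul_comm, add_mul, smul_add,
      smul_mul_assoc, smul_smul, mul_assoc]
    have : sgn u z * (sgn v z * sgn u z) = sgn v z := by
      rw [mul_left_comm, sgn_mul_self, mul_one]
    rw [this]
    split_ifs <;> simp [mul_assoc]
  simp only [bil, Finset.sum_mul, h, Finset.sum_sub_distrib, Finset.mul_sum, Finset.smul_sum]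
  congr 1
  by_cases hv : u = z <;> simp [hv]

/-- All relations between `dL`, `dR`, `T`, `T'`, `hL`, `hR` are instances of this one. Because the
two kinds of fermions commute with each other, the signs are not those of the usual supercommutator:
`dL` and `dR` commute, although both square to zero. -/
theorem bil_mul_bil (u v w z : Fin 3) :
    (bil u v * bil w z : Module.End ℝ (Space D)) =
      (sgn v w * sgn u w * (sgn u z * sgn v z)) • (bil w z * bil u v) +
      (if v = w then bil u z else 0) -
      (sgn v w * sgn u w * (sgn u z * sgn v z)) • (if u = z then bil w v else 0) := by
  have h : ∀ d : Fin D, bil u v * (up w d * down z d) =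
      (sgn v w * sgn u w * (sgn u z * sgn v z)) • (up w d * down z d * bil u v) +
      (if v = w then up u d * down z d else 0) -
      (sgn v w * sgn u w * (sgn u z * sgn v z)) • (if u = z then up w d * down v d else 0) := by
    intro d
    rw [← mul_assoc, bil_mul_up, add_mul, smul_mul_assoc, mul_assoc (up w d), bil_mul_down, mul_sub,
      mul_smul_comm, mul_smul_comm, smul_sub, smul_smul, smul_smul, mul_assoc (up w d)]
    rw [sub_add_eq_add_sub]
    congr 2
    · split_ifs <;> simp
    · split_ifs <;> simp
  conv_lhs => rw [bil.eq_def w z]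
  simp only [Finset.mul_sum, h, Finset.sum_add_distrib, Finset.sum_sub_distrib, ← Finset.smul_sum,
    ← Finset.sum_mul]
  split_ifs <;> simp [bil]

variable (D) in
/-- The vacuum. -/
def vac : Space D := Finsupp.single 0 1 ⊗ₜ (1 ⊗ₜ 1)

theorem down_vac (u : Fin 3) (c : Fin D) : down u c (vac D) = 0 := by
  have h : fermionDown c (1 : Ext D) = 0 := CliffordAlgebra.contractLeft_one (Q := 0) _
  fin_cases u
  · change bosonDown c (Finsupp.single 0 1) ⊗ₜ[ℝ] ((1 : Ext D) ⊗ₜ[ℝ] (1 : Ext D)) = 0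
    rw [bosonDown_single]
    simp
  · change Finsupp.single 0 1 ⊗ₜ[ℝ] (fermionDown c (1 : Ext D) ⊗ₜ[ℝ] (1 : Ext D)) = 0
    rw [h, TensorProduct.zero_tmul, TensorProduct.tmul_zero]
  · change Finsupp.single 0 1 ⊗ₜ[ℝ] ((1 : Ext D) ⊗ₜ[ℝ] fermionDown c (1 : Ext D)) = 0
    rw [h, TensorProduct.tmul_zero, TensorProduct.tmul_zero]

/-- The monomials in the creation operators. -/
def word : List (Fin 3 × Fin D) → Space D
  | [] => vac D
  | a :: L => up a.1 a.2 (word L)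

/-- The degree of a monomial. -/
def wordDegree : List (Fin 3 × Fin D) → Fin 3 → ℤ
  | [] => 0
  | a :: L => wordDegree L + Pi.single a.1 1

variable (D) in
/-- The subspace of degree `d`. -/
def graded (d : Fin 3 → ℤ) : Submodule ℝ (Space D) :=
  Submodule.span ℝ {z | ∃ L, wordDegree L = d ∧ z = word L}

theorem word_mem (L : List (Fin 3 × Fin D)) : word L ∈ graded D (wordDegree L) :=
  Submodule.subset_span ⟨L, rfl, rfl⟩

theorem wordDegree_nonneg (L : List (Fin 3 × Fin D)) (u : Fin 3) : 0 ≤ wordDegree L u := by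
  induction L with
  | nil => exact le_rfl
  | cons a L ih =>
    simp only [wordDegree, Pi.add_apply, Pi.single_apply]
    split_ifs <;> omega

/-- With integer degrees, removing an index from an empty column needs no separate case: the result
lies in a zero space. -/
theorem eq_zero_of_neg {d : Fin 3 → ℤ} {z : Space D} (hz : z ∈ graded D d) {u : Fin 3}
    (hu : d u < 0) : z = 0 := by
  have h : {z : Space D | ∃ L, wordDegree L = d ∧ z = word L} = ∅ := by
    rw [Set.eq_empty_iff_forall_notMem]
    rintro _ ⟨L, rfl, -⟩
    exact (wordDegree_nonneg L u).not_gt hu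
  rw [graded, h, Submodule.span_empty] at hz
  exact hz

theorem map_graded {T : Module.End ℝ (Space D)} {d e : Fin 3 → ℤ}
    (h : ∀ L, wordDegree L = d → T (word L) ∈ graded D e) {z : Space D} (hz : z ∈ graded D d) :
    T z ∈ graded D e := by
  have : graded D d ≤ (graded D e).comap T := by
    refine Submodule.span_le.2 ?_
    rintro _ ⟨L, hL, rfl⟩
    exact h L hL
  exact this hz

theorem up_mem {d : Fin 3 → ℤ} {z : Space D} (hz : z ∈ graded D d) (u : Fin 3) (c : Fin D) :
    up u c z ∈ graded D (d + Pi.single u 1) := by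
  refine map_graded ?_ hz
  rintro L rfl
  exact word_mem ((u, c) :: L)

theorem down_mem {d : Fin 3 → ℤ} {z : Space D} (hz : z ∈ graded D d) (u : Fin 3) (c : Fin D) :
    down u c z ∈ graded D (d - Pi.single u 1) := by
  refine map_graded ?_ hz
  clear hz
  rintro L rfl
  induction L with
  | nil => rw [word, down_vac]; exact Submodule.zero_mem _
  | cons a L ih =>
    have h := LinearMap.congr_fun (down_mul_up u a.1 c a.2) (word L)
    rw [Module.End.mul_apply] at h
    rw [word, h, LinearMap.add_apply, LinearMap.smul_apply, Module.End.mul_apply, wordDegree]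
    refine Submodule.add_mem _ (Submodule.smul_mem _ _ ?_) ?_
    · have := up_mem ih a.1 a.2
      rwa [sub_add_eq_add_sub] at this
    · split_ifs with h
      · rw [h.1, add_sub_cancel_right]
        exact word_mem L
      · exact Submodule.zero_mem _

theorem bil_mem {d : Fin 3 → ℤ} {z : Space D} (hz : z ∈ graded D d) (u v : Fin 3) :
    bil u v z ∈ graded D (d - Pi.single v 1 + Pi.single u 1) := by
  rw [bil, LinearMap.sum_apply]
  exact Submodule.sum_mem _ fun c _ => up_mem (down_mem hz v c) u c

/-- The diagonal bilinears are the number operators. They supply the scalars in the homotopy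
formulas and separate the degrees. -/
theorem bil_self {d : Fin 3 → ℤ} {z : Space D} (hz : z ∈ graded D d) (u : Fin 3) :
    bil u u z = (d u : ℝ) • z := by
  induction hz using Submodule.span_induction with
  | mem z h =>
    obtain ⟨L, rfl, rfl⟩ := h
    induction L with
    | nil => simp [bil, word, down_vac, wordDegree, LinearMap.sum_apply]
    | cons a L ih =>
      have h := LinearMap.congr_fun (bil_mul_up u u a.1 a.2) (word L)
      rw [Module.End.mul_apply, sgn_mul_self, one_smul, LinearMap.add_apply, Module.End.mul_apply,
        ih, map_smul] at h
      rw [word, h, wordDegree, Pi.add_apply, Int.cast_add, add_smul]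
      congr 1
      by_cases hu : u = a.1
      · subst hu; simp
      · rw [if_neg hu, Pi.single_eq_of_ne hu]; simp
  | zero => simp
  | add y z _ _ hy hz => rw [map_add, hy, hz, smul_add]
  | smul c z _ hz => rw [map_smul, hz, smul_comm]

end

end Fock

/-! ### The sl₂ of the two columns and exactness of the curls modulo `T` -/

namespace Fock

noncomputable section

open scoped TensorProduct

variable {D : ℕ}

theorem iSup_graded : ⨆ d, graded D d = ⊤ := by
  set S : Submodule ℝ (Space D) := ⨆ d, graded D d with hS
  have hup : ∀ u c z, z ∈ S → up u c z ∈ S := by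
    intro u c z hz
    have : S ≤ S.comap (up u c) := iSup_le fun d z hz =>
      Submodule.mem_iSup_of_mem _ (up_mem hz u c)
    exact this hz
  have hι : ∀ v : Fin D → ℝ, ExteriorAlgebra.ι ℝ v = ∑ c, v c • ExteriorAlgebra.ι ℝ (Pi.single c 1) := by
    intro v
    conv_lhs => rw [← Finset.univ_sum_single v]
    rw [map_sum]
    refine Finset.sum_congr rfl fun c _ => ?_
    rw [← map_smul, ← Pi.single_smul, smul_eq_mul, mul_one]
  have h0 : ∀ m : Multiset (Fin D), (Finsupp.single m (1 : ℝ)) ⊗ₜ[ℝ] ((1 : Ext D) ⊗ₜ[ℝ] (1 : Ext D)) ∈ S := by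
    intro m
    induction m using Multiset.induction with
    | empty => exact Submodule.mem_iSup_of_mem _ (word_mem [])
    | cons c m ih =>
      have := hup 0 c _ ih
      change bosonUp c _ ⊗ₜ _ ∈ S at this
      rwa [bosonUp_single] at this
  have h1 : ∀ (m : Multiset (Fin D)) (x : Ext D),
      (Finsupp.single m (1 : ℝ)) ⊗ₜ[ℝ] (x ⊗ₜ[ℝ] (1 : Ext D)) ∈ S := by
    intro m x
    induction x using CliffordAlgebra.left_induction with
    | algebraMap r =>
      rw [Algebra.algebraMap_eq_smul_one, ← TensorProduct.smul_tmul', TensorProduct.tmul_smul]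
      exact S.smul_mem r (h0 m)
    | add x y hx hy =>
      rw [TensorProduct.add_tmul, TensorProduct.tmul_add]
      exact S.add_mem hx hy
    | ι_mul x v hx =>
      change _ ⊗ₜ (((ExteriorAlgebra.ι ℝ v * x : Ext D)) ⊗ₜ _) ∈ S
      rw [hι, Finset.sum_mul, TensorProduct.sum_tmul, TensorProduct.tmul_sum]
      refine S.sum_mem fun c _ => ?_
      rw [smul_mul_assoc, ← TensorProduct.smul_tmul', TensorProduct.tmul_smul]
      exact S.smul_mem _ (hup 1 c _ hx)
  have h2 : ∀ (m : Multiset (Fin D)) (x y : Ext D),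
      (Finsupp.single m (1 : ℝ)) ⊗ₜ[ℝ] (x ⊗ₜ[ℝ] y) ∈ S := by
    intro m x y
    induction y using CliffordAlgebra.left_induction with
    | algebraMap r =>
      rw [Algebra.algebraMap_eq_smul_one, TensorProduct.tmul_smul, TensorProduct.tmul_smul]
      exact S.smul_mem r (h1 m x)
    | add y y' hy hy' =>
      rw [TensorProduct.tmul_add, TensorProduct.tmul_add]
      exact S.add_mem hy hy'
    | ι_mul y v hy =>
      change _ ⊗ₜ (_ ⊗ₜ (ExteriorAlgebra.ι ℝ v * y : Ext D)) ∈ S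
      rw [hι, Finset.sum_mul, TensorProduct.tmul_sum, TensorProduct.tmul_sum]
      refine S.sum_mem fun c _ => ?_
      rw [smul_mul_assoc, TensorProduct.tmul_smul, TensorProduct.tmul_smul]
      exact S.smul_mem _ (hup 2 c _ hy)
  refine eq_top_iff.2 fun z _ => ?_
  induction z using TensorProduct.induction_on with
  | zero => exact S.zero_mem
  | add y z hy hz => exact S.add_mem (hy trivial) (hz trivial)
  | tmul m w =>
    induction w using TensorProduct.induction_on with
    | zero => rw [TensorProduct.tmul_zero]; exact S.zero_mem
    | add y z hy hz => rw [TensorProduct.tmul_add]; exact S.add_mem (hy trivial) (hz trivial)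
    | tmul x y =>
      induction m using Finsupp.induction_linear with
      | zero => rw [TensorProduct.zero_tmul]; exact S.zero_mem
      | add m m' h h' => rw [TensorProduct.add_tmul]; exact S.add_mem (h trivial) (h' trivial)
      | single m r =>
        have : Finsupp.single m r = r • Finsupp.single m (1 : ℝ) := by simp
        rw [this, ← TensorProduct.smul_tmul']
        exact S.smul_mem r (h2 m x y)

/-- The degrees are the joint eigenvalues of the three commuting number operators. -/
theorem iSupIndep_graded : iSupIndep (graded D) := by
  have h := Module.End.independent_iInf_maxGenEigenspace_of_forall_mapsTo
    (fun u : Fin 3 => (bil u u : Module.End ℝ (Space D))) fun u v r =>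
      Module.End.mapsTo_maxGenEigenspace_of_comm (by
        have := bil_mul_bil (D := D) v v u u
        have e : sgn v u * sgn v u * (sgn v u * sgn v u) = 1 := by simp [sgn_mul_self]
        rw [e, one_smul, one_smul] at this
        rw [commute_iff_eq, this]
        split_ifs with h
        · subst h; simp
        · simp) r
  have hi : Function.Injective fun (d : Fin 3 → ℤ) (u : Fin 3) => ((d u : ℤ) : ℝ) := by
    intro d e hde
    funext u
    exact Int.cast_injective (congrFun hde u)
  refine (h.comp hi).mono fun d z hz => ?_
  simp only [Function.comp_apply, Submodule.mem_iInf]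
  intro u
  refine (Module.End.mem_maxGenEigenspace _ _ _).2 ⟨1, ?_⟩
  simp [bil_self hz]

/-- The span of all monomials of degree different from `d`. -/
def others (D : ℕ) (d : Fin 3 → ℤ) : Submodule ℝ (Space D) := ⨆ (e) (_ : e ≠ d), graded D e

theorem mem_others {d e : Fin 3 → ℤ} (h : e ≠ d) {z : Space D} (hz : z ∈ graded D e) :
    z ∈ others D d :=
  Submodule.mem_iSup_of_mem e (Submodule.mem_iSup_of_mem h hz)

theorem eq_zero_of_add {d : Fin 3 → ℤ} {x y : Space D} (hx : x ∈ graded D d) (hy : y ∈ others D d)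
    (h : x + y = 0) : x = 0 := by
  have := (Submodule.disjoint_def.1 (iSupIndep_graded d)) x hx
  refine this ?_
  rw [eq_neg_of_add_eq_zero_left h]
  exact Submodule.neg_mem _ hy

/-- `z` of degree `(n, a, b)` (with `n` bosons). -/
abbrev Om (D : ℕ) (n a b : ℤ) : Submodule ℝ (Space D) := graded D ![n, a, b]

/-- The curl on the first column. -/
def dL : Module.End ℝ (Space D) := bil 0 1
/-- The curl on the second column. -/
def dR : Module.End ℝ (Space D) := bil 0 2
/-- The move of an index from the first to the second column. -/
def T : Module.End ℝ (Space D) := bil 2 1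
/-- The move of an index from the second to the first column. -/
def T' : Module.End ℝ (Space D) := bil 1 2
/-- The homotopy for `dL`. -/
def hL : Module.End ℝ (Space D) := bil 1 0
/-- The homotopy for `dR`. -/
def hR : Module.End ℝ (Space D) := bil 2 0

variable {n a b : ℤ} {z : Space D}

theorem mem_Om (u v : Fin 3) {n' a' b' : ℤ} (hz : z ∈ Om D n a b)
    (h : ![n, a, b] - Pi.single v 1 + Pi.single u 1 = ![n', a', b']) :
    bil u v z ∈ Om D n' a' b' := by
  rw [Om, ← h]
  exact bil_mem hz u v

theorem Om_congr (hz : z ∈ Om D n a b) {n' a' b' : ℤ} (hn : n = n') (ha : a = a') (hb : b = b') :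
    z ∈ Om D n' a' b' := by
  rwa [← hn, ← ha, ← hb]

theorem eq_zero_of_eq_neg (h : z = -z) : z = 0 := by
  have h2 : (2 : ℝ) • z = 0 := by
    rw [two_smul]
    nth_rewrite 1 [h]
    exact neg_add_cancel z
  exact (smul_eq_zero.1 h2).resolve_left two_ne_zero

theorem dL_mem (hz : z ∈ Om D n a b) {n' a' : ℤ} (hn : n' = n + 1) (ha : a' = a - 1) :
    dL z ∈ Om D n' a' b :=
  mem_Om _ _ hz (by ext u; fin_cases u <;> simp [hn, ha, Matrix.vecHead, Matrix.vecTail])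

theorem dR_mem (hz : z ∈ Om D n a b) {n' b' : ℤ} (hn : n' = n + 1) (hb : b' = b - 1) :
    dR z ∈ Om D n' a b' :=
  mem_Om _ _ hz (by ext u; fin_cases u <;> simp [hn, hb, Matrix.vecHead, Matrix.vecTail])

theorem hL_mem (hz : z ∈ Om D n a b) {n' a' : ℤ} (hn : n' = n - 1) (ha : a' = a + 1) :
    hL z ∈ Om D n' a' b :=
  mem_Om _ _ hz (by ext u; fin_cases u <;> simp [hn, ha, Matrix.vecHead, Matrix.vecTail])

theorem hR_mem (hz : z ∈ Om D n a b) {n' b' : ℤ} (hn : n' = n - 1) (hb : b' = b + 1) :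
    hR z ∈ Om D n' a b' :=
  mem_Om _ _ hz (by ext u; fin_cases u <;> simp [hn, hb, Matrix.vecHead, Matrix.vecTail])

theorem T_mem (hz : z ∈ Om D n a b) {a' b' : ℤ} (ha : a' = a - 1) (hb : b' = b + 1) :
    T z ∈ Om D n a' b' :=
  mem_Om _ _ hz (by ext u; fin_cases u <;> simp [ha, hb, Matrix.vecHead, Matrix.vecTail])

theorem T'_mem (hz : z ∈ Om D n a b) {a' b' : ℤ} (ha : a' = a + 1) (hb : b' = b - 1) :
    T' z ∈ Om D n a' b' :=
  mem_Om _ _ hz (by ext u; fin_cases u <;> simp [ha, hb, Matrix.vecHead, Matrix.vecTail])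

theorem dL_dL (z : Space D) : dL (dL z) = 0 := by
  have := LinearMap.congr_fun (bil_mul_bil (D := D) 0 1 0 1) z
  simp [sgn] at this
  rw [dL]
  exact eq_zero_of_eq_neg this

theorem dR_dR (z : Space D) : dR (dR z) = 0 := by
  have := LinearMap.congr_fun (bil_mul_bil (D := D) 0 2 0 2) z
  simp [sgn] at this
  rw [dR]
  exact eq_zero_of_eq_neg this

theorem dL_dR (z : Space D) : dL (dR z) = dR (dL z) := by
  have := LinearMap.congr_fun (bil_mul_bil (D := D) 0 1 0 2) z
  simp [sgn] at this
  exact this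

theorem dL_T (z : Space D) : dL (T z) = -T (dL z) := by
  have := LinearMap.congr_fun (bil_mul_bil (D := D) 0 1 2 1) z
  simp [sgn] at this
  exact this

theorem dR_T (z : Space D) : dR (T z) = dL z - T (dR z) := by
  have := LinearMap.congr_fun (bil_mul_bil (D := D) 0 2 2 1) z
  simp [sgn] at this
  rw [dR, dL, T, this]
  abel

theorem dL_T' (z : Space D) : dL (T' z) = dR z - T' (dL z) := by
  have := LinearMap.congr_fun (bil_mul_bil (D := D) 0 1 1 2) z
  simp [sgn] at this
  rw [dR, dL, T', this]
  abel

theorem dR_T' (z : Space D) : dR (T' z) = -T' (dR z) := by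
  have := LinearMap.congr_fun (bil_mul_bil (D := D) 0 2 1 2) z
  simp [sgn] at this
  exact this

/-- The sl₂ relation: `T` and `T'` are the ladder operators, and b - a is the weight. -/
theorem T_T' (hz : z ∈ Om D n a b) : T (T' z) = T' (T z) + ((b : ℝ) - a) • z := by
  have := LinearMap.congr_fun (bil_mul_bil (D := D) 2 1 1 2) z
  simp [sgn, bil_self hz] at this
  rw [T, T', this, sub_smul]
  abel

/-- The Koszul homotopy: the anticommutator of `dL` and `hL` counts derivatives and indices of the
first column, which gives `exact_dL`. -/
theorem dL_hL (hz : z ∈ Om D n a b) : dL (hL z) = ((n : ℝ) + a) • z - hL (dL z) := by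
  have := LinearMap.congr_fun (bil_mul_bil (D := D) 0 1 1 0) z
  simp [sgn, bil_self hz] at this
  rw [dL, hL, this, add_smul]
  abel

theorem dR_hR (hz : z ∈ Om D n a b) : dR (hR z) = ((n : ℝ) + b) • z - hR (dR z) := by
  have := LinearMap.congr_fun (bil_mul_bil (D := D) 0 2 2 0) z
  simp [sgn, bil_self hz] at this
  rw [dR, hR, this, add_smul]
  abel

/-- The homogeneous components of an element of the range of `T` are in the range of `T`. -/
theorem exists_of_add_eq_T {x y u : Space D} (hx : x ∈ Om D n a b)
    (hy : y ∈ others D ![n, a, b]) (h : x + y = T u) : ∃ w ∈ Om D n (a + 1) (b - 1), x = T w := by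
  have hu : u ∈ graded D ![n, a + 1, b - 1] ⊔ others D ![n, a + 1, b - 1] := by
    have h1 : (⊤ : Submodule ℝ (Space D)) ≤
        graded D ![n, a + 1, b - 1] ⊔ others D ![n, a + 1, b - 1] := by
      rw [← iSup_graded]
      refine iSup_le fun e => ?_
      by_cases he : e = ![n, a + 1, b - 1]
      · rw [he]; exact le_sup_left
      · exact le_sup_of_le_right fun z hz => mem_others he hz
    exact h1 trivial
  obtain ⟨w, hw, w', hw', rfl⟩ := Submodule.mem_sup.1 hu
  refine ⟨w, hw, ?_⟩
  have h2 : T w' ∈ others D ![n, a, b] := by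
    have : others D ![n, a + 1, b - 1] ≤ (others D ![n, a, b]).comap T := by
      refine iSup₂_le fun e he z hz => ?_
      refine mem_others (fun h => he ?_) (bil_mem hz 2 1)
      have h' : e = ![n, a, b] - Pi.single 2 1 + Pi.single 1 1 := by rw [← h]; abel
      rw [h']
      ext u; fin_cases u <;> simp [Matrix.vecHead, Matrix.vecTail]
    exact this hw'
  have := eq_zero_of_add (D := D) (Submodule.sub_mem _ hx (T_mem hw (by ring) (by ring)))
    (Submodule.sub_mem _ hy h2) (by rw [map_add] at h; rw [sub_add_sub_comm, h, sub_self])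
  exact sub_eq_zero.1 this

theorem exact_dL (hz : z ∈ Om D n a b) (h : 0 < n + a) (h0 : dL z = 0) :
    ∃ y ∈ Om D (n - 1) (a + 1) b, z = dL y := by
  refine ⟨((n : ℝ) + a)⁻¹ • hL z, Submodule.smul_mem _ _ (hL_mem hz rfl rfl), ?_⟩
  have : ((n : ℝ) + a) ≠ 0 := by exact_mod_cast h.ne'
  rw [map_smul, dL_hL hz, h0, map_zero, sub_zero, smul_smul, inv_mul_cancel₀ this, one_smul]

theorem exact_dR (hz : z ∈ Om D n a b) (h : 0 < n + b) (h0 : dR z = 0) :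
    ∃ y ∈ Om D (n - 1) a (b + 1), z = dR y := by
  refine ⟨((n : ℝ) + b)⁻¹ • hR z, Submodule.smul_mem _ _ (hR_mem hz rfl rfl), ?_⟩
  have : ((n : ℝ) + b) ≠ 0 := by exact_mod_cast h.ne'
  rw [map_smul, dR_hR hz, h0, map_zero, sub_zero, smul_smul, inv_mul_cancel₀ this, one_smul]

theorem T_pow_mem (hz : z ∈ Om D n a b) (k : ℕ) : (T ^ k) z ∈ Om D n (a - k) (b + k) := by
  induction k with
  | zero => simpa using hz
  | succ k ih =>
    rw [pow_succ', Module.End.mul_apply]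
    exact T_mem ih (by push_cast; ring) (by push_cast; ring)

theorem T'_pow_mem (hz : z ∈ Om D n a b) (k : ℕ) : (T' ^ k) z ∈ Om D n (a + k) (b - k) := by
  induction k with
  | zero => simpa using hz
  | succ k ih =>
    rw [pow_succ', Module.End.mul_apply]
    exact T'_mem ih (by push_cast; ring) (by push_cast; ring)

theorem T_T'_pow (hz : z ∈ Om D n a b) (k : ℕ) :
    T ((T' ^ (k + 1)) z) = (T' ^ (k + 1)) (T z) + ((k + 1) * ((b : ℝ) - a - k)) • (T' ^ k) z := by
  induction k with
  | zero => simpa using T_T' hz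
  | succ k ih =>
    rw [pow_succ' T' (k + 1), Module.End.mul_apply, T_T' (T'_pow_mem hz (k + 1)), ih, map_add,
      map_smul, ← Module.End.mul_apply, ← pow_succ', ← Module.End.mul_apply T', ← pow_succ',
      add_assoc, ← add_smul]
    congr 2
    push_cast
    ring

theorem T_pow_T' (hz : z ∈ Om D n a b) (k : ℕ) :
    (T ^ (k + 1)) (T' z) = T' ((T ^ (k + 1)) z) + ((k + 1) * ((b : ℝ) - a + k)) • (T ^ k) z := by
  induction k with
  | zero => simpa using T_T' hz
  | succ k ih =>
    rw [pow_succ' T (k + 1), Module.End.mul_apply, ih, map_add, T_T' (T_pow_mem hz (k + 1)),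
      map_smul, ← Module.End.mul_apply T, ← Module.End.mul_apply T, ← pow_succ', ← pow_succ',
      add_assoc, ← add_smul]
    congr 2
    push_cast
    ring

/-- If `T` kills z, then `T` sends `T'`^(k+1) z to (k+1)(b-a-k) `T'`^k z, and the coefficient is
nonzero for b < a. High powers of `T'` exhaust the second column, and one descends from there to k =
0. -/
theorem eq_zero_of_T (hz : z ∈ Om D n a b) (hab : b < a) (h : T z = 0) : z = 0 := by
  have h1 : ∀ k : ℕ, (T' ^ k) z = 0 → z = 0 := by
    intro k
    induction k with
    | zero => simp
    | succ k ih =>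
      intro hk
      have := T_T'_pow hz k
      rw [hk, h, map_zero, map_zero, zero_add] at this
      refine ih ((smul_eq_zero.1 this.symm).resolve_left ?_)
      have h2 : (b : ℝ) < a := by exact_mod_cast hab
      have h3 : (0 : ℝ) ≤ k := k.cast_nonneg
      refine mul_ne_zero (by positivity) (ne_of_lt ?_)
      linarith
  exact h1 (b + 1).toNat (eq_zero_of_neg (T'_pow_mem hz _) (u := 2) (by simp))

/-- Each `T` lowers a - b by two, and the bound keeps this difference positive before each of the
`m` applications. -/
theorem eq_zero_of_T_pow {m : ℕ} (hz : z ∈ Om D n a b) (hab : 2 * ((m : ℤ) - 1) < a - b)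
    (h : (T ^ m) z = 0) : z = 0 := by
  induction m with
  | zero => simpa using h
  | succ m ih =>
    refine ih (by push_cast at hab; linarith) ?_
    rw [pow_succ', Module.End.mul_apply] at h
    exact eq_zero_of_T (T_pow_mem hz m) (by push_cast at hab; linarith) h

/-- Induction on the power of `T` that kills z: if `T`^(m+1) z = 0, then `T` `T'` z - c z is killed
by `T`^m for a constant c ≠ 0. Some power of `T` kills z because the first column runs out. -/
theorem exists_T (hz : z ∈ Om D n a b) (hab : a < b) : ∃ w ∈ Om D n (a + 1) (b - 1), z = T w := by
  have h1 : ∀ (m : ℕ) (z : Space D), z ∈ Om D n a b → (T ^ m) z = 0 →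
      ∃ w ∈ Om D n (a + 1) (b - 1), z = T w := by
    intro m
    induction m with
    | zero =>
      intro z _ h
      exact ⟨0, Submodule.zero_mem _, by simpa using h⟩
    | succ m ih =>
      intro z hz h
      have h2 := T_pow_T' hz m
      rw [h, map_zero, zero_add, pow_succ, Module.End.mul_apply] at h2
      set c : ℝ := (m + 1) * ((b : ℝ) - a + m) with hc
      have hc0 : c ≠ 0 := by
        have h2 : (a : ℝ) < b := by exact_mod_cast hab
        have h3 : (0 : ℝ) ≤ m := m.cast_nonneg
        refine mul_ne_zero (by positivity) (ne_of_gt ?_)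
        linarith
      have hT' := T'_mem hz rfl rfl
      obtain ⟨w, hw, e⟩ := ih (T (T' z) - c • z)
        (Submodule.sub_mem _ (T_mem hT' (by ring) (by ring)) (Submodule.smul_mem _ _ hz))
        (by rw [map_sub, h2, map_smul, sub_self])
      refine ⟨c⁻¹ • (T' z - w), Submodule.smul_mem _ _ (Submodule.sub_mem _ hT' hw), ?_⟩
      rw [map_smul, map_sub, ← e, sub_sub_cancel, smul_smul, inv_mul_cancel₀ hc0, one_smul]
  exact h1 (a + 1).toNat z hz (eq_zero_of_neg (T_pow_mem hz _) (u := 1) (by simp))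

/-- Exactness of `dL` on Young tensors. From `dL` z = `T` u one gets `T` `dL` u = 0, so `dL` u = 0
by injectivity of `T`, and u = `dL` y'. Then z + `T` y' is `dL`-closed, hence `dL`-exact. -/
theorem row (hz : z ∈ Om D n a b) (hna : 0 < n + a) (hab : b < a) {u : Space D}
    (hu : u ∈ Om D (n + 1) a (b - 1)) (h : dL z = T u) :
    ∃ y ∈ Om D (n - 1) (a + 1) b, ∃ w ∈ Om D n (a + 1) (b - 1), z = dL y + T w := by
  have h1 : dL u = 0 := by
    refine eq_zero_of_T (dL_mem hu rfl rfl) (by omega) ?_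
    rw [← neg_eq_zero, ← dL_T, ← h, dL_dL]
  obtain ⟨y', hy', e⟩ := exact_dL hu (by omega) h1
  rw [add_sub_cancel_right] at hy'
  obtain ⟨y, hy, e'⟩ := exact_dL (Submodule.add_mem _ hz (T_mem hy' (by ring) (by ring))) hna
    (by rw [map_add, h, dL_T, ← e, add_neg_cancel])
  exact ⟨y, hy, -y', Submodule.neg_mem _ hy', by rw [← e', map_neg]; abel⟩

theorem dR_T_pow (z : Space D) (k : ℕ) : dR ((T ^ (k + 1)) z) =
    (-1 : ℝ) ^ (k + 1) • (T ^ (k + 1)) (dR z) + ((k + 1) * (-1 : ℝ) ^ k) • (T ^ k) (dL z) := by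
  induction k generalizing z with
  | zero =>
    simp [dR_T]
    abel
  | succ k ih =>
    rw [pow_succ T (k + 1), Module.End.mul_apply, ih, dR_T, dL_T, map_sub, map_neg,
      Module.End.mul_apply, pow_succ T k, Module.End.mul_apply, smul_sub, smul_neg]
    simp only [Module.End.mul_apply]
    push_cast
    module

/-- The obstruction is pushed into ever higher powers of `T` until its second column is empty.
Applying `dR` to `dR` z = `T`^(k+1) u shows that `dL` u lies in the range of `T`, so `row` gives u =
`dL` y + `T` w. The term `T`^(k+1) `dL` y is, up to a factor and a multiple of `T`^(k+2) `dR` y, the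
`dR` of `T`^(k+2) y, and it is removed by changing z by an element of the range of `T`. The equation
then holds with k + 1. -/
theorem column_aux (hnb : 0 < n + b) (hab : b ≤ a + 1) :
    ∀ (l k : ℕ) (z u : Space D), b ≤ l + k + 1 → z ∈ Om D n a b →
      u ∈ Om D (n + 1) (a + (k + 1)) (b - 1 - (k + 1)) → dR z = (T ^ (k + 1)) u →
      ∃ y ∈ Om D (n - 1) a (b + 1), ∃ w ∈ Om D n (a + 1) (b - 1), z = dR y + T w := by
  intro l
  induction l with
  | zero =>
    intro k z u hk hz hu h
    -- Here b ≤ k + 1, so `u` would have a second column of negative length.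
    rw [eq_zero_of_neg hu (u := 2) (by simp at hk ⊢; omega), map_zero] at h
    obtain ⟨y, hy, e⟩ := exact_dR hz hnb h
    exact ⟨y, hy, 0, Submodule.zero_mem _, by rw [map_zero, add_zero, e]⟩
  | succ l ih =>
    intro k z u hk hz hu h
    have h1 : (T ^ k) (((k : ℝ) + 1) • dL u - T (dR u)) = 0 := by
      have := dR_T_pow u k
      rw [← h, dR_dR, pow_succ T, Module.End.mul_apply, pow_succ, mul_comm _ (-1 : ℝ), mul_smul,
        mul_comm _ ((-1 : ℝ) ^ k), mul_smul, smul_comm (-1 : ℝ), ← smul_add] at this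
      have h0 := (smul_eq_zero.1 this.symm).resolve_left (by simp)
      rw [map_sub, map_smul, ← h0]
      module
    have hk1 : (k : ℝ) + 1 ≠ 0 := by positivity
    have hdL : dL u ∈ Om D (n + 2) (a + k) (b - 2 - k) :=
      Om_congr (dL_mem hu rfl rfl) (by ring) (by ring) (by ring)
    have hdR : dR u ∈ Om D (n + 2) (a + k + 1) (b - 2 - k - 1) :=
      Om_congr (dR_mem hu rfl rfl) (by ring) (by ring) (by ring)
    have h2 := eq_zero_of_T_pow (Submodule.sub_mem _ (Submodule.smul_mem _ _ hdL)
      (T_mem hdR (by ring) (by ring))) (by omega) h1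
    have h3 : dL u = T (((k : ℝ) + 1)⁻¹ • dR u) := by
      rw [map_smul, ← sub_eq_zero.1 h2, smul_smul, inv_mul_cancel₀ hk1, one_smul]
    obtain ⟨y, hy, w, hw, e⟩ := row hu (by omega) (by omega)
      (Submodule.smul_mem _ _ (dR_mem hu rfl rfl)) h3
    rw [add_sub_cancel_right] at hy
    have h4 := dR_T_pow y (k + 1)
    have hc : (((k + 1 : ℕ) : ℝ) + 1) * (-1) ^ (k + 1) ≠ 0 :=
      mul_ne_zero (by positivity) (by simp)
    set c : ℝ := (((k + 1 : ℕ) : ℝ) + 1) * (-1) ^ (k + 1) with hcd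
    set s : ℝ := (-1 : ℝ) ^ (k + 1 + 1)
    have hTy : (T ^ (k + 1 + 1)) y ∈ Om D n a b :=
      Om_congr (T_pow_mem hy (k + 1 + 1)) rfl (by push_cast; ring) (by push_cast; ring)
    have hdy : dR y ∈ Om D (n + 1) (a + ((k + 1 : ℕ) + 1)) (b - 1 - ((k + 1 : ℕ) + 1)) :=
      Om_congr (dR_mem hy rfl rfl) rfl (by push_cast; ring) (by push_cast; ring)
    have hw' : w ∈ Om D (n + 1) (a + ((k + 1 : ℕ) + 1)) (b - 1 - ((k + 1 : ℕ) + 1)) :=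
      Om_congr hw rfl (by push_cast; ring) (by push_cast; ring)
    have hTk : (T ^ (k + 1)) y ∈ Om D n (a + 1) (b - 1) :=
      Om_congr (T_pow_mem hy (k + 1)) rfl (by push_cast; ring) (by push_cast; ring)
    have h5 : dR (z - c⁻¹ • (T ^ (k + 1 + 1)) y) =
        (T ^ (k + 1 + 1)) (w - (c⁻¹ * s) • dR y) := by
      rw [map_sub, h, e, map_add, ← Module.End.mul_apply _ T, ← pow_succ, map_smul, h4, map_sub,
        map_smul, smul_add, smul_smul, smul_smul, inv_mul_cancel₀ hc, one_smul]
      abel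
    obtain ⟨y₁, hy₁, w₁, hw₁, e₁⟩ := ih (k + 1) (z - c⁻¹ • (T ^ (k + 1 + 1)) y)
      (w - (c⁻¹ * s) • dR y) (by push_cast at hk ⊢; omega)
      (Submodule.sub_mem _ hz (Submodule.smul_mem _ _ hTy))
      (Submodule.sub_mem _ hw' (Submodule.smul_mem _ _ hdy)) h5
    refine ⟨y₁, hy₁, w₁ + c⁻¹ • (T ^ (k + 1)) y, Submodule.add_mem _ hw₁
      (Submodule.smul_mem _ _ hTk), ?_⟩
    rw [map_add, map_smul, ← Module.End.mul_apply T, ← pow_succ', ← add_assoc, ← e₁,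
      sub_add_cancel]

/-- The term `dL` v is absorbed first: `dR` `T` v = `dL` v - `T` `dR` v, so replacing z by z - `T` v
leaves only an element of the range of `T`. -/
theorem column (hz : z ∈ Om D n a b) (hnb : 0 < n + b) (hab : b ≤ a + 1)
    {u v : Space D} (hu : u ∈ Om D (n + 1) (a + 1) (b - 2)) (hv : v ∈ Om D n (a + 1) (b - 1))
    (h : dR z = T u + dL v) :
    ∃ y ∈ Om D (n - 1) a (b + 1), ∃ w ∈ Om D n (a + 1) (b - 1), z = dR y + T w := by
  obtain ⟨y, hy, w, hw, e⟩ := column_aux hnb hab b.toNat 0 (z - T v) (u + dR v)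
    (by push_cast; omega) (Submodule.sub_mem _ hz (T_mem hv (by ring) (by ring)))
    (Submodule.add_mem _ (Om_congr hu rfl (by simp) (by push_cast; ring))
      (Om_congr (dR_mem hv rfl rfl) rfl (by simp) (by push_cast; ring)))
    (by rw [map_sub, h, dR_T, zero_add, pow_one, map_add]; abel)
  exact ⟨y, hy, w + v, Submodule.add_mem _ hw hv, by rw [map_add, ← add_assoc, ← e, sub_add_cancel]⟩

/-- The curl on the second column of a Young tensor, up to the range of `T`. -/
def G (a b : ℤ) : Module.End ℝ (Space D) := dR + ((a : ℝ) - b + 1)⁻¹ • (T' * dL)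

theorem G_apply (a b : ℤ) (z : Space D) :
    G a b z = dR z + ((a : ℝ) - b + 1)⁻¹ • T' (dL z) := rfl

theorem G_mem (hz : z ∈ Om D n a b) {n' b' : ℤ} (hn : n' = n + 1) (hb : b' = b - 1) :
    G a b z ∈ Om D n' a b' :=
  Submodule.add_mem _ (dR_mem hz hn hb) (Submodule.smul_mem _ _
    (T'_mem (dL_mem hz hn rfl) (by ring) hb))

theorem G_dL (a b : ℤ) (z : Space D) : G a b (dL z) = dL (dR z) := by
  rw [G_apply, dL_dL, map_zero, smul_zero, add_zero, dL_dR]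

theorem G_eq (a b : ℤ) (z : Space D) : G a b z =
    (1 + ((a : ℝ) - b + 1)⁻¹) • dR z - ((a : ℝ) - b + 1)⁻¹ • dL (T' z) := by
  rw [G_apply, dL_T']
  module

theorem dL_G (a b : ℤ) (z : Space D) :
    dL (G a b z) = (1 + ((a : ℝ) - b + 1)⁻¹) • dL (dR z) := by
  rw [G_eq, map_sub, map_smul, map_smul, dL_dL, smul_zero, sub_zero]

/-- With m = a - b + 1, the two terms in `T'` `dR` `dL` have coefficients -1/m and (1 + 1/m)/(m +
1), which cancel. -/
theorem G_G (hab : b ≤ a) (z : Space D) : G a (b - 1) (G a b z) = 0 := by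
  have h1 : (b : ℝ) ≤ a := by exact_mod_cast hab
  rw [G_apply, dL_G, G_apply, map_add, dR_dR, map_smul, dR_T', map_smul, dL_dR]
  push_cast
  rw [zero_add, smul_neg, smul_smul, ← neg_smul, ← add_smul]
  convert zero_smul ℝ _
  have h2 : (a : ℝ) - b + 1 ≠ 0 := by linarith
  have h3 : (a : ℝ) - (b - 1) + 1 ≠ 0 := by linarith
  field_simp
  ring

/-- `G` descends to Young tensors: its coefficient is chosen so that the `dL` w from `dR` `T` w
cancels against the one from commuting `T'` past `T`. -/
theorem G_T {w : Space D} (hab : b ≤ a) (hw : w ∈ Om D n (a + 1) (b - 1)) :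
    G a b (T w) = T (-dR w - ((a : ℝ) - b + 1)⁻¹ • T' (dL w)) := by
  have h1 : (b : ℝ) ≤ a := by exact_mod_cast hab
  have h2 : (a : ℝ) - b + 1 ≠ 0 := by linarith
  have h := T_T' (dL_mem hw rfl (a' := a) (by ring))
  rw [G_apply, dR_T, dL_T, map_neg, map_sub, map_neg, map_smul, h, smul_add, smul_smul]
  push_cast
  have e : ((a : ℝ) - b + 1)⁻¹ * (b - 1 - a) = -1 := by field_simp; ring
  rw [e]
  module

end

end Fock

/-! ### Sums over permutations -/

namespace TwoColumn

open Equiv (Perm)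
open Equiv.Perm (sign)
open scoped Nat

variable {D : ℕ} {W : Type*} [AddCommGroup W] [Module ℝ W]

theorem neg_one_pow_units_smul (k : ℕ) (w : W) : ((-1 : ℤˣ) ^ k) • w = (-1 : ℝ) ^ k • w := by
  rcases Nat.even_or_odd k with h | h
  · rw [h.neg_one_pow, h.neg_one_pow, one_smul, one_smul]
  · rw [h.neg_one_pow, h.neg_one_pow, Units.neg_smul, one_smul, neg_smul, one_smul]

theorem map_sign_smul {W' : Type*} [AddCommGroup W'] [Module ℝ W'] (f : W →ₗ[ℝ] W') (s : ℤˣ)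
    (w : W) : f (s • w) = s • f w := by
  simp [Units.smul_def]

/-- The decomposition of a sum over permutations according to the image of `0`. -/
theorem sum_perm_succ {n : ℕ} (H : Fin (n + 1) → (Fin n → Fin (n + 1)) → W) :
    ∑ σ : Perm (Fin (n + 1)), sign σ • H (σ 0) (fun k => σ k.succ) =
      ∑ k : Fin (n + 1), (-1 : ℝ) ^ (k : ℕ) •
        ∑ e : Perm (Fin n), sign e • H k (fun l => k.succAbove (e l)) := by
  -- The pair (k, e) gives the permutation that sends 0 to k and runs through the other values in
  -- the order e. The cycle that brings k to the front contributes the sign (-1)^k.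
  let g : Fin (n + 1) × Perm (Fin n) → Perm (Fin (n + 1)) := fun x =>
    x.1.cycleRange.symm * Equiv.Perm.decomposeFin.symm (0, x.2)
  have h0 : ∀ k e, g (k, e) 0 = k := fun k e => by
    simp [g, Fin.cycleRange_symm_zero]
  have h1 : ∀ k e l, g (k, e) (Fin.succ l) = k.succAbove (e l) := fun k e l => by
    simp [g, Fin.cycleRange_symm_succ]
  have hs : ∀ k e, sign (g (k, e)) = (-1 : ℤˣ) ^ (k : ℕ) * sign e := fun k e => by
    simp [g, Equiv.Perm.decomposeFin.symm_sign, Fin.sign_cycleRange]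
  have hg : Function.Bijective g := by
    rw [Fintype.bijective_iff_injective_and_card]
    refine ⟨?_, ?_⟩
    · rintro ⟨k, e⟩ ⟨k', e'⟩ h
      have hk : k = k' := by rw [← h0 k e, h, h0]
      subst hk
      refine Prod.ext rfl (Equiv.ext fun l => ?_)
      have := h1 k e l
      rw [h, h1] at this
      exact (Fin.succAbove_right_injective this).symm
    · simp [Fintype.card_perm, Nat.factorial_succ]
  rw [← hg.sum_comp, Fintype.sum_prod_type]
  refine Finset.sum_congr rfl fun k _ => ?_
  rw [Finset.smul_sum]
  refine Finset.sum_congr rfl fun e _ => ?_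
  rw [hs, h0, mul_smul, neg_one_pow_units_smul]
  simp only [h1]

theorem sum_sign_const {n : ℕ} (w : W) (t : Perm (Fin n) → W) (h : ∀ e, t e = sign e • w) :
    ∑ e, sign e • t e = (n ! : ℝ) • w := by
  simp only [h, smul_smul, Int.units_mul_self, one_smul, Finset.sum_const, Finset.card_univ,
    Fintype.card_perm, Fintype.card_fin]
  rw [Nat.cast_smul_eq_nsmul]

theorem sum_perm_alt {n : ℕ} (F : Fin D → (Fin n → Fin D) → W)
    (hF : ∀ c (σ : Perm (Fin n)) μ, F c (μ ∘ σ) = sign σ • F c μ) (κ : Fin (n + 1) → Fin D) :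
    ∑ σ : Perm (Fin (n + 1)), sign σ • F (κ (σ 0)) (fun k => κ (σ k.succ)) =
      (n ! : ℝ) • ∑ k : Fin (n + 1), (-1 : ℝ) ^ (k : ℕ) • F (κ k) (fun l => κ (k.succAbove l)) := by
  rw [sum_perm_succ fun k s => F (κ k) fun l => κ (s l), Finset.smul_sum]
  refine Finset.sum_congr rfl fun k _ => ?_
  rw [smul_comm (n ! : ℝ), sum_sign_const (F (κ k) fun l => κ (k.succAbove l))]
  exact fun e => hF _ e fun l => κ (k.succAbove l)

theorem sum_perm_alt_last {n : ℕ} (F : Fin D → (Fin n → Fin D) → W)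
    (hF : ∀ c (σ : Perm (Fin n)) μ, F c (μ ∘ σ) = sign σ • F c μ) (κ : Fin (n + 1) → Fin D) :
    ∑ σ : Perm (Fin (n + 1)), sign σ • F (κ (σ (Fin.last n))) (fun k => κ (σ k.castSucc)) =
      ((-1 : ℝ) ^ n * n !) •
        ∑ k : Fin (n + 1), (-1 : ℝ) ^ (k : ℕ) • F (κ k) (fun l => κ (k.succAbove l)) := by
  rw [sum_rotate, mul_smul, ← sum_perm_alt F hF κ, sign_finRotate, Nat.add_sub_cancel,
    neg_one_pow_units_smul]
  simp only [Equiv.Perm.mul_apply, finRotate_castSucc, finRotate_last]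

end TwoColumn

/-! ### Monomials with explicit indices -/

namespace Fock

noncomputable section

open scoped TensorProduct Nat
open Equiv (Perm)
open Equiv.Perm (sign)

variable {D : ℕ}

/-- The product of basis vectors of the exterior algebra. -/
def mono (l : List (Fin D)) : Ext D := (l.map fun c => ExteriorAlgebra.ι ℝ (Pi.single c 1)).prod

/-- The monomial `∂_{der} A_{l | m}`. -/
def sym (der : Multiset (Fin D)) (l m : List (Fin D)) : Space D :=
  Finsupp.single der 1 ⊗ₜ (mono l ⊗ₜ mono m)

theorem mono_cons (c : Fin D) (l : List (Fin D)) : mono (c :: l) = fermionUp c (mono l) := by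
  simp [mono, fermionUp]

theorem up_zero_sym (c : Fin D) (der : Multiset (Fin D)) (l m : List (Fin D)) :
    up 0 c (sym der l m) = sym (c ::ₘ der) l m := by
  change bosonUp c _ ⊗ₜ[ℝ] _ = _
  rw [bosonUp_single]
  rfl

theorem up_one_sym (c : Fin D) (der : Multiset (Fin D)) (l m : List (Fin D)) :
    up 1 c (sym der l m) = sym der (c :: l) m := by
  change _ ⊗ₜ[ℝ] (fermionUp c _ ⊗ₜ[ℝ] _) = _
  rw [← mono_cons]
  rfl

theorem up_two_sym (c : Fin D) (der : Multiset (Fin D)) (l m : List (Fin D)) :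
    up 2 c (sym der l m) = sym der l (c :: m) := by
  change _ ⊗ₜ[ℝ] (_ ⊗ₜ[ℝ] fermionUp c _) = _
  rw [← mono_cons]
  rfl

theorem word_eq_sym (L : List (Fin 3 × Fin D)) : ∃ der l m, word L = sym der l m ∧
    wordDegree L = ![(der.card : ℤ), (l.length : ℤ), (m.length : ℤ)] := by
  induction L with
  | nil =>
    refine ⟨0, [], [], rfl, ?_⟩
    ext u; fin_cases u <;> rfl
  | cons a L ih =>
    obtain ⟨der, l, m, h, h'⟩ := ih
    obtain ⟨u, c⟩ := a
    rw [word, h, wordDegree, h']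
    fin_cases u
    · refine ⟨c ::ₘ der, l, m, up_zero_sym .., ?_⟩
      ext u; fin_cases u <;> simp
    · refine ⟨der, c :: l, m, up_one_sym .., ?_⟩
      ext u; fin_cases u <;> simp
    · refine ⟨der, l, c :: m, up_two_sym .., ?_⟩
      ext u; fin_cases u <;> simp

theorem graded_congr {d e : Fin 3 → ℤ} {z : Space D} (hz : z ∈ graded D d) (h : d = e) :
    z ∈ graded D e := h ▸ hz

theorem sym_mem (der : Multiset (Fin D)) (l m : List (Fin D)) :
    sym der l m ∈ Om D der.card l.length m.length := by
  induction m with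
  | nil =>
    induction l with
    | nil =>
      induction der using Multiset.induction with
      | empty =>
        have h : sym (0 : Multiset (Fin D)) [] [] = word [] := rfl
        rw [h]
        exact graded_congr (word_mem []) (by ext u; fin_cases u <;> rfl)
      | cons c der ih =>
        rw [← up_zero_sym]
        refine graded_congr (up_mem ih 0 c) ?_
        ext u; fin_cases u <;> simp
    | cons c l ih =>
      rw [← up_one_sym]
      refine graded_congr (up_mem ih 1 c) ?_
      ext u; fin_cases u <;> simp
  | cons c m ih =>
    rw [← up_two_sym]
    refine graded_congr (up_mem ih 2 c) ?_
    ext u; fin_cases u <;> simp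

theorem Om_le {n a b : ℕ} {S : Submodule ℝ (Space D)}
    (h : ∀ (der : Multiset (Fin D)) (μ : Fin a → Fin D) (ν : Fin b → Fin D), der.card = n →
      sym der (List.ofFn μ) (List.ofFn ν) ∈ S) : Om D n a b ≤ S := by
  refine Submodule.span_le.2 ?_
  rintro _ ⟨L, hL, rfl⟩
  obtain ⟨der, l, m, e, e'⟩ := word_eq_sym L
  rw [hL] at e'
  have h0 : der.card = n := by have := congrFun e' 0; simp at this; omega
  have h1 : l.length = a := by have := congrFun e' 1; simp at this; omega
  have h2 : m.length = b := by have := congrFun e' 2; simp at this; omega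
  subst h1 h2
  have := h der l.get m.get h0
  rwa [List.ofFn_get, List.ofFn_get, ← e] at this

theorem bil_one_nil (u : Fin 3) (der : Multiset (Fin D)) (m : List (Fin D)) :
    bil u 1 (sym der [] m) = 0 := by
  have h : ∀ c : Fin D, down 1 c (sym der [] m) = 0 := fun c => by
    have h : fermionDown c (1 : Ext D) = 0 := CliffordAlgebra.contractLeft_one (Q := 0) _
    change _ ⊗ₜ[ℝ] (fermionDown c (1 : Ext D) ⊗ₜ[ℝ] _) = 0
    rw [h, TensorProduct.zero_tmul, TensorProduct.tmul_zero]
  simp [bil, LinearMap.sum_apply, h]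

theorem bil_two_nil (u : Fin 3) (der : Multiset (Fin D)) (l : List (Fin D)) :
    bil u 2 (sym der l []) = 0 := by
  have h : ∀ c : Fin D, down 2 c (sym der l []) = 0 := fun c => by
    have h : fermionDown c (1 : Ext D) = 0 := CliffordAlgebra.contractLeft_one (Q := 0) _
    change _ ⊗ₜ[ℝ] (_ ⊗ₜ[ℝ] fermionDown c (1 : Ext D)) = 0
    rw [h, TensorProduct.tmul_zero, TensorProduct.tmul_zero]
  simp [bil, LinearMap.sum_apply, h]

theorem up_comm {u v : Fin 3} (h : u ≠ v) (c d : Fin D) (z : Space D) :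
    up u c (up v d z) = up v d (up u c z) := by
  have := LinearMap.congr_fun (up_mul_up u v c d) z
  rw [sgn, if_neg (by tauto), one_smul] at this
  exact this

theorem bil_one_up {u : Fin 3} (hu : u ≠ 1) (c : Fin D) (z : Space D) :
    bil u 1 (up 1 c z) = up u c z - up 1 c (bil u 1 z) := by
  have := LinearMap.congr_fun (bil_mul_up u 1 1 c) z
  have h : sgn 1 1 * sgn u 1 = -1 := by simp [sgn, hu]
  rw [h, neg_smul, one_smul, if_pos rfl] at this
  rw [← Module.End.mul_apply, this, LinearMap.add_apply, LinearMap.neg_apply,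
    Module.End.mul_apply, neg_add_eq_sub]

theorem bil_two_up {u : Fin 3} (hu : u ≠ 2) (c : Fin D) (z : Space D) :
    bil u 2 (up 2 c z) = up u c z - up 2 c (bil u 2 z) := by
  have := LinearMap.congr_fun (bil_mul_up u 2 2 c) z
  have h : sgn 2 2 * sgn u 2 = -1 := by simp [sgn, hu]
  rw [h, neg_smul, one_smul, if_pos rfl] at this
  rw [← Module.End.mul_apply, this, LinearMap.add_apply, LinearMap.neg_apply,
    Module.End.mul_apply, neg_add_eq_sub]

theorem ofFn_succAbove_succ {n : ℕ} (μ : Fin (n + 2) → Fin D) (k : Fin (n + 1)) :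
    List.ofFn (fun l => μ (k.succ.succAbove l)) =
      μ 0 :: List.ofFn (fun l => μ (k.succAbove l).succ) := by
  rw [List.ofFn_succ]
  simp

theorem bil_one_sym {u : Fin 3} (hu : u ≠ 1) {n : ℕ} (der : Multiset (Fin D))
    (μ : Fin (n + 1) → Fin D) (m : List (Fin D)) : bil u 1 (sym der (List.ofFn μ) m) =
      ∑ k : Fin (n + 1), (-1 : ℝ) ^ (k : ℕ) •
        up u (μ k) (sym der (List.ofFn fun l => μ (k.succAbove l)) m) := by
  induction n with
  | zero => simp [← up_one_sym, bil_one_up hu, bil_one_nil]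
  | succ n ih =>
    rw [List.ofFn_succ, ← up_one_sym, bil_one_up hu, ih, map_sum, Fin.sum_univ_succ (n := n + 1),
      sub_eq_add_neg,      ← Finset.sum_neg_distrib]
    congr 1
    · simp
    · refine Finset.sum_congr rfl fun k _ => ?_
      rw [map_smul, up_comm hu.symm, up_one_sym, ofFn_succAbove_succ, Fin.val_succ, pow_succ,
        mul_neg_one, neg_smul]

theorem bil_two_sym {u : Fin 3} (hu : u ≠ 2) {n : ℕ} (der : Multiset (Fin D))
    (l : List (Fin D)) (ν : Fin (n + 1) → Fin D) : bil u 2 (sym der l (List.ofFn ν)) =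
      ∑ k : Fin (n + 1), (-1 : ℝ) ^ (k : ℕ) •
        up u (ν k) (sym der l (List.ofFn fun l => ν (k.succAbove l))) := by
  induction n with
  | zero => simp [← up_two_sym, bil_two_up hu, bil_two_nil]
  | succ n ih =>
    rw [List.ofFn_succ, ← up_two_sym, bil_two_up hu, ih, map_sum, Fin.sum_univ_succ (n := n + 1),
      sub_eq_add_neg,      ← Finset.sum_neg_distrib]
    congr 1
    · simp
    · refine Finset.sum_congr rfl fun k _ => ?_
      rw [map_smul, up_comm hu.symm, up_two_sym, ofFn_succAbove_succ, Fin.val_succ, pow_succ,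
        mul_neg_one, neg_smul]

theorem mono_perm {n : ℕ} (μ : Fin n → Fin D) (σ : Perm (Fin n)) :
    mono (List.ofFn (μ ∘ σ)) = sign σ • mono (List.ofFn μ) := by
  have h : ∀ μ : Fin n → Fin D, mono (List.ofFn μ) =
      ExteriorAlgebra.ιMulti ℝ n (fun k => Pi.single (μ k) (1 : ℝ)) := fun μ => by
    rw [mono, ExteriorAlgebra.ιMulti_apply, List.map_ofFn]
    rfl
  rw [h, h, ← AlternatingMap.map_perm]
  rfl

theorem sym_perm_left {n : ℕ} (der : Multiset (Fin D)) (μ : Fin n → Fin D) (σ : Perm (Fin n))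
    (m : List (Fin D)) : sym der (List.ofFn (μ ∘ σ)) m = sign σ • sym der (List.ofFn μ) m := by
  rw [sym, mono_perm, sym]
  rcases Int.units_eq_one_or (sign σ) with h | h <;>
    simp [h, TensorProduct.neg_tmul, TensorProduct.tmul_neg]

theorem sym_perm_right {n : ℕ} (der : Multiset (Fin D)) (l : List (Fin D)) (ν : Fin n → Fin D)
    (σ : Perm (Fin n)) : sym der l (List.ofFn (ν ∘ σ)) = sign σ • sym der l (List.ofFn ν) := by
  rw [sym, mono_perm, sym]
  rcases Int.units_eq_one_or (sign σ) with h | h <;>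
    simp [h, TensorProduct.tmul_neg]

theorem dL_sym {n : ℕ} (der : Multiset (Fin D)) (μ : Fin (n + 1) → Fin D) (m : List (Fin D)) :
    ∑ σ : Perm (Fin (n + 1)), sign σ •
      sym (μ (σ 0) ::ₘ der) (List.ofFn fun k => μ (σ k.succ)) m =
      (n ! : ℝ) • dL (sym der (List.ofFn μ) m) := by
  rw [TwoColumn.sum_perm_alt (fun c κ => sym (c ::ₘ der) (List.ofFn κ) m)
    (fun c σ κ => sym_perm_left _ κ σ m) μ, dL, bil_one_sym (by decide)]
  simp only [up_zero_sym]

theorem dR_sym {n : ℕ} (der : Multiset (Fin D)) (l : List (Fin D)) (ν : Fin (n + 1) → Fin D) :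
    ∑ σ : Perm (Fin (n + 1)), sign σ •
      sym (ν (σ (Fin.last n)) ::ₘ der) l (List.ofFn fun k => ν (σ k.castSucc)) =
      ((-1 : ℝ) ^ n * n !) • dR (sym der l (List.ofFn ν)) := by
  rw [TwoColumn.sum_perm_alt_last (fun c κ => sym (c ::ₘ der) l (List.ofFn κ))
    (fun c σ κ => sym_perm_right _ l κ σ) ν, dR, bil_two_sym (by decide)]
  simp only [up_zero_sym]

theorem T_sym {n : ℕ} (der : Multiset (Fin D)) (κ : Fin (n + 1) → Fin D) (m : List (Fin D)) :
    ∑ σ : Perm (Fin (n + 1)), sign σ •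
      sym der (List.ofFn fun k => κ (σ k.castSucc)) (κ (σ (Fin.last n)) :: m) =
      ((-1 : ℝ) ^ n * n !) • T (sym der (List.ofFn κ) m) := by
  rw [TwoColumn.sum_perm_alt_last (fun c κ => sym der (List.ofFn κ) (c :: m))
    (fun c σ κ => sym_perm_left _ κ σ _) κ, T, bil_one_sym (by decide)]
  simp only [up_two_sym]

/-- `θ_ν …` with `s` of the factors replaced by factors of the second column. -/
def mixed : List (Fin D) → ℕ → Module.End ℝ (Space D)
  | [], 0 => 1
  | [], _ + 1 => 0
  | c :: l, 0 => up 1 c * mixed l 0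
  | c :: l, s + 1 => up 1 c * mixed l (s + 1) + (-1 : ℝ) ^ l.length • (up 2 c * mixed l s)

theorem up_one_T (c : Fin D) (z : Space D) : up 1 c (T z) = up 2 c z - T (up 1 c z) := by
  rw [T, bil_one_up (by decide)]
  abel

theorem up_two_T (c : Fin D) (z : Space D) : up 2 c (T z) = -T (up 2 c z) := by
  have := LinearMap.congr_fun (bil_mul_up 2 1 2 c) z
  have h : sgn 1 2 * sgn 2 2 = -1 := by simp [sgn]
  rw [h, neg_smul, one_smul, if_neg (by decide), add_zero] at this
  change T (up 2 c z) = -up 2 c (T z) at this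
  rw [this, neg_neg]

theorem up_two_dL (c : Fin D) (z : Space D) : up 2 c (dL z) = dL (up 2 c z) := by
  have := LinearMap.congr_fun (bil_mul_up 0 1 2 c) z
  have h : sgn 1 2 * sgn 0 2 = 1 := by simp [sgn]
  rw [h, one_smul, if_neg (by decide), add_zero] at this
  exact this.symm

/-- Moving `T` to the left past a factor of the first column turns that factor into one of the
second. Each choice of s + 1 converted factors arises s + 1 times, according to which one was
converted by this `T`. -/
theorem mixed_T (l : List (Fin D)) (s : ℕ) (z : Space D) : mixed l s (T z) =
    (-1 : ℝ) ^ l.length • T (mixed l s z) + ((s : ℝ) + 1) • mixed l (s + 1) z := by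
  induction l generalizing s with
  | nil => cases s <;> simp [mixed]
  | cons c l ih =>
    cases s with
    | zero =>
      simp only [mixed, Module.End.mul_apply, LinearMap.add_apply, LinearMap.smul_apply, ih, map_add,
        map_smul, up_one_T, List.length_cons, pow_succ]
      push_cast
      module
    | succ s =>
      simp only [mixed, Module.End.mul_apply, LinearMap.add_apply, LinearMap.smul_apply, ih, map_add,
        map_smul, up_one_T, up_two_T, List.length_cons, pow_succ]
      push_cast
      rcases neg_one_pow_eq_or ℝ l.length with h | h <;> rw [h] <;> module

/-- The product of the signs `(-1)^s` for `s < k`. -/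
def signProd (k : ℕ) : ℝ := ∏ s ∈ Finset.range k, (-1 : ℝ) ^ s

theorem signProd_succ (k : ℕ) : signProd (k + 1) = signProd k * (-1) ^ k :=
  Finset.prod_range_succ _ _

/-- The product of factors of the second column. -/
def upTwo (l : List (Fin D)) : Module.End ℝ (Space D) := (l.map (up 2)).prod

theorem upTwo_cons (c : Fin D) (l : List (Fin D)) (z : Space D) :
    upTwo (c :: l) z = up 2 c (upTwo l z) := by
  simp [upTwo]

theorem mixed_of_lt (l : List (Fin D)) (s : ℕ) (h : l.length < s) : mixed l s = 0 := by
  induction l generalizing s with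
  | nil =>
    cases s with
    | zero => simp at h
    | succ s => rfl
  | cons c l ih =>
    cases s with
    | zero => simp at h
    | succ s =>
      simp at h
      rw [mixed, ih _ (by omega), ih _ h]
      simp

theorem mixed_length (l : List (Fin D)) :
    mixed l l.length = signProd l.length • upTwo l := by
  induction l with
  | nil => simp [mixed, signProd, upTwo]
  | cons c l ih =>
    rw [List.length_cons, mixed, mixed_of_lt l _ (Nat.lt_succ_self _), ih, signProd_succ]
    have h : (upTwo (c :: l) : Module.End ℝ (Space D)) = up 2 c * upTwo l :=
      LinearMap.ext (upTwo_cons c l)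
    rw [h]
    simp [smul_smul, mul_comm]

/-- With all but one factor in the second column, the sum over the remaining one is what `T'`
produces by moving one factor back. The hypothesis on `z` removes the term in which `T'` passes all
factors. -/
theorem mixed_pred {z : Space D} (hz : T' z = 0) (c : Fin D) (l : List (Fin D)) :
    mixed (c :: l) l.length z = signProd l.length • T' (upTwo (c :: l) z) := by
  induction l generalizing c with
  | nil =>
    have h : T' (upTwo [c] z) = up 1 c z := by
      rw [upTwo_cons, T', bil_two_up (by decide), ← T']
      simp [upTwo, hz]
    rw [h]
    simp [mixed, signProd]
  | cons d l ih =>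
    rw [List.length_cons, mixed, ← List.length_cons (a := d), mixed_length, LinearMap.add_apply,
      LinearMap.smul_apply, Module.End.mul_apply, Module.End.mul_apply, List.length_cons, ih,
      upTwo_cons c, T', bil_two_up (by decide), ← T', map_smul, smul_sub, LinearMap.smul_apply,
      map_smul, sub_eq_add_neg, ← smul_neg]
    congr 1
    rw [signProd_succ, smul_smul, pow_succ]
    module

end

end Fock

/-! ### The exchanged term of the curl on the second column -/

namespace Fock

noncomputable section

open scoped TensorProduct Nat
open Equiv (Perm)
open Equiv.Perm (sign)

variable {D : ℕ} {W : Type*} [AddCommGroup W] [Module ℝ W]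

theorem signProd_mul_self (k : ℕ) : signProd k * signProd k = 1 := by
  rw [signProd, ← Finset.prod_mul_distrib]
  refine Finset.prod_eq_one fun s _ => ?_
  rw [← mul_pow]
  norm_num

/-- The monomial with the first `R` factors moved to the second column and the next one turned into
a derivative. -/
def shifted {P : ℕ} (R : ℕ) (h : R < P) (der : Multiset (Fin D)) (μ : Fin P → Fin D) : Space D :=
  sym (μ ⟨R, h⟩ ::ₘ der) ((List.ofFn μ).drop (R + 1)) ((List.ofFn μ).take R)

theorem up_two_T_pow (c : Fin D) (k : ℕ) (z : Space D) :
    up 2 c ((T ^ k) z) = (-1 : ℝ) ^ k • (T ^ k) (up 2 c z) := by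
  induction k generalizing z with
  | zero => simp
  | succ k ih =>
    rw [pow_succ T, Module.End.mul_apply, ih, up_two_T, map_neg, pow_succ, Module.End.mul_apply]
    module

/-- Induction on R, peeling off the first index: creating it in the second column commutes with
`T`^R `dL` up to a sign, and the alternating sum over its value is one more `T`. -/
theorem sum_shifted (R : ℕ) : ∀ {P : ℕ} (h : R < P) (der : Multiset (Fin D)) (μ : Fin P → Fin D),
    ∑ σ : Perm (Fin P), sign σ • shifted R h der (fun k => μ (σ k)) =
      ((P - R - 1)! * ((-1) ^ R * signProd R) : ℝ) • (T ^ R) (dL (sym der (List.ofFn μ) [])) := by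
  induction R with
  | zero =>
    intro P h der μ
    obtain ⟨n, rfl⟩ : ∃ n, P = n + 1 := ⟨P - 1, by omega⟩
    have := dL_sym der μ []
    simpa [shifted, signProd, List.ofFn_succ] using this
  | succ R ih =>
    intro P h der μ
    obtain ⟨n, rfl⟩ : ∃ n, P = n + 1 := ⟨P - 1, by omega⟩
    have h' : R < n := by omega
    have h1 : ∀ κ : Fin (n + 1) → Fin D, shifted (R + 1) h der κ =
        up 2 (κ 0) (shifted R h' der (fun k => κ k.succ)) := by
      intro κ
      rw [shifted, shifted, up_two_sym, List.ofFn_succ]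
      rfl
    simp only [h1]
    rw [TwoColumn.sum_perm_succ fun k s => up 2 (μ k) (shifted R h' der (fun l => μ (s l)))]
    have h2 : ∀ k : Fin (n + 1), ∑ e : Perm (Fin n), sign e •
        up 2 (μ k) (shifted R h' der (fun l => μ (k.succAbove (e l)))) =
        ((n - R - 1)! * ((-1) ^ R * signProd R) * (-1) ^ R : ℝ) • (T ^ R) (dL (up 2 (μ k)
          (sym der (List.ofFn fun l => μ (k.succAbove l)) []))) := by
      intro k
      have := congrArg (up 2 (μ k)) (ih h' der fun l => μ (k.succAbove l))
      rw [map_sum, map_smul, up_two_T_pow, up_two_dL, smul_smul] at this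
      rw [← this]
      refine Finset.sum_congr rfl fun e _ => ?_
      rw [TwoColumn.map_sign_smul]
    simp only [h2, smul_comm ((-1 : ℝ) ^ (_ : ℕ))]
    simp only [← map_smul (T ^ R), ← map_smul dL]
    rw [← map_sum, ← map_sum, ← Finset.smul_sum, ← bil_one_sym (by decide), ← T, map_smul, dL_T,
      map_smul, map_neg, ← Module.End.mul_apply, ← pow_succ, signProd_succ,
      Nat.add_sub_add_right]
    rw [smul_neg, ← neg_smul, pow_succ (-1 : ℝ)]
    congr 1
    have : ((-1 : ℝ) ^ R) * (-1) ^ R = 1 := by rw [← mul_pow]; norm_num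
    ring

theorem mixed_zero_sym (l : List (Fin D)) (der : Multiset (Fin D)) (l' m : List (Fin D)) :
    mixed l 0 (sym der l' m) = sym der (l ++ l') m := by
  induction l with
  | nil => rfl
  | cons c l ih => rw [mixed, Module.End.mul_apply, ih, up_one_sym, List.cons_append]

theorem upTwo_sym (l : List (Fin D)) (der : Multiset (Fin D)) (l' : List (Fin D)) :
    upTwo l (sym der l' []) = sym der l' l := by
  induction l with
  | nil => rfl
  | cons c l ih => rw [upTwo_cons, ih, up_two_sym]

theorem upTwo_dL (l : List (Fin D)) (z : Space D) : upTwo l (dL z) = dL (upTwo l z) := by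
  induction l with
  | nil => rfl
  | cons c l ih => rw [upTwo_cons, ih, up_two_dL, upTwo_cons]

/-- Modulo the range of `T`, each `T` to the right of the block `l` only moves one more of its
factors to the second column. -/
theorem mixed_T_pow {f : Space D →ₗ[ℝ] W} (hf : ∀ z, f (T z) = 0) (l : List (Fin D)) (k : ℕ) :
    ∀ (s : ℕ) (z : Space D),
      (s ! : ℝ) • f (mixed l s ((T ^ k) z)) = ((s + k)! : ℝ) • f (mixed l (s + k) z) := by
  induction k with
  | zero => intro s z; rfl
  | succ k ih =>
    intro s z
    rw [pow_succ', Module.End.mul_apply, mixed_T, map_add, map_smul, hf, smul_zero, zero_add,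
      map_smul, smul_smul]
    have := ih (s + 1) z
    rw [Nat.factorial_succ, Nat.cast_mul, mul_comm ((s + 1 : ℕ) : ℝ)] at this
    push_cast at this
    rw [this]
    have e : s + 1 + k = s + (k + 1) := by ring
    rw [e]

/-- The monomial is the block of all ν's in the first column, applied to a shifted monomial. The
shifted monomials add up to a multiple of `T`^R `dL`; these R operators `T` push R of the R + 1 ν's
to the second column, and the sum over the one left behind is a `T'`. -/
theorem sum_second {f : Space D →ₗ[ℝ] W} (hf : ∀ z, f (T z) = 0) {P R : ℕ} (h : R + 1 ≤ P)
    (der : Multiset (Fin D)) (μ : Fin P → Fin D) (ν : Fin (R + 1) → Fin D) :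
    ∑ σ : Perm (Fin P), sign σ • f (sym (μ (σ ⟨R, h⟩) ::ₘ der)
      (List.ofFn fun k : Fin P => if hk : (k : ℕ) < R + 1 then ν ⟨k, hk⟩ else μ (σ k))
      (List.ofFn fun k : Fin R => μ (σ ⟨k, by omega⟩))) =
      ((P - R - 1)! * (R ! * (-1) ^ R) : ℝ) •
        f (T' (dL (sym der (List.ofFn μ) (List.ofFn ν)))) := by
  have h1 : ∀ κ : Fin P → Fin D, sym (κ ⟨R, h⟩ ::ₘ der)
      (List.ofFn fun k : Fin P => if hk : (k : ℕ) < R + 1 then ν ⟨k, hk⟩ else κ k)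
      (List.ofFn fun k : Fin R => κ ⟨k, by omega⟩) =
      mixed (List.ofFn ν) 0 (shifted R h der κ) := by
    intro κ
    rw [shifted, mixed_zero_sym]
    congr 1
    · refine List.ext_getElem (by simp; omega) fun i hi hi' => ?_
      rw [List.getElem_append]
      simp only [List.length_ofFn, List.getElem_ofFn, List.getElem_drop]
      split_ifs with h1
      · rfl
      · congr 2
        omega
    · refine List.ext_getElem (by simp; omega) fun i hi hi' => ?_
      simp
  refine (Finset.sum_congr rfl fun σ _ => congrArg (sign σ • ·)
    (congrArg f (h1 fun k => μ (σ k)))).trans ?_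
  simp only [← TwoColumn.map_sign_smul]
  have h2 : T' (dL (sym der (List.ofFn μ) [])) = 0 := by
    have := T'_mem (dL_mem (sym_mem der (List.ofFn μ) []) rfl rfl) rfl rfl
    exact eq_zero_of_neg this (u := 2) (by simp)
  have h3 := mixed_T_pow hf (List.ofFn ν) R 0 (dL (sym der (List.ofFn μ) []))
  have h4 := mixed_pred h2 (ν 0) (List.ofFn fun k => ν k.succ)
  rw [← List.ofFn_succ, List.length_ofFn, upTwo_dL, upTwo_sym] at h4
  rw [Nat.factorial_zero, Nat.cast_one, one_smul, zero_add, h4] at h3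
  rw [← map_sum, ← map_sum, sum_shifted R h der μ, map_smul, map_smul, h3, map_smul, smul_smul,
    smul_smul]
  congr 1
  linear_combination ((P - R - 1)! * (-1) ^ R * R ! : ℝ) * signProd_mul_self R

end

end Fock

/-! ### The two curls as `dL` and `G` -/

namespace TwoColumn

noncomputable section

open Equiv (Perm)
open Equiv.Perm (sign)
open scoped Nat
open Fock (Space sym dL dR G)

variable {D : ℕ} {W : Type*} [AddCommGroup W] [Module ℝ W]

theorem curlLeft_sym (f : Space D →ₗ[ℝ] W) {P Q P' : ℕ} (h : P' = P + 1) (der : Multiset (Fin D))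
    (μ : Fin P' → Fin D) (ν : Fin Q → Fin D) :
    curlLeft (fun c (μ' : Fin P → Fin D) ν' => f (sym (c ::ₘ der) (List.ofFn μ') (List.ofFn ν')))
      h μ ν = f ((P' : ℝ)⁻¹ • dL (sym der (List.ofFn μ) (List.ofFn ν))) := by
  subst h
  rw [curlLeft]
  simp only [← map_sign_smul, ← map_sum]
  have := Fock.dL_sym der μ (List.ofFn ν)
  rw [← map_smul]
  congr 1
  refine (congrArg _ this).trans ?_
  rw [smul_smul, Nat.factorial_succ]
  congr 1
  have : (P ! : ℝ) ≠ 0 := by positivity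
  push_cast
  field_simp

/-- The number a_{i,j} enters here: it makes the exchanged term, relative to the plain curl `dR`,
exactly (P - Q + 1)⁻¹ `T'` `dL`. -/
theorem curlRight_sym {f : Space D →ₗ[ℝ] W} (hf : ∀ z, f (Fock.T z) = 0) {P Q R : ℕ}
    (h : Q = R + 1) (hPQ : Q ≤ P) (der : Multiset (Fin D)) (μ : Fin P → Fin D)
    (ν : Fin Q → Fin D) :
    curlRight (fun c μ' (ν' : Fin R → Fin D) =>
      f (sym (c ::ₘ der) (List.ofFn μ') (List.ofFn ν'))) h hPQ μ ν =
      f (((-1 : ℝ) ^ R / Q) • G P Q (sym der (List.ofFn μ) (List.ofFn ν))) := by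
  subst h
  rw [curlRight]
  have h1 := Fock.dR_sym der (List.ofFn μ) ν
  have h2 := Fock.sum_second hf hPQ der μ ν
  have e : P - (R + 1) + 1 = (P - R - 1) + 1 := by omega
  have h3 : ∑ τ : Perm (Fin (R + 1)), sign τ • f (sym (ν (τ (Fin.last R)) ::ₘ der) (List.ofFn μ)
      (List.ofFn fun k => ν (τ k.castSucc))) =
      f (((-1 : ℝ) ^ R * R !) • dR (sym der (List.ofFn μ) (List.ofFn ν))) := by
    rw [← h1, map_sum]
    simp only [map_sign_smul]
  refine (congrArg₂ (· + ·) (congrArg (((R + 1)! : ℝ)⁻¹ • ·) h3) (congrArg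
    (((P ! : ℝ) / ((P - (R + 1) + 1)! * (R + 1)!)) • (P ! : ℝ)⁻¹ • ·) h2)).trans ?_
  · have hP : (P ! : ℝ) ≠ 0 := by positivity
    have hR : (R ! : ℝ) ≠ 0 := by positivity
    have hPR : ((P - R - 1)! : ℝ) ≠ 0 := by positivity
    have hc : ((P - R - 1 : ℕ) : ℝ) + 1 = (P : ℝ) - R := by
      rw [Nat.sub_sub, Nat.cast_sub hPQ]
      push_cast
      ring
    have hc' : (P : ℝ) - R ≠ 0 := by rw [← hc]; positivity
    rw [e, Nat.factorial_succ, Nat.factorial_succ, Fock.G_apply, smul_add, map_add, map_smul f _ (_),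
      smul_smul, smul_smul, smul_smul, map_smul, smul_smul, map_smul]
    push_cast
    rw [hc]
    have e2 : (P : ℝ) - (R + 1) + 1 = P - R := by ring
    rw [e2]
    congr 2
    · field_simp
    · field_simp

end

end TwoColumn

/-! ### Linear maps with prescribed antisymmetric components -/

namespace Fock

noncomputable section

open scoped TensorProduct
open Equiv (Perm)
open Equiv.Perm (sign)

variable {D : ℕ} {W : Type*} [AddCommGroup W] [Module ℝ W]

/-- The alternating map with given antisymmetric components. -/
def altOfBasis {n : ℕ} (f : (Fin n → Fin D) → W)
    (hf : ∀ (σ : Perm (Fin n)) μ, f (μ ∘ σ) = sign σ • f μ) : (Fin D → ℝ) [⋀^Fin n]→ₗ[ℝ] W :=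
  { (∑ μ : Fin n → Fin D, ((MultilinearMap.mkPiAlgebra ℝ (Fin n) ℝ).compLinearMap
      fun k => LinearMap.proj (μ k)).smulRight (f μ) :
      MultilinearMap ℝ (fun _ : Fin n => Fin D → ℝ) W) with
    map_eq_zero_of_eq' := by
      intro v i j hv hij
      set S := (∑ μ : Fin n → Fin D, ((MultilinearMap.mkPiAlgebra ℝ (Fin n) ℝ).compLinearMap
        fun k => LinearMap.proj (μ k)).smulRight (f μ) :
        MultilinearMap ℝ (fun _ : Fin n => Fin D → ℝ) W) v with hS
      change S = 0
      have h1 : S = ∑ μ : Fin n → Fin D, (∏ k, v k (μ k)) • f μ := by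
        simp [hS]
      have hvs : ∀ k, v (Equiv.swap i j k) = v k := fun k => by
        rcases eq_or_ne k i with rfl | hi
        · rw [Equiv.swap_apply_left, hv]
        · rcases eq_or_ne k j with rfl | hj
          · rw [Equiv.swap_apply_right, hv]
          · rw [Equiv.swap_apply_of_ne_of_ne hi hj]
      -- Reindexing the sum over μ by the transposition of i and j preserves the products, as v i =
      -- v j, and changes the sign of `f`.
      have h2 : S = -S := by
        refine (h1.trans (Equiv.sum_comp ((Equiv.swap i j).arrowCongr (Equiv.refl (Fin D)))
          _).symm).trans ?_
        rw [h1, ← Finset.sum_neg_distrib]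
        refine Finset.sum_congr rfl fun μ _ => ?_
        have e : ((Equiv.swap i j).arrowCongr (Equiv.refl (Fin D))) μ = μ ∘ Equiv.swap i j := rfl
        rw [e, hf, Equiv.Perm.sign_swap hij, Units.neg_smul, one_smul, smul_neg,
          ← Equiv.prod_comp (Equiv.swap i j)]
        simp [hvs]
      have h3 : (2 : ℝ) • S = 0 := by
        rw [two_smul]
        nth_rewrite 1 [h2]
        exact neg_add_cancel S
      exact (smul_eq_zero.1 h3).resolve_left two_ne_zero }

theorem altOfBasis_apply {n : ℕ} (f : (Fin n → Fin D) → W)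
    (hf : ∀ (σ : Perm (Fin n)) μ, f (μ ∘ σ) = sign σ • f μ) (κ : Fin n → Fin D) :
    altOfBasis f hf (fun k => Pi.single (κ k) 1) = f κ := by
  have h : altOfBasis f hf (fun k => Pi.single (κ k) 1) =
      ∑ μ : Fin n → Fin D, (∏ k, (Pi.single (κ k) 1 : Fin D → ℝ) (μ k)) • f μ := by
    change (∑ μ : Fin n → Fin D, ((MultilinearMap.mkPiAlgebra ℝ (Fin n) ℝ).compLinearMap
        fun k => LinearMap.proj (μ k)).smulRight (f μ) :
        MultilinearMap ℝ (fun _ : Fin n => Fin D → ℝ) W) _ = _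
    simp
  rw [h, Finset.sum_eq_single κ]
  · simp
  · intro μ _ hμ
    obtain ⟨k, hk⟩ := Function.ne_iff.1 hμ
    rw [Finset.prod_eq_zero (Finset.mem_univ k) (Pi.single_eq_of_ne hk _), zero_smul]
  · simp

theorem liftAlternating_mono (g : ∀ n, (Fin D → ℝ) [⋀^Fin n]→ₗ[ℝ] W) {n : ℕ} (μ : Fin n → Fin D) :
    ExteriorAlgebra.liftAlternating g (mono (List.ofFn μ)) =
      g n (fun k => Pi.single (μ k) 1) := by
  rw [← ExteriorAlgebra.liftAlternating_apply_ιMulti, ExteriorAlgebra.ιMulti_apply, mono,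
    List.map_ofFn]
  rfl

/-- The bilinear map on exterior algebras with given antisymmetric components. -/
def biAlternating (f : ∀ a b, (Fin a → Fin D) → (Fin b → Fin D) → W)
    (hL : ∀ a b (σ : Perm (Fin a)) μ ν, f a b (μ ∘ σ) ν = sign σ • f a b μ ν)
    (hR : ∀ a b (σ : Perm (Fin b)) μ ν, f a b μ (ν ∘ σ) = sign σ • f a b μ ν) :
    Ext D →ₗ[ℝ] Ext D →ₗ[ℝ] W :=
  ExteriorAlgebra.liftAlternating fun a => altOfBasis
    (fun μ => ExteriorAlgebra.liftAlternating fun b =>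
      altOfBasis (f a b μ) fun σ ν => hR a b σ μ ν) (by
    intro σ μ
    have h : (fun b => altOfBasis (f a b (μ ∘ σ)) fun τ ν => hR a b τ (μ ∘ σ) ν) =
        ((sign σ : ℤ) : ℝ) • fun b => altOfBasis (f a b μ) fun τ ν => hR a b τ μ ν := by
      funext b
      refine (Pi.basisFun ℝ (Fin D)).ext_alternating fun ν _ => ?_
      simp only [Pi.basisFun_apply, altOfBasis_apply, Pi.smul_apply, AlternatingMap.smul_apply, hL]
      rw [Units.smul_def, ← Int.cast_smul_eq_zsmul ℝ]
    rw [h, map_smul, Units.smul_def, ← Int.cast_smul_eq_zsmul ℝ])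

theorem biAlternating_apply (f : ∀ a b, (Fin a → Fin D) → (Fin b → Fin D) → W)
    (hL : ∀ a b (σ : Perm (Fin a)) μ ν, f a b (μ ∘ σ) ν = sign σ • f a b μ ν)
    (hR : ∀ a b (σ : Perm (Fin b)) μ ν, f a b μ (ν ∘ σ) = sign σ • f a b μ ν) {a b : ℕ}
    (μ : Fin a → Fin D) (ν : Fin b → Fin D) :
    biAlternating f hL hR (mono (List.ofFn μ)) (mono (List.ofFn ν)) = f a b μ ν := by
  rw [biAlternating, liftAlternating_mono, altOfBasis_apply, liftAlternating_mono,
    altOfBasis_apply]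

end

end Fock

/-! ### Linear functions as the quotient of the Fock space by the range of `T` -/

namespace TwoColumn

noncomputable section

open Equiv (Perm)
open Equiv.Perm (sign)
open scoped Nat TensorProduct
open Fock (Space Om sym dL dR G mono)

set_option linter.unusedSectionVars false

variable {D P Q p q : ℕ} {W : Type*} [AddCommGroup W] [Module ℝ W]

theorem IsYoung.cast {f : (Fin P → Fin D) → (Fin Q → Fin D) → W} (hf : IsYoung f) {P' Q' : ℕ}
    (hP : P = P') (hQ : Q = Q') :
    IsYoung fun (μ : Fin P' → Fin D) (ν : Fin Q' → Fin D) =>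
      f (fun k => μ (Fin.cast hP k)) (fun k => ν (Fin.cast hQ k)) := by
  subst hP hQ
  exact hf

variable (p q) in
/-- The component of the field or ghost with given numbers of indices (zero if there is none). -/
def component (der : Multiset (Fin D)) (a b : ℕ) (μ : Fin a → Fin D) (ν : Fin b → Fin D) :
    LinearFunction D p q :=
  if h : q ≤ a ∧ a ≤ p ∧ b ≤ q then
    var ⟨false, p - a, q - b, by omega, by omega, der, fun k => μ (Fin.cast (by omega) k),
      fun k => ν (Fin.cast (by omega) k)⟩
  else 0

theorem isYoung_component (der : Multiset (Fin D)) (a b : ℕ) :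
    IsYoung (component p q der a b) := by
  by_cases h : q ≤ a ∧ a ≤ p ∧ b ≤ q
  · have := (isYoung_var (D := D) (p := p) (q := q) false (p - a) (q - b) (by omega) (by omega)
      der).cast (P' := a) (Q' := b) (by omega) (by omega)
    convert this using 3
    rw [component, dif_pos h]
  · have : component p q der a b = fun _ _ => 0 := by
      funext μ ν
      rw [component, dif_neg h]
    rw [this]
    exact IsYoung.zero

theorem component_sub {i j : ℕ} (hi : i + q ≤ p) (hj : j ≤ q) (der : Multiset (Fin D))
    (μ : Fin (p - i) → Fin D) (ν : Fin (q - j) → Fin D) :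
    component p q der (p - i) (q - j) μ ν = var ⟨false, i, j, hi, hj, der, μ, ν⟩ := by
  have h : ∀ i' j' (hi' : i' + q ≤ p) (hj' : j' ≤ q) (e : i' = i) (e' : j' = j),
      (⟨false, i', j', hi', hj', der, fun k => μ (Fin.cast (by rw [e]) k),
        fun k => ν (Fin.cast (by rw [e']) k)⟩ : JetVar D p q) = ⟨false, i, j, hi, hj, der, μ, ν⟩ := by
    rintro _ _ _ _ rfl rfl
    rfl
  rw [component, dif_pos (by omega)]
  congr 1
  exact h _ _ _ _ (by omega) (by omega)

variable (D p q) in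
/-- The linear map that interprets the monomials as fields and ghosts. -/
def proj : Space D →ₗ[ℝ] LinearFunction D p q :=
  TensorProduct.lift (Finsupp.linearCombination ℝ fun der => TensorProduct.lift
    (Fock.biAlternating (component p q der)
      (fun a b => (isYoung_component der a b).alt_left)
      (fun a b σ μ ν => (isYoung_component der a b).alt_right σ μ ν)))

theorem proj_sym (der : Multiset (Fin D)) {a b : ℕ} (μ : Fin a → Fin D) (ν : Fin b → Fin D) :
    proj D p q (sym der (List.ofFn μ) (List.ofFn ν)) = component p q der a b μ ν := by
  rw [proj, sym, TensorProduct.lift.tmul, Finsupp.linearCombination_single, one_smul,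
    TensorProduct.lift.tmul, Fock.biAlternating_apply]

theorem var_eq_proj (i j : ℕ) (hi : i + q ≤ p) (hj : j ≤ q) (der : Multiset (Fin D))
    (μ : Fin (p - i) → Fin D) (ν : Fin (q - j) → Fin D) :
    var (⟨false, i, j, hi, hj, der, μ, ν⟩ : JetVar D p q) =
      proj D p q (sym der (List.ofFn μ) (List.ofFn ν)) := by
  rw [proj_sym, component_sub hi hj]

/-- Up to a nonzero constant, `T` antisymmetrizes the first column together with the leading index
of the second. These are the Garnir relations of the components. -/
theorem proj_T (z : Space D) : proj D p q (Fock.T z) = 0 := by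
  have h : (⊤ : Submodule ℝ (Space D)) ≤ LinearMap.ker (proj D p q ∘ₗ Fock.T) := by
    rw [← Fock.iSup_graded]
    refine iSup_le fun d => Submodule.span_le.2 ?_
    rintro _ ⟨L, -, rfl⟩
    obtain ⟨der, l, m, e, -⟩ := Fock.word_eq_sym L
    rw [e, SetLike.mem_coe, LinearMap.mem_ker, LinearMap.comp_apply]
    obtain ⟨a, μ, rfl⟩ : ∃ (a : ℕ) (μ : Fin a → Fin D), l = List.ofFn μ :=
      ⟨_, l.get, (List.ofFn_get l).symm⟩
    cases a with
    | zero => rw [Fock.T, List.ofFn_zero, Fock.bil_one_nil, map_zero]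
    | succ n =>
      obtain ⟨b, ν, rfl⟩ : ∃ (b : ℕ) (ν : Fin b → Fin D), m = List.ofFn ν :=
        ⟨_, m.get, (List.ofFn_get m).symm⟩
      have h1 := congrArg (proj D p q) (Fock.T_sym der μ (List.ofFn ν))
      have h2 := (isYoung_component (p := p) (q := q) der n (b + 1)).garnir (Nat.succ_pos b) μ
        (Fin.cons (μ 0) ν)
      have h3 : ∀ c : Fin D, c :: List.ofFn ν = List.ofFn (Fin.cons c ν : Fin (b + 1) → Fin D) :=
        fun c => by rw [List.ofFn_succ]; simp
      have h4 : ∀ c : Fin D, Function.update (Fin.cons (μ 0) ν : Fin (b + 1) → Fin D)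
          ⟨0, Nat.succ_pos b⟩ c = Fin.cons c ν := fun c => Fin.update_cons_zero _ _ _
      simp only [h4] at h2
      rw [map_sum] at h1
      simp only [map_sign_smul, h3, proj_sym, h2, map_smul] at h1
      exact (smul_eq_zero.1 h1.symm).resolve_left (mul_ne_zero (by simp) (by positivity))
  exact h trivial

/-- This implements the convention that fields outside the range of (i, j) are zero. -/
theorem proj_eq_zero {n a b : ℤ} {z : Space D} (hz : z ∈ Om D n a b)
    (h : ¬ (q ≤ a ∧ a ≤ p ∧ b ≤ q)) : proj D p q z = 0 := by
  have : Om D n a b ≤ LinearMap.ker (proj D p q) := by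
    refine Submodule.span_le.2 ?_
    rintro _ ⟨L, hL, rfl⟩
    obtain ⟨der, l, m, e, e'⟩ := Fock.word_eq_sym L
    rw [hL] at e'
    have h1 := congrFun e' 1
    have h2 := congrFun e' 2
    simp at h1 h2
    rw [SetLike.mem_coe, LinearMap.mem_ker, e, ← List.ofFn_get l, ← List.ofFn_get m, proj_sym,
      component, dif_neg (by omega)]
  exact this hz

theorem isYoung_sym (der : Multiset (Fin D)) (P Q : ℕ) :
    IsYoung fun (μ : Fin P → Fin D) (ν : Fin Q → Fin D) =>
      (LinearMap.range (Fock.T (D := D))).mkQ (sym der (List.ofFn μ) (List.ofFn ν)) where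
  alt_left σ μ ν := by rw [Fock.sym_perm_left, map_sign_smul]
  alt_right σ μ ν := by rw [Fock.sym_perm_right, map_sign_smul]
  garnir h κ ν := by
    obtain ⟨R, rfl⟩ : ∃ R, Q = R + 1 := ⟨Q - 1, by omega⟩
    have h1 := Fock.T_sym der κ (List.ofFn fun k => ν k.succ)
    have h2 : ∀ c : Fin D, List.ofFn (Function.update ν ⟨0, h⟩ c) =
        c :: List.ofFn fun k => ν k.succ := by
      intro c
      rw [List.ofFn_succ]
      congr 1
    simp only [h2, ← map_sign_smul]
    rw [← map_sum, h1, Submodule.mkQ_apply, Submodule.Quotient.mk_eq_zero]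
    exact Submodule.smul_mem _ _ ⟨_, rfl⟩

/-- The linear function defined by a function of the components with the Young symmetry. -/
theorem exists_lift (f : JetVar D p q → W)
    (hf : ∀ (star : Bool) (i j : ℕ) (hi : i + q ≤ p) (hj : j ≤ q) (der : Multiset (Fin D)),
      IsYoung fun μ ν => f ⟨star, i, j, hi, hj, der, μ, ν⟩) :
    ∃ g : LinearFunction D p q →ₗ[ℝ] W, ∀ v, g (var v) = f v := by
  have h : relations D p q ≤ LinearMap.ker (Finsupp.linearCombination ℝ f) := by
    refine Submodule.span_le.2 ?_
    rintro w ⟨star, i, j, hi, hj, der, hw⟩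
    refine youngRelators_map _ ?_ hw
    simpa using hf star i j hi hj der
  exact ⟨(relations D p q).liftQ _ h, fun v => by simp [var]⟩

theorem linear_ext {f g : LinearFunction D p q →ₗ[ℝ] W} (h : ∀ v, f (var v) = g (var v)) :
    f = g := by
  refine Submodule.linearMap_qext _ (Finsupp.lhom_ext' fun v => LinearMap.ext_ring ?_)
  exact h v

theorem span_var : Submodule.span ℝ (Set.range (var (D := D) (p := p) (q := q))) = ⊤ := by
  have : ∀ v : LinearFunction D p q, v ∈ Submodule.span ℝ (Set.range (var (D := D) (p := p) (q := q))) := by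
    intro v
    obtain ⟨x, rfl⟩ := Submodule.mkQ_surjective _ v
    induction x using Finsupp.induction_linear with
    | zero => rw [map_zero]; exact Submodule.zero_mem _
    | add x y hx hy => rw [map_add]; exact Submodule.add_mem _ hx hy
    | single v r =>
      have : Finsupp.single v r = r • Finsupp.single v (1 : ℝ) := by simp
      rw [this, map_smul]
      exact Submodule.smul_mem _ _ (Submodule.subset_span ⟨v, rfl⟩)
  exact eq_top_iff.2 fun v _ => this v

variable (D p q) in
/-- The span of the monomials that occur as fields and ghosts. -/
def inRange : Submodule ℝ (Space D) :=
  Submodule.span ℝ {z | ∃ der l m, q ≤ l.length ∧ l.length ≤ p ∧ m.length ≤ q ∧ z = sym der l m}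

theorem mem_inRange {n a b : ℤ} {z : Space D} (hz : z ∈ Om D n a b) (ha : q ≤ a) (ha' : a ≤ p)
    (hb : b ≤ q) : z ∈ inRange D p q := by
  have h : Om D n a b ≤ inRange D p q := by
    refine Submodule.span_le.2 ?_
    rintro _ ⟨L, hL, rfl⟩
    obtain ⟨der, l, m, e, e'⟩ := Fock.word_eq_sym L
    rw [hL] at e'
    have h1 := congrFun e' 1
    have h2 := congrFun e' 2
    simp at h1 h2
    exact Submodule.subset_span ⟨der, l, m, by omega, by omega, by omega, e⟩
  exact h hz

/-- The converse of `proj_T`. Monomials modulo the range of `T` have the Young symmetry, so sending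
a component back to its monomial is well defined on linear functions and inverts `proj` on the
degrees that carry a field. -/
theorem exists_T_of_proj {x : Space D} (hx : x ∈ inRange D p q) (h : proj D p q x = 0) :
    ∃ u, x = Fock.T u := by
  obtain ⟨g, hg⟩ := exists_lift (D := D) (p := p) (q := q)
    (fun v => if v.star then 0 else
      (LinearMap.range (Fock.T (D := D))).mkQ (sym v.der (List.ofFn v.μ) (List.ofFn v.ν)))
    (fun star i j hi hj der => by
      cases star with
      | true => exact IsYoung.zero
      | false => exact isYoung_sym der _ _)
  have h1 : inRange D p q ≤ LinearMap.eqLocus (g ∘ₗ proj D p q)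
      (LinearMap.range (Fock.T (D := D))).mkQ := by
    refine Submodule.span_le.2 ?_
    rintro _ ⟨der, l, m, h1, h2, h3, rfl⟩
    obtain ⟨i, hi, e⟩ : ∃ i, i + q ≤ p ∧ l.length = p - i := ⟨p - l.length, by omega, by omega⟩
    obtain ⟨j, hj, e'⟩ : ∃ j, j ≤ q ∧ m.length = q - j := ⟨q - m.length, by omega, by omega⟩
    have hl : l = List.ofFn fun k : Fin (p - i) => l.get (Fin.cast e.symm k) := by
      conv_lhs => rw [← List.ofFn_get l]
      exact List.ofFn_congr e _
    have hm : m = List.ofFn fun k : Fin (q - j) => m.get (Fin.cast e'.symm k) := by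
      conv_lhs => rw [← List.ofFn_get m]
      exact List.ofFn_congr e' _
    rw [SetLike.mem_coe, LinearMap.mem_eqLocus, LinearMap.comp_apply, hl, hm,
      ← var_eq_proj i j hi hj, hg]
    rfl
  have h2 : (LinearMap.range (Fock.T (D := D))).mkQ x = 0 := by
    rw [← LinearMap.mem_eqLocus.1 (h1 hx), LinearMap.comp_apply, h, map_zero]
  rw [Submodule.mkQ_apply, Submodule.Quotient.mk_eq_zero] at h2
  obtain ⟨u, hu⟩ := h2
  exact ⟨u, hu.symm⟩

/-- The homogeneous components of an element that represents zero are in the range of `T`. -/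
theorem exists_T_of_proj_add {n a b : ℤ} {x y : Space D} (hx : x ∈ Om D n a b)
    (hxr : x ∈ inRange D p q) (hy : y ∈ Fock.others D ![n, a, b]) (hyr : y ∈ inRange D p q)
    (h : proj D p q (x + y) = 0) : ∃ w ∈ Om D n (a + 1) (b - 1), x = Fock.T w := by
  obtain ⟨u, hu⟩ := exists_T_of_proj (Submodule.add_mem _ hxr hyr) h
  exact Fock.exists_of_add_eq_T hx hy hu

end

end TwoColumn

/-! ### γ on the Fock space, and γ² = 0 -/

namespace TwoColumn

noncomputable section

open Equiv (Perm)
open Equiv.Perm (sign)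
open scoped Nat TensorProduct
open Fock (Space Om sym dL dR G mono)

variable {D p q : ℕ} {W : Type*} [AddCommGroup W] [Module ℝ W]

/-- The coefficient of `G` in the action of `γ` on fields with `a` and `b` indices. -/
def beta (p q : ℕ) (a b : ℤ) : ℝ :=
  coeffB p q (p - a).toNat (q - b).toNat * ((-1) ^ (b - 1).toNat / b)

theorem beta_eq {a b : ℤ} (ha : a ≤ p) (hb : b ≤ q) :
    beta p q a b = (-1) ^ (p - a).toNat * ((p : ℝ) - b + 2) / ((a : ℝ) - b + 2) *
      ((-1) ^ (b - 1).toNat / b) := by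
  have h1 : (((p - a).toNat : ℕ) : ℝ) = p - a := by
    have : (((p - a).toNat : ℕ) : ℤ) = p - a := Int.toNat_of_nonneg (by omega)
    exact_mod_cast congrArg (Int.cast (R := ℝ)) this
  have h2 : (((q - b).toNat : ℕ) : ℝ) = q - b := by
    have : (((q - b).toNat : ℕ) : ℤ) = q - b := Int.toNat_of_nonneg (by omega)
    exact_mod_cast congrArg (Int.cast (R := ℝ)) this
  rw [beta, coeffB, h1, h2]
  congr 3 <;> ring

theorem beta_ne_zero {a b : ℤ} (ha : a ≤ p) (hqa : q ≤ a) (hb : b ≤ q) (hb0 : 0 < b) :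
    beta p q a b ≠ 0 := by
  rw [beta_eq ha hb]
  have h1 : (b : ℝ) ≤ p := by exact_mod_cast (by omega : b ≤ p)
  have h2 : (b : ℝ) ≤ a := by exact_mod_cast (by omega : b ≤ a)
  have h3 : (0 : ℝ) < b := by exact_mod_cast hb0
  refine mul_ne_zero (div_ne_zero (mul_ne_zero (by simp) ?_) ?_) (div_ne_zero (by simp) h3.ne')
  · linarith
  · linarith

/-- The recursion in i behind the constants b_{i,j}: it makes the two parts of γ anticommute, since
`G` `dL` = `dL` `dR` while `dL` `G` = (1 + (a-b+1)⁻¹) `dL` `dR`. -/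
theorem beta_pred {a b : ℤ} (ha : a ≤ p) (hqa : q < a) (hb : b ≤ q) :
    beta p q (a - 1) b + beta p q a b * (1 + ((a : ℝ) - b + 1)⁻¹) = 0 := by
  rw [beta_eq ha hb, beta_eq (by omega) hb]
  have h2 : (b : ℝ) ≤ a - 1 := by exact_mod_cast (by omega : b ≤ a - 1)
  have h4 : (p - (a - 1)).toNat = (p - a).toNat + 1 := by omega
  have h5 : (a : ℝ) - b + 1 ≠ 0 := by linarith
  have h6 : (a : ℝ) - b + 2 ≠ 0 := by linarith
  have h7 : (a : ℝ) - 1 - b + 2 = a - b + 1 := by ring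
  rw [h4, pow_succ]
  push_cast
  rw [h7]
  have h8 : 1 + ((a : ℝ) - b + 1)⁻¹ = (a - b + 2) / (a - b + 1) := by
    field_simp
    ring
  rw [h8]
  field_simp
  ring

/-- The part of `γ` that removes an index of the first column. -/
def partL (q : ℕ) (a b : ℤ) (z : Space D) : Space D :=
  if q < a ∧ b ≤ q then (a : ℝ)⁻¹ • dL z else 0

/-- The part of `γ` that removes an index of the second column. -/
def partR (p q : ℕ) (a b : ℤ) (z : Space D) : Space D :=
  if 0 < b ∧ b ≤ q then beta p q a b • G a b z else 0

theorem partL_mem {n a b : ℤ} {z : Space D} (hz : z ∈ Om D n a b) :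
    partL q a b z ∈ Om D (n + 1) (a - 1) b := by
  unfold partL
  split_ifs
  · exact Submodule.smul_mem _ _ (Fock.dL_mem hz rfl rfl)
  · exact Submodule.zero_mem _

theorem partR_mem {n a b : ℤ} {z : Space D} (hz : z ∈ Om D n a b) :
    partR p q a b z ∈ Om D (n + 1) a (b - 1) := by
  unfold partR
  split_ifs
  · exact Submodule.smul_mem _ _ (Fock.G_mem hz rfl rfl)
  · exact Submodule.zero_mem _

theorem partL_mem_inRange {n a b : ℤ} {z : Space D} (hz : z ∈ Om D n a b) (ha : a ≤ p) :
    partL q a b z ∈ inRange D p q := by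
  have := partL_mem (q := q) hz
  unfold partL at this ⊢
  split_ifs at this ⊢ with h
  · exact mem_inRange this (by omega) (by omega) h.2
  · exact Submodule.zero_mem _

theorem partR_mem_inRange {n a b : ℤ} {z : Space D} (hz : z ∈ Om D n a b) (ha : a ≤ p)
    (hqa : q ≤ a) : partR p q a b z ∈ inRange D p q := by
  have := partR_mem (p := p) (q := q) hz
  unfold partR at this ⊢
  split_ifs at this ⊢ with h
  · exact mem_inRange this hqa ha (by omega)
  · exact Submodule.zero_mem _

theorem gamma_proj_sym {i j : ℕ} (hi : i + q ≤ p) (hj : j ≤ q) (der : Multiset (Fin D))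
    (μ : Fin (p - i) → Fin D) (ν : Fin (q - j) → Fin D) :
    gammaLinear D p q (proj D p q (sym der (List.ofFn μ) (List.ofFn ν))) =
      proj D p q (partL q (p - i : ℕ) (q - j : ℕ) (sym der (List.ofFn μ) (List.ofFn ν)) +
        partR p q (p - i : ℕ) (q - j : ℕ) (sym der (List.ofFn μ) (List.ofFn ν))) := by
  rw [← var_eq_proj i j hi hj, gammaLinear_var, gammaVar, map_add, partL, partR]
  congr 1
  · by_cases h : i + q < p
    · rw [dif_pos h, if_pos ⟨by omega, by omega⟩]
      simp only [var_eq_proj]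
      exact curlLeft_sym (proj D p q) _ der μ ν
    · rw [dif_neg h, if_neg (by omega), map_zero]
  · by_cases h : j < q
    · rw [dif_pos h, if_pos ⟨by omega, by omega⟩]
      simp only [var_eq_proj]
      have e := curlRight_sym (f := proj D p q) (proj_T (p := p) (q := q))
        (show q - j = q - (j + 1) + 1 by omega) (show q - j ≤ p - i by omega) der μ ν
      rw [e, map_smul, map_smul, smul_smul, beta]
      have h1 : ((p : ℤ) - ((p - i : ℕ) : ℤ)).toNat = i := by omega
      have h2 : ((q : ℤ) - ((q - j : ℕ) : ℤ)).toNat = j := by omega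
      have h3 : (((q - j : ℕ) : ℤ) - 1).toNat = q - (j + 1) := by omega
      rw [h1, h2, h3]
      norm_cast
    · rw [dif_neg h, if_neg (by omega), map_zero]

theorem Om_le_of_range {n a b : ℤ} (hqa : q ≤ a) (ha : a ≤ p) (hb : b ≤ q)
    {S : Submodule ℝ (Space D)}
    (h : ∀ (i j : ℕ), i + q ≤ p → j ≤ q → ∀ (der : Multiset (Fin D)) (μ : Fin (p - i) → Fin D)
      (ν : Fin (q - j) → Fin D), n = der.card → a = (p - i : ℕ) → b = (q - j : ℕ) →
      sym der (List.ofFn μ) (List.ofFn ν) ∈ S) : Om D n a b ≤ S := by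
  refine Submodule.span_le.2 ?_
  rintro _ ⟨L, hL, rfl⟩
  obtain ⟨der, l, m, e, e'⟩ := Fock.word_eq_sym L
  rw [hL] at e'
  have h0 := congrFun e' 0
  have h1 := congrFun e' 1
  have h2 := congrFun e' 2
  simp at h0 h1 h2
  have hli : l.length = p - (p - l.length) := by omega
  have hmj : m.length = q - (q - m.length) := by omega
  have hl : l = List.ofFn fun k : Fin (p - (p - l.length)) => l.get (Fin.cast hli.symm k) :=
    (List.ofFn_get l).symm.trans (List.ofFn_congr hli _)
  have hm : m = List.ofFn fun k : Fin (q - (q - m.length)) => m.get (Fin.cast hmj.symm k) :=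
    (List.ofFn_get m).symm.trans (List.ofFn_congr hmj _)
  have := h (p - l.length) (q - m.length) (by omega) (by omega) der
    (fun k => l.get (Fin.cast hli.symm k)) (fun k => m.get (Fin.cast hmj.symm k)) h0 (by omega)
    (by omega)
  rwa [← hl, ← hm, ← e] at this

/-- From here on γ is computed with operators instead of indices. For b > q both sides vanish, so
only the length of the first column needs bounds. -/
theorem gamma_proj {n a b : ℤ} {z : Space D} (hz : z ∈ Om D n a b) (ha : a ≤ p) (hqa : q ≤ a) :
    gammaLinear D p q (proj D p q z) = proj D p q (partL q a b z + partR p q a b z) := by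
  by_cases hb : b ≤ q
  · have hf : ∀ y : Space D, proj D p q (partL q a b y + partR p q a b y) = (proj D p q ∘ₗ
        ((if q < a ∧ b ≤ q then (a : ℝ)⁻¹ • dL else 0) +
          if 0 < b ∧ b ≤ q then beta p q a b • G a b else 0)) y := by
      intro y
      rw [LinearMap.comp_apply, LinearMap.add_apply, partL, partR]
      congr 2
      · split_ifs <;> rfl
      · split_ifs <;> rfl
    have h : Om D n a b ≤ LinearMap.eqLocus (gammaLinear D p q ∘ₗ proj D p q) (proj D p q ∘ₗ
        ((if q < a ∧ b ≤ q then (a : ℝ)⁻¹ • dL else 0) +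
          if 0 < b ∧ b ≤ q then beta p q a b • G a b else 0)) := by
      refine Om_le_of_range hqa ha hb fun i j hi hj der μ ν _ h1 h2 => ?_
      rw [LinearMap.mem_eqLocus, LinearMap.comp_apply, ← hf, gamma_proj_sym hi hj, h1, h2]
    rw [hf]
    exact LinearMap.mem_eqLocus.1 (h hz)
  · rw [proj_eq_zero hz (by omega), map_zero, partL, if_neg (by omega), partR, if_neg (by omega),
      add_zero, map_zero]

/-- The pure parts vanish by `dL_dL` and `G_G`, the mixed part by `beta_pred`. At a = q the first
part of γ is truncated and only `G_G` is needed. -/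
theorem gamma_gamma_proj {n a b : ℤ} {z : Space D} (hz : z ∈ Om D n a b) (ha : a ≤ p)
    (hqa : q ≤ a) (hb : b ≤ q) :
    gammaLinear D p q (gammaLinear D p q (proj D p q z)) = 0 := by
  have h1 : gammaLinear D p q (proj D p q (partR p q a b z)) =
      proj D p q (partL q a (b - 1) (partR p q a b z)) := by
    rw [gamma_proj (partR_mem hz) ha hqa]
    have h : partR p q a (b - 1) (partR p q a b z) = 0 := by
      unfold partR
      split_ifs
      · rw [map_smul, Fock.G_G (by omega), smul_zero, smul_zero]
      · rw [map_zero, smul_zero]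
      · rfl
    rw [h, add_zero]
  rw [gamma_proj hz ha hqa, map_add, map_add, h1]
  by_cases hq : q < a
  · have h2 : partL q (a - 1) b (partL q a b z) = 0 := by
      unfold partL
      split_ifs
      · rw [map_smul, Fock.dL_dL, smul_zero, smul_zero]
      · rw [map_zero, smul_zero]
      · rfl
    rw [gamma_proj (partL_mem hz) (by omega) (by omega), h2, zero_add, ← map_add]
    have h3 : partR p q (a - 1) b (partL q a b z) + partL q a (b - 1) (partR p q a b z) = 0 := by
      unfold partL partR
      by_cases h0 : 0 < b ∧ b ≤ q
      · rw [if_pos h0, if_pos ⟨hq, hb⟩, if_pos ⟨hq, by omega⟩, if_pos h0, map_smul, map_smul,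
          Fock.G_dL, Fock.dL_G]
        have := beta_pred ha hq hb
        rw [smul_smul, smul_smul, smul_smul, ← add_smul]
        convert zero_smul ℝ _
        linear_combination (a : ℝ)⁻¹ * this
      · rw [if_neg h0, if_neg h0, map_zero, smul_zero, ite_self, add_zero]
    rw [h3, map_zero]
  · have h2 : ∀ b (y : Space D), partL q a b y = 0 := fun b y => by
      rw [partL, if_neg (by tauto)]
    rw [h2, h2, map_zero, map_zero, add_zero]

theorem gammaLinear_gammaLinear (v : LinearFunction D p q) :
    gammaLinear D p q (gammaLinear D p q v) = 0 := by
  have h : gammaLinear D p q ∘ₗ gammaLinear D p q = 0 := by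
    refine linear_ext fun v => ?_
    obtain ⟨star, i, j, hi, hj, der, μ, ν⟩ := v
    cases star with
    | true =>
      rw [LinearMap.comp_apply, gammaLinear_var, gammaVar, map_zero]
      rfl
    | false =>
      rw [LinearMap.comp_apply, var_eq_proj,
        gamma_gamma_proj (Fock.sym_mem _ _ _) (by simp) (by simp; omega) (by simp)]
      rfl
  exact LinearMap.congr_fun h v

theorem exists_scale (w : Bool → ℕ → ℕ → ℕ → ℝ) :
    ∃ g : LinearFunction D p q →ₗ[ℝ] LinearFunction D p q,
      ∀ v, g (var v) = w v.star v.i v.j v.der.card • var v :=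
  exists_lift (fun v => w v.star v.i v.j v.der.card • var v) fun star i j hi hj der =>
    (isYoung_var star i j hi hj der).smul (w star i j der.card)

/-- The operator that multiplies the variables by weights. -/
def scale (w : Bool → ℕ → ℕ → ℕ → ℝ) : LinearFunction D p q →ₗ[ℝ] LinearFunction D p q :=
  (exists_scale w).choose

theorem scale_var (w : Bool → ℕ → ℕ → ℕ → ℝ) (v : JetVar D p q) :
    scale w (var v) = w v.star v.i v.j v.der.card • var v :=
  (exists_scale w).choose_spec v

theorem scale_proj (w : Bool → ℕ → ℕ → ℕ → ℝ) {n a b : ℤ} {z : Space D} (hz : z ∈ Om D n a b) :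
    scale w (proj D p q z) = w false (p - a).toNat (q - b).toNat n.toNat • proj D p q z := by
  by_cases h : q ≤ a ∧ a ≤ p ∧ b ≤ q
  · have hle : Om D n a b ≤ LinearMap.eqLocus (scale w ∘ₗ proj D p q)
        (w false (p - a).toNat (q - b).toNat n.toNat • proj D p q) := by
      refine Om_le_of_range h.1 h.2.1 h.2.2 fun i j hi hj der μ ν h0 h1 h2 => ?_
      have e1 : ((p : ℤ) - a).toNat = i := by omega
      have e2 : ((q : ℤ) - b).toNat = j := by omega
      have e3 : n.toNat = der.card := by omega
      rw [LinearMap.mem_eqLocus, LinearMap.comp_apply, e1, e2, e3,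
        LinearMap.smul_apply, ← var_eq_proj i j hi hj, scale_var]
    exact LinearMap.mem_eqLocus.1 (hle hz)
  · rw [proj_eq_zero hz h, map_zero, smul_zero]

/-- γ raises i or j by one and adds one derivative, so weights that match under these shifts commute
with it. All filterings by ghost number, derivative order and parity rest on this. -/
theorem scale_gammaLinear {w w' : Bool → ℕ → ℕ → ℕ → ℝ}
    (h1 : ∀ i j n, w' false (i + 1) j (n + 1) = w false i j n)
    (h2 : ∀ i j n, w' false i (j + 1) (n + 1) = w false i j n) (v : LinearFunction D p q) :
    scale w' (gammaLinear D p q v) = gammaLinear D p q (scale w v) := by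
  have h : scale w' ∘ₗ gammaLinear D p q = gammaLinear D p q ∘ₗ scale w := by
    refine linear_ext fun v => ?_
    obtain ⟨star, i, j, hi, hj, der, μ, ν⟩ := v
    rw [LinearMap.comp_apply, LinearMap.comp_apply, scale_var, map_smul]
    cases star with
    | true => rw [gammaLinear_var, gammaVar, map_zero, smul_zero]
    | false =>
      have hz := Fock.sym_mem der (List.ofFn μ) (List.ofFn ν)
      simp only [List.length_ofFn] at hz
      rw [var_eq_proj, gamma_proj hz (by omega) (by omega), map_add, map_add, smul_add]
      congr 1
      · rw [scale_proj _ (partL_mem hz)]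
        by_cases h : i + q < p
        · have e1 : ((p : ℤ) - (((p - i : ℕ) : ℤ) - 1)).toNat = i + 1 := by omega
          have e2 : ((q : ℤ) - (q - j : ℕ)).toNat = j := by omega
          have e3 : ((der.card : ℤ) + 1).toNat = der.card + 1 := by omega
          rw [e1, e2, e3, h1]
        · rw [partL, if_neg (by omega), map_zero, smul_zero, smul_zero]
      · rw [scale_proj _ (partR_mem hz)]
        by_cases h : j < q
        · have e1 : ((p : ℤ) - (p - i : ℕ)).toNat = i := by omega
          have e2 : ((q : ℤ) - ((q - j : ℕ) - 1)).toNat = j + 1 := by omega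
          have e3 : ((der.card : ℤ) + 1).toNat = der.card + 1 := by omega
          rw [e1, e2, e3, h2]
        · rw [partR, if_neg (by omega), map_zero, smul_zero, smul_zero]
  exact LinearMap.congr_fun h v

end

end TwoColumn

/-! ### The invariant variables and elimination along a line -/

namespace TwoColumn

noncomputable section

open Equiv (Perm)
open Equiv.Perm (sign)
open scoped Nat TensorProduct
open Fock (Space Om sym dL dR G mono)

variable {D p q : ℕ} {W : Type*} [AddCommGroup W] [Module ℝ W]

variable (D p q) in
/-- The span of the four kinds of variables. -/
def invariants : Submodule ℝ (LinearFunction D p q) :=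
  Submodule.span ℝ (invariantVariables D p q)

theorem var_star_mem (v : JetVar D p q) (h : v.star = true) : var v ∈ invariants D p q :=
  Submodule.subset_span (Or.inl (Or.inl (Or.inl ⟨v, h, rfl⟩)))

theorem ghostCurl_eq (h : q ≤ p) (μ : Fin (p + 1) → Fin D) : ghostCurl h μ =
    ((-1 : ℝ) ^ q * ((p + 1)! : ℝ)⁻¹ * p !) • proj D p q (dL (sym 0 (List.ofFn μ) [])) := by
  have h1 := congrArg (proj D p q) (Fock.dL_sym 0 μ [])
  rw [map_sum, map_smul] at h1
  rw [mul_smul, ← h1, ghostCurl, mul_smul]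
  congr 2
  refine Finset.sum_congr rfl fun σ _ => ?_
  rw [map_sign_smul, var_eq_proj]
  congr 3
  exact List.eq_nil_of_length_eq_zero (by simp)

theorem curvature_eq (h : q ≤ p) (der : Multiset (Fin D)) (μ : Fin (p + 1) → Fin D)
    (ν : Fin (q + 1) → Fin D) : curvature h der μ ν =
    (((p + 1)! : ℝ)⁻¹ * ((q + 1)! : ℝ)⁻¹ * (p ! * ((-1) ^ q * q !))) •
      proj D p q (dL (dR (sym der (List.ofFn μ) (List.ofFn ν)))) := by
  have h1 : ∀ τ : Perm (Fin (q + 1)), ∑ σ : Perm (Fin (p + 1)), sign σ •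
      proj D p q (sym (μ (σ 0) ::ₘ ν (τ (Fin.last q)) ::ₘ der) (List.ofFn fun k => μ (σ k.succ))
        (List.ofFn fun k => ν (τ k.castSucc))) = (p ! : ℝ) • proj D p q (dL
          (sym (ν (τ (Fin.last q)) ::ₘ der) (List.ofFn μ) (List.ofFn fun k => ν (τ k.castSucc)))) := by
    intro τ
    have := congrArg (proj D p q) (Fock.dL_sym (ν (τ (Fin.last q)) ::ₘ der) μ
      (List.ofFn fun k => ν (τ k.castSucc)))
    rw [map_sum, map_smul] at this
    rw [← this]
    simp only [map_sign_smul]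
  have h2 := congrArg (fun z => proj D p q (dL z)) (Fock.dR_sym der (List.ofFn μ) ν)
  simp only [map_sum, map_smul, map_sign_smul] at h2
  rw [curvature, mul_smul, mul_smul, mul_smul (p ! : ℝ), ← h2, Finset.sum_comm]
  refine congrArg _ (congrArg _ ?_)
  rw [Finset.smul_sum]
  refine Finset.sum_congr rfl fun τ _ => ?_
  rw [smul_comm (p ! : ℝ) (sign τ) (_ : LinearFunction D p q), ← h1, Finset.smul_sum]
  refine Finset.sum_congr rfl fun σ _ => ?_
  rw [smul_comm (sign τ), var_eq_proj]
  rfl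

theorem proj_dL_mem {z : Space D} (hqp : q ≤ p) (hz : z ∈ Om D 0 (p + 1) 0) :
    proj D p q (dL z) ∈ invariants D p q := by
  have h : Om D (0 : ℕ) (p + 1 : ℕ) (0 : ℕ) ≤ (invariants D p q).comap (proj D p q ∘ₗ dL) := by
    refine Fock.Om_le fun der μ ν hder => ?_
    have hν : List.ofFn ν = [] := List.ofFn_zero
    rw [Multiset.card_eq_zero] at hder
    subst hder
    rw [Submodule.mem_comap, LinearMap.comp_apply, hν]
    have h1 := ghostCurl_eq (q := q) hqp μ
    set c := ((-1 : ℝ) ^ q * ((p + 1)! : ℝ)⁻¹ * p !)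
    have hc : c ≠ 0 := mul_ne_zero (mul_ne_zero (by simp) (by positivity)) (by positivity)
    rw [← inv_smul_eq_iff₀ hc] at h1
    rw [← h1]
    exact Submodule.smul_mem _ _ (Submodule.subset_span (Or.inr ⟨hqp, μ, rfl⟩))
  exact h (Fock.Om_congr hz (by simp) (by push_cast; ring) (by simp))

theorem proj_dL_dR_mem {z : Space D} (hqp : q ≤ p) {n : ℤ} (hz : z ∈ Om D n (p + 1) (q + 1)) :
    proj D p q (dL (dR z)) ∈ invariants D p q := by
  rcases lt_or_ge n 0 with hn | hn
  · rw [Fock.eq_zero_of_neg hz (u := 0) hn, map_zero, map_zero, map_zero]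
    exact Submodule.zero_mem _
  lift n to ℕ using hn
  have h : Om D (n : ℕ) (p + 1 : ℕ) (q + 1 : ℕ) ≤
      (invariants D p q).comap (proj D p q ∘ₗ dL ∘ₗ dR) := by
    refine Fock.Om_le fun der μ ν _ => ?_
    rw [Submodule.mem_comap, LinearMap.comp_apply, LinearMap.comp_apply]
    have h1 := curvature_eq hqp der μ ν
    set c := (((p + 1)! : ℝ)⁻¹ * ((q + 1)! : ℝ)⁻¹ * (p ! * ((-1) ^ q * q !)))
    have hc : c ≠ 0 := mul_ne_zero (by positivity)
      (mul_ne_zero (by positivity) (mul_ne_zero (by simp) (by positivity)))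
    rw [← inv_smul_eq_iff₀ hc] at h1
    rw [← h1]
    exact Submodule.smul_mem _ _ (Submodule.subset_span (Or.inl (Or.inl (Or.inr ⟨hqp, der, μ, ν, rfl⟩))))
  exact h (Fock.Om_congr hz rfl (by push_cast; ring) (by push_cast; ring))

theorem proj_mem_of_top {z : Space D} (hqp : q ≤ p) (hz : z ∈ Om D 0 q 0) :
    proj D p q z ∈ invariants D p q := by
  have h : Om D 0 q 0 ≤ (invariants D p q).comap (proj D p q) := by
    refine Om_le_of_range (p := p) le_rfl (by omega) (by omega) fun i j hi hj der μ ν h0 h1 h2 => ?_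
    rw [Submodule.mem_comap, ← var_eq_proj i j hi hj]
    refine Submodule.subset_span (Or.inl (Or.inr ⟨_, rfl, ?_, ?_, ?_, rfl⟩))
    · simp only; omega
    · simp only; omega
    · simp only
      rw [← Multiset.card_eq_zero]
      omega
  exact h hz

/-- Antifields are closed by definition. The curvature is `dL` `dR` y, which `dL` and `G` both kill;
D⁰ is `dL` y with an empty second column; for A^(p-q,q) both parts of γ are truncated. -/
theorem gammaLinear_eq_zero {v : LinearFunction D p q} (hv : v ∈ invariants D p q) :
    gammaLinear D p q v = 0 := by
  have h : invariants D p q ≤ LinearMap.ker (gammaLinear D p q) := by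
    refine Submodule.span_le.2 ?_
    rintro _ (((⟨v, hv, rfl⟩ | ⟨h, der, μ, ν, rfl⟩) | ⟨v, hv, hi, hj, hder, rfl⟩) | ⟨h, μ, rfl⟩)
    · rw [SetLike.mem_coe, LinearMap.mem_ker, gammaLinear_var]
      obtain ⟨star, i, j, hi, hj, der, μ, ν⟩ := v
      subst hv
      rfl
    · have hz := Fock.dR_mem (Fock.sym_mem der (List.ofFn μ) (List.ofFn ν)) rfl rfl
      rw [SetLike.mem_coe, LinearMap.mem_ker, curvature_eq, map_smul,
        gamma_proj (Fock.dL_mem hz rfl rfl) (by simp) (by simp; omega), partL, partR]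
      have e : ((List.ofFn ν).length : ℤ) - 1 = q := by simp
      rw [Fock.G_dL, Fock.dR_dR, Fock.dL_dL, map_zero, smul_zero, smul_zero, ite_self, ite_self,
        add_zero, map_zero, smul_zero]
    · rw [SetLike.mem_coe, LinearMap.mem_ker, gammaLinear_var]
      obtain ⟨star, i, j, hi', hj', der, μ, ν⟩ := v
      simp only at hv hi hj
      subst hv hi hj
      rw [gammaVar, dif_neg (by omega), dif_neg (by omega), add_zero]
    · have hz := Fock.dL_mem (Fock.sym_mem 0 (List.ofFn μ) []) rfl rfl
      rw [SetLike.mem_coe, LinearMap.mem_ker, ghostCurl_eq, map_smul,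
        gamma_proj hz (by simp) (by simp; omega), partL, partR, if_neg (c := 0 < _ ∧ _) (by simp),
        Fock.dL_dL, smul_zero, ite_self, add_zero, map_zero, smul_zero]
  exact h hv

/-- Elements of total degree `s` (in the number of ghosts) with `n` derivatives. -/
def IsLine (D p q n s m : ℕ) (z : ℕ → Space D) : Prop :=
  ∀ i < m, z i ∈ Om D n ((p : ℤ) - i) ((q : ℤ) - s + i)

theorem partL_mem_others {n a b n' a' b' : ℤ} {z : Space D} (hz : z ∈ Om D n a b)
    (h : a' ≠ a - 1 ∨ b' ≠ b) : partL q a b z ∈ Fock.others D ![n', a', b'] := by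
  refine Fock.mem_others (fun e => ?_) (partL_mem hz)
  have h1 := congrFun e 1
  have h2 := congrFun e 2
  simp at h1 h2
  omega

theorem partR_mem_others {n a b n' a' b' : ℤ} {z : Space D} (hz : z ∈ Om D n a b)
    (h : a' ≠ a ∨ b' ≠ b - 1) : partR p q a b z ∈ Fock.others D ![n', a', b'] := by
  refine Fock.mem_others (fun e => ?_) (partR_mem hz)
  have h1 := congrFun e 1
  have h2 := congrFun e 2
  simp at h1 h2
  omega

/-- The action of `γ` on a line. -/
def lineImage (p q s m : ℕ) (z : ℕ → Space D) : Space D :=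
  ∑ i ∈ Finset.range m, (partL q ((p : ℤ) - i) ((q : ℤ) - s + i) (z i) +
    partR p q ((p : ℤ) - i) ((q : ℤ) - s + i) (z i))

theorem gamma_line {n s m : ℕ} {z : ℕ → Space D} (hz : IsLine D p q n s m z) (hm : m + q ≤ p + 1) :
    gammaLinear D p q (∑ i ∈ Finset.range m, proj D p q (z i)) =
      proj D p q (lineImage p q s m z) := by
  rw [lineImage, map_sum, map_sum]
  refine Finset.sum_congr rfl fun i hi => ?_
  have := Finset.mem_range.1 hi
  exact gamma_proj (hz i this) (by omega) (by omega)

theorem lineImage_mem_inRange {n s m : ℕ} {z : ℕ → Space D} (hz : IsLine D p q n s m z)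
    (hm : m + q ≤ p + 1) : lineImage p q s m z ∈ inRange D p q := by
  refine Submodule.sum_mem _ fun i hi => ?_
  have := Finset.mem_range.1 hi
  exact Submodule.add_mem _ (partL_mem_inRange (hz i this) (by omega))
    (partR_mem_inRange (hz i this) (by omega) (by omega))

theorem lineImage_mem_others {n s m : ℕ} {z : ℕ → Space D} (hz : IsLine D p q n s m z)
    {n' a' b' : ℤ} (h : a' < (p : ℤ) - m) : lineImage p q s m z ∈ Fock.others D ![n', a', b'] := by
  refine Submodule.sum_mem _ fun i hi => ?_
  have := Finset.mem_range.1 hi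
  exact Submodule.add_mem _ (partL_mem_others (hz i this) (by omega))
    (partR_mem_others (hz i this) (by omega))

/-- The subtraction of a `γ`-exact term that removes the last element of a line. -/
theorem line_finish {n s m : ℕ} (hm : m + 1 + q ≤ p) {z : ℕ → Space D}
    (hz : IsLine D p q n s (m + 1) z) {zm y₂ y : Space D} {c : ℝ}
    (hy₂ : y₂ ∈ Om D ((n : ℤ) - 1) ((p : ℤ) - m) ((q : ℤ) - s + (m + 1)))
    (hy : y ∈ Om D ((n : ℤ) - 1) ((p : ℤ) - (m + 1)) ((q : ℤ) - s + (m + 1) + 1))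
    (hc : c = 0 ∨ ((q : ℤ) - s + (m + 1) < q ∧ 0 ≤ (q : ℤ) - s + (m + 1) ∧ (p : ℤ) - (m + 1) = q))
    (hb : y₂ = 0 ∨ (q : ℤ) - s + (m + 1) ≤ q)
    (h : proj D p q zm = proj D p q (dL y₂) +
      c • proj D p q (G ((p : ℤ) - (m + 1)) ((q : ℤ) - s + (m + 1) + 1) y)) :
    ∃ z', IsLine D p q n s (m + 1) z' ∧ ∃ w, (n = 0 → w = 0) ∧
      ∑ i ∈ Finset.range (m + 1), proj D p q (z i) + proj D p q zm =
        gammaLinear D p q w + ∑ i ∈ Finset.range (m + 1), proj D p q (z' i) := by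
  have h1 : ∃ w, (n = 0 → w = 0) ∧ gammaLinear D p q w =
      c • proj D p q (G ((p : ℤ) - (m + 1)) ((q : ℤ) - s + (m + 1) + 1) y) := by
    rcases hc with rfl | ⟨hc1, hc2, hc3⟩
    · exact ⟨0, fun _ => rfl, by rw [map_zero, zero_smul]⟩
    -- Here y has first column of length q, where γ consists of its `G` part alone, so dividing by β
    -- makes `G` y exact.
    · refine ⟨(c * (beta p q ((p : ℤ) - (m + 1)) ((q : ℤ) - s + (m + 1) + 1))⁻¹) • proj D p q y,
        fun hn => ?_, ?_⟩
      · rw [Fock.eq_zero_of_neg hy (u := 0) (by simp [hn]), map_zero, smul_zero]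
      · rw [map_smul, gamma_proj hy (by omega) (by omega), partL, if_neg (by omega), partR,
          if_pos (by omega), zero_add, map_smul, smul_smul, mul_assoc, inv_mul_cancel₀, mul_one]
        exact beta_ne_zero (by omega) (by omega) (by omega) (by omega)
  obtain ⟨w₁, hw₁, e₁⟩ := h1
  have ha : (((p : ℤ) - m : ℤ) : ℝ) ≠ 0 := by
    have : (p : ℤ) - m ≠ 0 := by omega
    exact_mod_cast this
  set a : ℝ := (((p : ℤ) - m : ℤ) : ℝ) with had
  -- γ(a y₂) is `dL` y₂ plus this term, which has the degree of z m and is subtracted from it.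
  set r := a • partR p q ((p : ℤ) - m) ((q : ℤ) - s + (m + 1)) y₂ with hr
  have hrm : r ∈ Om D n ((p : ℤ) - m) ((q : ℤ) - s + m) :=
    Submodule.smul_mem _ _ (Fock.Om_congr (partR_mem hy₂) (by ring) rfl (by ring))
  have e₂ : gammaLinear D p q (a • proj D p q y₂) = proj D p q (dL y₂) + proj D p q r := by
    rw [map_smul, gamma_proj hy₂ (by omega) (by omega), map_add, smul_add, ← map_smul, ← map_smul]
    congr 2
    rw [partL]
    rcases hb with rfl | hb
    · rw [map_zero, smul_zero, ite_self, smul_zero]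
    · rw [if_pos (by omega), smul_smul, mul_inv_cancel₀ ha, one_smul]
  refine ⟨Function.update z m (z m - r), fun i hi => ?_, w₁ + a • proj D p q y₂, fun hn => ?_, ?_⟩
  · rcases eq_or_ne i m with rfl | him
    · rw [Function.update_self]
      exact Submodule.sub_mem _ (hz i hi) hrm
    · rw [Function.update_of_ne him]
      exact hz i hi
  · rw [hw₁ hn, Fock.eq_zero_of_neg hy₂ (u := 0) (by simp [hn]), map_zero, smul_zero, add_zero]
  · have hs : ∑ i ∈ Finset.range m, proj D p q (Function.update z m (z m - r) i) =
        ∑ i ∈ Finset.range m, proj D p q (z i) := Finset.sum_congr rfl fun i hi => by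
      rw [Function.update_of_ne (Finset.mem_range.1 hi).ne]
    rw [map_add, e₁, e₂, h, Finset.sum_range_succ, Finset.sum_range_succ, Function.update_self,
      map_sub, hs]
    abel

/-- `G` is a nonzero multiple of `dR` up to a multiple of `dL` `T'` z, and the latter fits into the
`dL` v of `Fock.column`. -/
theorem exists_column {n a b : ℤ} {z : Space D} (hz : z ∈ Om D n a b) (hba : b ≤ a)
    (hnb : 0 < n + b) {u v : Space D} (hu : u ∈ Om D (n + 1) (a + 1) (b - 2))
    (hv : v ∈ Om D n (a + 1) (b - 1)) (h : G a b z = Fock.T u + dL v) :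
    ∃ y ∈ Om D (n - 1) a (b + 1), ∃ w ∈ Om D n (a + 1) (b - 1), z = dR y + Fock.T w := by
  have hm : (0 : ℝ) < (a : ℝ) - b + 1 := by
    have : (b : ℝ) ≤ a := by exact_mod_cast hba
    linarith
  set c := 1 + ((a : ℝ) - b + 1)⁻¹ with hc
  have hc0 : c ≠ 0 := by positivity
  refine Fock.column hz hnb (by omega) (u := c⁻¹ • u)
    (v := c⁻¹ • (v + ((a : ℝ) - b + 1)⁻¹ • Fock.T' z)) (Submodule.smul_mem _ _ hu)
    (Submodule.smul_mem _ _ (Submodule.add_mem _ hv (Submodule.smul_mem _ _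
      (Fock.T'_mem hz rfl rfl)))) ?_
  rw [Fock.G_eq, ← hc, sub_eq_iff_eq_add] at h
  rw [map_smul, map_smul, ← smul_add, eq_inv_smul_iff₀ hc0, h, map_add, map_smul]
  abel

/-- The elimination of the last element of a line. -/
theorem line_top {n s m : ℕ} (hm : m + 1 + q ≤ p) {z : ℕ → Space D}
    (hz : IsLine D p q n s (m + 2) z) {a b : ℤ} (ha : a = (p : ℤ) - (m + 1))
    (hb : b = (q : ℤ) - s + (m + 1)) {g : Space D} (hg : g ∈ Om D (n + 1) p ((q : ℤ) - s - 1))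
    (h : gammaLinear D p q (∑ i ∈ Finset.range (m + 2), proj D p q (z i)) = proj D p q g)
    (hn : ¬ (n = 0 ∧ b = 0 ∧ a = q)) :
    ∃ y₂ ∈ Om D ((n : ℤ) - 1) (a + 1) b, ∃ y ∈ Om D ((n : ℤ) - 1) a (b + 1), ∃ c : ℝ,
      (c = 0 ∨ (b < q ∧ 0 ≤ b ∧ a = q)) ∧ (y₂ = 0 ∨ b ≤ q) ∧
      proj D p q (z (m + 1)) = proj D p q (dL y₂) + c • proj D p q (G a (b + 1) y) := by
  have hzm : z (m + 1) ∈ Om D n a b := by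
    have := hz (m + 1) (by omega)
    push_cast at this
    rwa [← ha, ← hb] at this
  by_cases hbr : b < 0 ∨ q < b
  · refine ⟨0, Submodule.zero_mem _, 0, Submodule.zero_mem _, 0, Or.inl rfl, Or.inl rfl, ?_⟩
    rw [map_zero, map_zero, zero_smul, add_zero]
    rcases hbr with h0 | h0
    · rw [Fock.eq_zero_of_neg hzm (u := 2) h0, map_zero]
    · exact proj_eq_zero hzm (by omega)
  push Not at hbr
  have hz' : IsLine D p q n s (m + 1) z := fun i hi => hz i (by omega)
  have h0 : proj D p q (lineImage p q s (m + 1) z - g +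
      (partL q a b (z (m + 1)) + partR p q a b (z (m + 1)))) = 0 := by
    rw [gamma_line hz (by omega), ← sub_eq_zero, ← map_sub, lineImage, Finset.sum_range_succ,
      ← lineImage] at h
    push_cast at h
    rw [← ha, ← hb] at h
    rw [← h]
    congr 1
    abel
  have hgr : g ∈ inRange D p q := mem_inRange hg (by omega) le_rfl (by omega)
  by_cases haq : q < a
  · -- the curl on the first column vanishes up to the range of `T`
    have hLr : partL q a b (z (m + 1)) ∈ inRange D p q := partL_mem_inRange hzm (by omega)
    obtain ⟨w, hw, e⟩ := exists_T_of_proj_add (p := p) (q := q) (partL_mem hzm) hLr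
      (y := lineImage p q s (m + 1) z - g + partR p q a b (z (m + 1)))
      (Submodule.add_mem _ (Submodule.sub_mem _ (lineImage_mem_others hz' (by push_cast; omega))
        (Fock.mem_others (fun e => by have := congrFun e 1; simp at this; omega) hg))
        (partR_mem_others hzm (by omega)))
      (Submodule.add_mem _ (Submodule.sub_mem _ (lineImage_mem_inRange hz' (by omega)) hgr)
        (partR_mem_inRange hzm (by omega) (by omega)))
      (by rw [← h0]; congr 1; abel)
    rw [partL, if_pos ⟨haq, hbr.2⟩] at e
    have ha0 : (a : ℝ) ≠ 0 := by
      have : a ≠ 0 := by omega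
      exact_mod_cast this
    have e' : dL (z (m + 1)) = Fock.T ((a : ℝ) • w) := by
      rw [map_smul, ← e, smul_smul, mul_inv_cancel₀ ha0, one_smul]
    obtain ⟨y₂, hy₂, w', -, e₂⟩ := Fock.row hzm (by omega) (by omega)
      (Submodule.smul_mem _ _ (Fock.Om_congr hw rfl (by ring) rfl)) e'
    refine ⟨y₂, hy₂, 0, Submodule.zero_mem _, 0, Or.inl rfl, Or.inr hbr.2, ?_⟩
    rw [e₂, map_add, proj_T, zero_smul]
  -- At a = q no equation for `dL` of the last tensor is available. The component of degree (q, b-1)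
  -- relates `G` of the last tensor to `dL` of its neighbour, which is the hypothesis of
  -- `exists_column`.
  · have haq' : a = q := by omega
    have hpos : (0 : ℤ) < n + b := by omega
    have hcol : ∃ y ∈ Om D ((n : ℤ) - 1) a (b + 1), ∃ w ∈ Om D (n : ℤ) (a + 1) (b - 1),
        z (m + 1) = dR y + Fock.T w := by
      -- With an empty second column `G` vanishes, so there is no condition to extract from
      -- closedness.
      by_cases hb0 : b = 0
      · refine exists_column hzm (by omega) hpos
          (Submodule.zero_mem _) (Submodule.zero_mem _) ?_
        rw [Fock.eq_zero_of_neg (Fock.G_mem hzm rfl rfl) (u := 2) (by simp [hb0]), map_zero,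
          map_zero, add_zero]
      · have hz'' : IsLine D p q n s m z := fun i hi => hz i (by omega)
        have hzm' : z m ∈ Om D n (a + 1) (b - 1) :=
          Fock.Om_congr (hz m (by omega)) rfl (by omega) (by omega)
        have hRm := partR_mem (p := p) (q := q) hzm
        obtain ⟨w, hw, e⟩ := exists_T_of_proj_add (p := p) (q := q)
          (x := partL q (a + 1) (b - 1) (z m) + partR p q a b (z (m + 1)))
          (y := lineImage p q s m z - g + partR p q (a + 1) (b - 1) (z m))
          (Submodule.add_mem _ (Fock.Om_congr (partL_mem hzm') rfl (by ring) rfl) hRm)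
          (Submodule.add_mem _ (partL_mem_inRange hzm' (by omega))
            (partR_mem_inRange hzm (by omega) (by omega)))
          (Submodule.add_mem _ (Submodule.sub_mem _ (lineImage_mem_others hz'' (by omega))
            (Fock.mem_others (fun e => by have := congrFun e 1; simp at this; omega) hg))
            (partR_mem_others hzm' (by omega)))
          (Submodule.add_mem _ (Submodule.sub_mem _ (lineImage_mem_inRange hz'' (by omega)) hgr)
            (partR_mem_inRange hzm' (by omega) (by omega)))
          (by
            have e1 : (p : ℤ) - (m : ℤ) = a + 1 := by omega
            have e2 : (q : ℤ) - s + (m : ℤ) = b - 1 := by omega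
            have e3 : partL q a b (z (m + 1)) = 0 := by rw [partL, if_neg (by omega)]
            rw [lineImage, Finset.sum_range_succ, ← lineImage, e1, e2, e3, zero_add] at h0
            rw [← h0]
            congr 1
            abel)
        rw [partL, if_pos (by omega), partR, if_pos (by omega)] at e
        have hβ : beta p q a b ≠ 0 := beta_ne_zero (by omega) (by omega) (by omega) (by omega)
        refine exists_column hzm (by omega) hpos
          (u := (beta p q a b)⁻¹ • w)
          (v := -((beta p q a b)⁻¹ • ((a + 1 : ℤ) : ℝ)⁻¹ • z m))
          (Submodule.smul_mem _ _ (Fock.Om_congr hw rfl rfl (by ring)))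
          (Submodule.neg_mem _ (Submodule.smul_mem _ _ (Submodule.smul_mem _ _ hzm'))) ?_
        rw [map_smul, ← e, map_neg, map_smul, map_smul, smul_add, smul_smul _ (beta p q a b),
          inv_mul_cancel₀ hβ, one_smul]
        abel
    obtain ⟨y, hy, w, hw, e⟩ := hcol
    by_cases hbq : b < q
    · have hm0 : ((a : ℝ) - (b + 1 : ℤ) + 1) ≠ 0 := by
        have : a - (b + 1) + 1 ≠ 0 := by omega
        exact_mod_cast this
      have hm1 : 1 + ((a : ℝ) - (b + 1 : ℤ) + 1)⁻¹ ≠ 0 := by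
        have : (0 : ℝ) ≤ (a : ℝ) - (b + 1 : ℤ) + 1 := by
          have : 0 ≤ a - (b + 1) + 1 := by omega
          exact_mod_cast this
        positivity
      have hG := Fock.G_eq a (b + 1) y
      set c := 1 + ((a : ℝ) - (b + 1 : ℤ) + 1)⁻¹ with hc
      -- `G_eq` solved for `dR` y: it is c⁻¹ `G` y plus a multiple of `dL` `T'` y.
      refine ⟨(c⁻¹ * ((a : ℝ) - (b + 1 : ℤ) + 1)⁻¹) • Fock.T' y,
        Submodule.smul_mem _ _ (Fock.T'_mem hy rfl (by ring)), y, hy, c⁻¹,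
        Or.inr ⟨hbq, hbr.1, haq'⟩, Or.inr hbr.2, ?_⟩
      rw [e, map_add, proj_T, add_zero, hG, map_smul, map_smul, map_sub, map_smul, map_smul,
        smul_sub, smul_smul, smul_smul, inv_mul_cancel₀ hm1, one_smul]
      abel
    -- For b = q there is no field of the degree of y. Its second column is longer than its first,
    -- so y = `T` y', and `dR` `T` y' is `dL` y' modulo the range of `T`.
    · obtain ⟨y', hy', e'⟩ := Fock.exists_T hy (by omega)
      refine ⟨y', Fock.Om_congr hy' rfl rfl (by ring), 0, Submodule.zero_mem _, 0, Or.inl rfl,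
        Or.inr hbr.2, ?_⟩
      rw [e, e', Fock.dR_T, map_add, map_sub, proj_T, proj_T, zero_smul, sub_zero]

/-- The exceptional degree n = 0, b = 0, a = q is that of A^(p-q,q). It lies on the line s = q + m +
1, which explains the clause for s ≤ q. -/
theorem line_reduce_succ {n s m : ℕ} (hm : m + 1 + q ≤ p) {z : ℕ → Space D}
    (hz : IsLine D p q n s (m + 2) z) {g : Space D} (hg : g ∈ Om D (n + 1) p ((q : ℤ) - s - 1))
    (h : gammaLinear D p q (∑ i ∈ Finset.range (m + 2), proj D p q (z i)) = proj D p q g) :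
    ∃ z', IsLine D p q n s (m + 1) z' ∧ ∃ x ∈ invariants D p q, (s ≤ q → x = 0) ∧
      ∃ w, (n = 0 → w = 0) ∧ ∑ i ∈ Finset.range (m + 2), proj D p q (z i) =
        x + gammaLinear D p q w + ∑ i ∈ Finset.range (m + 1), proj D p q (z' i) := by
  have hz' : IsLine D p q n s (m + 1) z := fun i hi => hz i (by omega)
  by_cases hn : n = 0 ∧ (q : ℤ) - s + (m + 1) = 0 ∧ (p : ℤ) - (m + 1) = q
  · refine ⟨z, hz', proj D p q (z (m + 1)), ?_, fun hs => by omega, 0, fun _ => rfl, ?_⟩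
    · refine proj_mem_of_top (by omega) (Fock.Om_congr (hz (m + 1) (by omega)) (by simp [hn.1]) ?_ ?_)
      · push_cast; exact hn.2.2
      · push_cast; exact hn.2.1
    · rw [Finset.sum_range_succ _ (m + 1), map_zero, add_zero, add_comm]
  · obtain ⟨y₂, hy₂, y, hy, c, hc, hb, e⟩ := line_top hm hz rfl rfl hg h hn
    obtain ⟨z', hz'', w, hw, e'⟩ := line_finish hm hz' (Fock.Om_congr hy₂ rfl (by ring) rfl) hy hc hb e
    exact ⟨z', hz'', 0, Submodule.zero_mem _, fun _ => rfl, w, hw, by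
      rw [Finset.sum_range_succ _ (m + 1), e', zero_add]⟩

/-- The right-hand side `g` has first column p, a degree that the eliminations never inspect. This
generality is what the proof that D⁰ is not exact needs; there n = 0, and `w` vanishes because it
has one derivative less than the line. -/
theorem line_reduce {n s : ℕ} (m : ℕ) (hm : m + q ≤ p) {z : ℕ → Space D}
    (hz : IsLine D p q n s (m + 1) z) {g : Space D} (hg : g ∈ Om D (n + 1) p ((q : ℤ) - s - 1))
    (h : gammaLinear D p q (∑ i ∈ Finset.range (m + 1), proj D p q (z i)) = proj D p q g) :
    ∃ z₀ ∈ Om D n p ((q : ℤ) - s), ∃ x ∈ invariants D p q, (s ≤ q → x = 0) ∧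
      ∃ w, (n = 0 → w = 0) ∧ ∑ i ∈ Finset.range (m + 1), proj D p q (z i) =
        x + gammaLinear D p q w + proj D p q z₀ := by
  induction m generalizing z with
  | zero =>
    refine ⟨z 0, Fock.Om_congr (hz 0 (by omega)) rfl (by simp) (by simp), 0, Submodule.zero_mem _,
      fun _ => rfl, 0, fun _ => rfl, ?_⟩
    simp
  | succ m ih =>
    obtain ⟨z', hz', x, hx, hx0, w, hw, e⟩ := line_reduce_succ hm hz hg h
    obtain ⟨z₀, hz₀, x', hx', hx0', w', hw', e'⟩ := ih (by omega) hz' (by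
      rw [← h, e, map_add, map_add, gammaLinear_eq_zero hx, gammaLinear_gammaLinear, zero_add,
        zero_add])
    refine ⟨z₀, hz₀, x + x', Submodule.add_mem _ hx hx', fun hs => by rw [hx0 hs, hx0' hs, add_zero],
      w + w', fun hn => by rw [hw hn, hw' hn, add_zero], ?_⟩
    rw [e, e', map_add]
    abel

/-- A closed field of the lowest generation in the first direction is invariant up to exact
terms. -/
theorem closed_bottom (hpq : q < p) {n s : ℕ} {z : Space D} (hz : z ∈ Om D n p ((q : ℤ) - s))
    (h : gammaLinear D p q (proj D p q z) = 0) :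
    proj D p q z ∈ invariants D p q ⊔ LinearMap.range (gammaLinear D p q) := by
  obtain ⟨b, hb⟩ : ∃ b : ℤ, b = (q : ℤ) - s := ⟨_, rfl⟩
  rw [← hb] at hz
  rcases lt_or_ge b 0 with hb0 | hb0
  · rw [Fock.eq_zero_of_neg hz (u := 2) hb0, map_zero]
    exact Submodule.zero_mem _
  rw [gamma_proj hz le_rfl (by omega)] at h
  have hp0 : ((p : ℤ) : ℝ) ≠ 0 := by
    have : (p : ℤ) ≠ 0 := by omega
    exact_mod_cast this
  obtain ⟨u, hu, e⟩ := exists_T_of_proj_add (p := p) (q := q) (partL_mem hz)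
    (partL_mem_inRange hz le_rfl) (partR_mem_others hz (by omega))
    (partR_mem_inRange hz le_rfl (by omega)) h
  rw [partL, if_pos (by omega), inv_smul_eq_iff₀ hp0, ← map_smul] at e
  obtain ⟨y, hy, w, hw, e₁⟩ := Fock.row hz (by omega) (by omega)
    (Submodule.smul_mem _ _ (Fock.Om_congr hu rfl (by ring) rfl)) e
  have hzy : proj D p q z = proj D p q (dL y) := by rw [e₁, map_add, proj_T, add_zero]
  rcases Nat.eq_zero_or_pos n with hn0 | hn0
  · rw [hzy, Fock.eq_zero_of_neg hy (u := 0) (by simp [hn0]), map_zero, map_zero]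
    exact Submodule.zero_mem _
  -- This is the only degree with n > 0 where `Fock.column` does not apply to y, which then has
  -- neither derivatives nor second indices.
  by_cases hD0 : n = 1 ∧ b = 0
  · rw [hzy]
    refine Submodule.mem_sup_left (proj_dL_mem hpq.le (Fock.Om_congr hy ?_ rfl hD0.2))
    omega
  have hcol : ∃ y' ∈ Om D ((n : ℤ) - 1 - 1) (p + 1) (b + 1),
      ∃ w' ∈ Om D ((n : ℤ) - 1) (p + 1 + 1) (b - 1), y = dR y' + Fock.T w' := by
    rcases eq_or_lt_of_le hb0 with hb0 | hb0
    · refine Fock.column hy (by omega) (by omega)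
        (Submodule.zero_mem _) (Submodule.zero_mem _) ?_
      rw [Fock.eq_zero_of_neg (Fock.dR_mem hy rfl rfl) (u := 2) (by simp [← hb0]), map_zero,
        map_zero, add_zero]
    · obtain ⟨u', hu', e'⟩ := exists_T_of_proj_add (p := p) (q := q) (partR_mem (p := p) (q := q) hz)
        (partR_mem_inRange hz le_rfl (by omega)) (partL_mem_others (q := q) hz (by omega))
        (partL_mem_inRange hz le_rfl) (by rw [← h, add_comm])
      have hβ : beta p q p b ≠ 0 := beta_ne_zero le_rfl (by omega) (by omega) (by omega)
      -- The other component of γz = 0, with z = `dL` y + `T` w inserted, puts `dL` `dR` y in the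
      -- range of `T`; `row` then gives the hypothesis of `column` for y.
      rw [partR, if_pos (by omega), e₁, map_add, Fock.G_dL, Fock.G_T (by omega) hw,
        ← eq_inv_smul_iff₀ hβ, ← eq_sub_iff_add_eq] at e'
      replace e' : dL (dR y) = Fock.T ((beta p q p b)⁻¹ • u' -
          (-dR w - (((p : ℤ) : ℝ) - b + 1)⁻¹ • Fock.T' (dL w))) := by
        rw [map_sub, map_smul]
        exact e'
      obtain ⟨v₀, hv₀, u₀, hu₀, e₂⟩ := Fock.row (Fock.dR_mem hy rfl rfl) (by omega) (by omega)
        (Submodule.sub_mem _ (Submodule.smul_mem _ _ (Fock.Om_congr hu' (by ring) rfl rfl))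
          (Submodule.sub_mem _ (Submodule.neg_mem _ (Fock.dR_mem hw (by ring) rfl))
            (Submodule.smul_mem _ _ (Fock.T'_mem (Fock.dL_mem hw rfl rfl) (by ring) rfl
              |> fun h => Fock.Om_congr h (by ring) rfl rfl)))) e'
      exact Fock.column hy (by omega) (by omega)
        (Fock.Om_congr hu₀ rfl rfl (by ring)) (Fock.Om_congr hv₀ (by ring) rfl rfl)
        (by rw [e₂, add_comm])
  obtain ⟨y', hy', w', -, e₃⟩ := hcol
  have hzy' : proj D p q z = proj D p q (dL (dR y')) := by
    rw [hzy, e₃, map_add, Fock.dL_T, map_add, map_neg, proj_T, neg_zero, add_zero]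
  rw [hzy']
  -- For b < q, `dL` y' represents a field or ghost, and γ of it is a multiple of `dL` `dR` y'. For
  -- b = q it would carry q + 1 second indices, and `dL` `dR` y' is a derivative of the curvature.
  rcases lt_or_ge b q with hbq | hbq
  · refine Submodule.mem_sup_right ⟨(beta p q p (b + 1))⁻¹ • proj D p q (dL y'), ?_⟩
    have hβ : beta p q p (b + 1) ≠ 0 := beta_ne_zero le_rfl (by omega) (by omega) (by omega)
    rw [map_smul, gamma_proj (Fock.dL_mem hy' rfl (a' := p) (by ring)) le_rfl (by omega), partL,
      Fock.dL_dL, smul_zero, ite_self, zero_add, partR, if_pos (by omega), Fock.G_dL, map_smul,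
      smul_smul, inv_mul_cancel₀ hβ, one_smul]
  · exact Submodule.mem_sup_left (proj_dL_dR_mem hpq.le (Fock.Om_congr hy' rfl rfl (by omega)))

end

end TwoColumn

/-! ### The cohomology of γ on linear functions -/

namespace TwoColumn

noncomputable section

open scoped Nat TensorProduct
open Fock (Space Om sym dL dR G)

variable {D p q : ℕ}

@[elab_as_elim]
theorem linear_induction {motive : LinearFunction D p q → Prop} (v : LinearFunction D p q)
    (h : ∀ v, motive (var v)) (zero : motive 0) (add : ∀ x y, motive x → motive y → motive (x + y))
    (smul : ∀ (c : ℝ) x, motive x → motive (c • x)) : motive v := by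
  have hv : v ∈ Submodule.span ℝ (Set.range (var (D := D) (p := p) (q := q))) := by
    rw [span_var]
    trivial
  induction hv using Submodule.span_induction with
  | mem x hx =>
    obtain ⟨v, rfl⟩ := hx
    exact h v
  | zero => exact zero
  | add x y _ _ hx hy => exact add x y hx hy
  | smul c x _ hx => exact smul c x hx

/-- The weight of the fields and ghosts `∂^n A^{(i,j)}` with `i + j = s`. -/
def lineWeight (s n : ℕ) (star : Bool) (i j k : ℕ) : ℝ :=
  if star = false ∧ i + j = s ∧ k = n then 1 else 0

/-- The weight of the antifields. -/
def starWeight (star : Bool) (_ _ _ : ℕ) : ℝ := if star = true then 1 else 0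

theorem scale_lineWeight_gamma (s n : ℕ) (v : LinearFunction D p q) :
    scale (lineWeight (s + 1) (n + 1)) (gammaLinear D p q v) =
      gammaLinear D p q (scale (lineWeight s n) v) := by
  refine scale_gammaLinear (fun i j k => ?_) (fun i j k => ?_) v <;>
  · unfold lineWeight
    exact if_congr (and_congr_right fun _ => by omega) rfl rfl

theorem scale_one (v : LinearFunction D p q) : scale (fun _ _ _ _ => 1) v = v := by
  have h : scale (fun _ _ _ _ => 1) = (LinearMap.id : LinearFunction D p q →ₗ[ℝ] _) :=
    linear_ext fun v => by rw [scale_var, one_smul, LinearMap.id_apply]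
  exact LinearMap.congr_fun h v

theorem exists_line (s n : ℕ) (v : LinearFunction D p q) :
    ∃ z, IsLine D p q n s (p - q + 1) z ∧
      scale (lineWeight s n) v = ∑ i ∈ Finset.range (p - q + 1), proj D p q (z i) := by
  induction v using linear_induction with
  | zero => exact ⟨0, fun i _ => Submodule.zero_mem _, by simp⟩
  | add x y hx hy =>
    obtain ⟨z, hz, e⟩ := hx
    obtain ⟨z', hz', e'⟩ := hy
    refine ⟨z + z', fun i hi => Submodule.add_mem _ (hz i hi) (hz' i hi), ?_⟩
    rw [map_add, e, e', ← Finset.sum_add_distrib]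
    simp only [Pi.add_apply, map_add]
  | smul c x hx =>
    obtain ⟨z, hz, e⟩ := hx
    refine ⟨c • z, fun i hi => Submodule.smul_mem _ _ (hz i hi), ?_⟩
    rw [map_smul, e, Finset.smul_sum]
    simp only [Pi.smul_apply, map_smul]
  | h v =>
    rw [scale_var]
    by_cases hv : v.star = false ∧ v.i + v.j = s ∧ v.der.card = n
    · obtain ⟨star, i, j, hi, hj, der, μ, ν⟩ := v
      simp only at hv
      obtain ⟨rfl, rfl, rfl⟩ := hv
      refine ⟨Pi.single i (sym der (List.ofFn μ) (List.ofFn ν)), fun k hk => ?_, ?_⟩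
      · rcases eq_or_ne k i with rfl | hki
        · rw [Pi.single_eq_same]
          refine Fock.Om_congr (Fock.sym_mem der (List.ofFn μ) (List.ofFn ν)) rfl ?_ ?_
          · simp only [List.length_ofFn]
            omega
          · simp only [List.length_ofFn]
            omega
        · rw [Pi.single_eq_of_ne hki]
          exact Submodule.zero_mem _
      · rw [lineWeight, if_pos ⟨rfl, rfl, rfl⟩, one_smul, var_eq_proj,
          Finset.sum_eq_single_of_mem i (Finset.mem_range.2 (by omega)) fun k _ hk => ?_,
          Pi.single_eq_same]
        rw [Pi.single_eq_of_ne hk, map_zero]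
    · refine ⟨0, fun i _ => Submodule.zero_mem _, ?_⟩
      rw [lineWeight, if_neg hv]
      simp

/-- The decomposition is required for every larger index set, so that two summands can share one. -/
theorem exists_finset (v : LinearFunction D p q) : ∃ F : Finset (ℕ × ℕ), ∀ F', F ⊆ F' →
    v = scale starWeight v + ∑ x ∈ F', scale (lineWeight x.1 x.2) v := by
  classical
  induction v using linear_induction with
  | zero => exact ⟨∅, fun F' _ => by simp⟩
  | add x y hx hy =>
    obtain ⟨F₁, h₁⟩ := hx
    obtain ⟨F₂, h₂⟩ := hy
    refine ⟨F₁ ∪ F₂, fun F' hF' => ?_⟩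
    simp only [map_add, Finset.sum_add_distrib]
    nth_rewrite 1 [h₁ F' (Finset.union_subset_left hF'), h₂ F' (Finset.union_subset_right hF')]
    abel
  | smul c x hx =>
    obtain ⟨F, h⟩ := hx
    refine ⟨F, fun F' hF' => ?_⟩
    simp only [map_smul]
    rw [← Finset.smul_sum, ← smul_add, ← h F' hF']
  | h v =>
    refine ⟨{(v.i + v.j, v.der.card)}, fun F' hF' => ?_⟩
    simp only [scale_var]
    rw [← Finset.sum_smul, ← add_smul]
    cases hs : v.star with
    | true => simp [starWeight, lineWeight]
    | false =>
      rw [Finset.sum_eq_single_of_mem _ (hF' (Finset.mem_singleton_self _)) fun x _ hx => ?_]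
      · simp [starWeight, lineWeight]
      · rw [lineWeight, if_neg]
        rintro ⟨-, h1, h2⟩
        exact hx (Prod.ext h1.symm h2.symm)

theorem scale_starWeight_mem (v : LinearFunction D p q) :
    scale starWeight v ∈ invariants D p q := by
  induction v using linear_induction with
  | zero => rw [map_zero]; exact Submodule.zero_mem _
  | add x y hx hy => rw [map_add]; exact Submodule.add_mem _ hx hy
  | smul c x hx => rw [map_smul]; exact Submodule.smul_mem _ _ hx
  | h v =>
    rw [scale_var, starWeight]
    split_ifs with h
    · exact Submodule.smul_mem _ _ (var_star_mem v h)
    · rw [zero_smul]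
      exact Submodule.zero_mem _

/-- The cohomology of `γ` on the linear functions is spanned by the four kinds of variables. -/
theorem mem_of_gammaLinear_eq_zero (hpq : q < p) {v : LinearFunction D p q}
    (h : gammaLinear D p q v = 0) :
    v ∈ invariants D p q ⊔ LinearMap.range (gammaLinear D p q) := by
  obtain ⟨F, hF⟩ := exists_finset v
  rw [hF F subset_rfl]
  refine Submodule.add_mem _ (Submodule.mem_sup_left (scale_starWeight_mem v))
    (Submodule.sum_mem _ fun x _ => ?_)
  obtain ⟨z, hz, e⟩ := exists_line x.1 x.2 v
  have hc : gammaLinear D p q (scale (lineWeight x.1 x.2) v) = 0 := by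
    rw [← scale_lineWeight_gamma, h, map_zero]
  obtain ⟨z₀, hz₀, y, hy, -, w, -, e'⟩ := line_reduce (p - q) (by omega) hz
    (Submodule.zero_mem _) (by rw [← e, hc, map_zero])
  rw [← e] at e'
  rw [e', map_add, map_add, gammaLinear_eq_zero hy, gammaLinear_gammaLinear, zero_add,
    zero_add] at hc
  rw [e']
  exact Submodule.add_mem _ (Submodule.add_mem _ (Submodule.mem_sup_left hy)
    (Submodule.mem_sup_right ⟨w, rfl⟩)) (closed_bottom hpq hz₀ hc)

/-- The weight of the differentiated ghosts. -/
def exactWeight (star : Bool) (i j k : ℕ) : ℝ :=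
  if star = false ∧ 1 ≤ i + j ∧ 1 ≤ k then 1 else 0

theorem scale_exactWeight_gamma (v : LinearFunction D p q) :
    scale exactWeight (gammaLinear D p q v) = gammaLinear D p q v := by
  rw [scale_gammaLinear (w := fun _ _ _ _ => 1) (fun i j k => ?_) (fun i j k => ?_), scale_one] <;>
  · unfold exactWeight
    exact if_pos (by simp; try omega)

/-- Antifields, curvatures and the undifferentiated ghost all have weight zero, so only D⁰ can
survive. For q = 0 it is a curl of the field itself, carries no ghost, and drops out too. -/
theorem scale_exactWeight_invariants {v : LinearFunction D p q} (hv : v ∈ invariants D p q) :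
    ∃ y ∈ Om D 0 (p + 1) 0, (q = 0 → y = 0) ∧ scale exactWeight v = proj D p q (dL y) := by
  induction hv using Submodule.span_induction with
  | zero => exact ⟨0, Submodule.zero_mem _, fun _ => rfl, by simp⟩
  | add x x' _ _ hx hx' =>
    obtain ⟨y, hy, h0, e⟩ := hx
    obtain ⟨y', hy', h0', e'⟩ := hx'
    refine ⟨y + y', Submodule.add_mem _ hy hy', fun h => by rw [h0 h, h0' h, add_zero], ?_⟩
    rw [map_add, e, e', map_add, map_add]
  | smul c x _ hx =>
    obtain ⟨y, hy, h0, e⟩ := hx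
    refine ⟨c • y, Submodule.smul_mem _ _ hy, fun h => by rw [h0 h, smul_zero], ?_⟩
    rw [map_smul, e, map_smul, map_smul]
  | mem x hx =>
    have hzero : scale exactWeight x = 0 → ∃ y ∈ Om D 0 (p + 1) 0, (q = 0 → y = 0) ∧
        scale exactWeight x = proj D p q (dL y) := fun h =>
      ⟨0, Submodule.zero_mem _, fun _ => rfl, by rw [h, map_zero, map_zero]⟩
    rcases hx with (((⟨v, hv, rfl⟩ | ⟨h, der, μ, ν, rfl⟩) | ⟨v, hv, hi, hj, hder, rfl⟩) | ⟨h, μ, rfl⟩)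
    · refine hzero ?_
      rw [scale_var, exactWeight, if_neg (by simp [hv]), zero_smul]
    · refine hzero ?_
      rw [curvature_eq, map_smul, scale_proj _ (Fock.dL_mem (Fock.dR_mem
        (Fock.sym_mem der (List.ofFn μ) (List.ofFn ν)) rfl rfl) rfl rfl), exactWeight,
        if_neg (by simp), zero_smul, smul_zero]
    · refine hzero ?_
      rw [scale_var, exactWeight, if_neg (by simp [hder]), zero_smul]
    · have hm := Fock.sym_mem 0 (List.ofFn μ) []
      have hs := scale_proj (p := p) (q := q) exactWeight (Fock.dL_mem hm rfl rfl)
      rw [ghostCurl_eq, map_smul, hs]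
      rcases Nat.eq_zero_or_pos q with hq | hq
      · refine ⟨0, Submodule.zero_mem _, fun _ => rfl, ?_⟩
        rw [exactWeight, if_neg (by simp [hq]), zero_smul, smul_zero, map_zero, map_zero]
      · refine ⟨_, Submodule.smul_mem _ ((-1 : ℝ) ^ q * ((p + 1)! : ℝ)⁻¹ * p !)
          (Fock.Om_congr hm (by simp) (by simp) (by simp)), fun h => by omega, ?_⟩
        rw [exactWeight, if_pos (by simp; omega), one_smul, map_smul, map_smul]

/-- No nonzero combination of the four kinds of variables is `γ`-exact. -/
theorem gammaLinear_eq_zero_of_mem (hpq : q < p) {v : LinearFunction D p q}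
    (h : gammaLinear D p q v ∈ invariants D p q) : gammaLinear D p q v = 0 := by
  obtain ⟨y, hy, h0, e⟩ := scale_exactWeight_invariants h
  rw [scale_exactWeight_gamma] at e
  rcases Nat.eq_zero_or_pos q with hq | hq
  · rw [e, h0 hq, map_zero, map_zero]
  obtain ⟨s, rfl⟩ : ∃ s, q = s + 1 := ⟨q - 1, by omega⟩
  -- `dL` y has ghost number q and one derivative, so it can only come from the part of v with ghost
  -- number q - 1 and no derivative.
  obtain ⟨z, hz, e₁⟩ := exists_line s 0 v
  have hdy : dL y ∈ Om D 1 p 0 := Fock.dL_mem hy (by simp) (by ring)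
  have e₂ : gammaLinear D p (s + 1) (scale (lineWeight s 0) v) = proj D p (s + 1) (dL y) := by
    rw [← scale_lineWeight_gamma, e, scale_proj _ hdy, lineWeight, if_pos (by simp), one_smul]
  obtain ⟨z₀, hz₀, x, -, hx, w, hw, e₃⟩ := line_reduce (p - (s + 1)) (by omega) hz
    (Fock.Om_congr hdy (by simp) rfl (by push_cast; ring)) (by rw [← e₁, e₂])
  rw [hx (by omega), hw rfl, map_zero, zero_add, zero_add, ← e₁] at e₃
  replace hz₀ : z₀ ∈ Om D 0 p 1 := Fock.Om_congr hz₀ (by simp) rfl (by push_cast; ring)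
  rw [e₃] at e₂
  suffices hp : proj D p (s + 1) z₀ = 0 by rw [e, ← e₂, hp, map_zero]
  rw [gamma_proj hz₀ le_rfl (by omega), ← sub_eq_zero, ← map_sub, add_sub_assoc] at e₂
  -- `dL` y sits in degree (1, p, 0), so the component of γz₀ in degree (1, p-1, 1) must vanish on
  -- its own.
  obtain ⟨u, hu, e₄⟩ := exists_T_of_proj_add (partL_mem hz₀) (partL_mem_inRange hz₀ le_rfl)
    (Submodule.sub_mem _ (partR_mem_others hz₀ (by omega))
      (Fock.mem_others (fun e => by have := congrFun e 1; simp at this; omega) hdy))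
    (Submodule.sub_mem _ (partR_mem_inRange hz₀ le_rfl (by omega))
      (mem_inRange hdy (by omega) le_rfl (by omega))) e₂
  have hp0 : ((p : ℤ) : ℝ) ≠ 0 := by
    have : (p : ℤ) ≠ 0 := by omega
    exact_mod_cast this
  rw [partL, if_pos (by omega), inv_smul_eq_iff₀ hp0, ← map_smul] at e₄
  obtain ⟨y', hy', w', -, e₅⟩ := Fock.row hz₀ (by omega) (by omega)
    (Submodule.smul_mem _ _ (Fock.Om_congr hu rfl (by ring) rfl)) e₄
  -- The primitive y' would carry -1 derivatives, so z₀ lies in the range of `T`.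
  rw [e₅, map_add, proj_T, add_zero, Fock.eq_zero_of_neg hy' (u := 0) (by simp), map_zero, map_zero]

end

end TwoColumn

/-! ### Grassmann parity and the conclusion -/

namespace TwoColumn

noncomputable section

open scoped Nat

variable {D p q : ℕ}

/-- The weight of the variables of Grassmann parity `b`. -/
def parityWeight (b : Bool) (star : Bool) (i j _ : ℕ) : ℝ :=
  if (if star then decide (Odd (i + j + 1)) else decide (Odd (i + j))) = b then 1 else 0

theorem scale_parityWeight_var (b : Bool) (v : JetVar D p q) :
    scale (parityWeight b) (var v) = if v.parity = b then var v else 0 := by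
  rw [scale_var]
  change (if v.parity = b then (1 : ℝ) else 0) • var v = _
  rw [ite_smul, one_smul, zero_smul]

theorem var_mem_sector (v : JetVar D p q) : var v ∈ sector D p q v.parity :=
  Submodule.subset_span ⟨v, rfl, rfl⟩

theorem scale_parityWeight_of_mem {b b' : Bool} {x : LinearFunction D p q}
    (hx : x ∈ sector D p q b') : scale (parityWeight b) x = if b' = b then x else 0 := by
  induction hx using Submodule.span_induction with
  | zero => rw [map_zero, ite_self]
  | add x y _ _ hx hy => rw [map_add, hx, hy]; split_ifs <;> simp
  | smul c x _ hx => rw [map_smul, hx]; split_ifs <;> simp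
  | mem x hx =>
    obtain ⟨v, rfl, rfl⟩ := hx
    exact scale_parityWeight_var b v

theorem scale_parityWeight_mem (b : Bool) (x : LinearFunction D p q) :
    scale (parityWeight b) x ∈ sector D p q b := by
  induction x using linear_induction with
  | zero => rw [map_zero]; exact Submodule.zero_mem _
  | add x y hx hy => rw [map_add]; exact Submodule.add_mem _ hx hy
  | smul c x hx => rw [map_smul]; exact Submodule.smul_mem _ _ hx
  | h v =>
    rw [scale_parityWeight_var]
    split_ifs with h
    · exact h ▸ var_mem_sector v
    · exact Submodule.zero_mem _

theorem scale_parityWeight_gamma (b : Bool) (v : LinearFunction D p q) :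
    scale (parityWeight b) (gammaLinear D p q v) =
      gammaLinear D p q (scale (parityWeight !b) v) := by
  refine scale_gammaLinear (fun i j k => ?_) (fun i j k => ?_) v
  · have h : i + 1 + j = i + j + 1 := by ring
    by_cases he : Odd (i + j) <;> cases b <;> simp [parityWeight, h, Nat.odd_add_one, he]
  · have h : i + (j + 1) = i + j + 1 := by ring
    by_cases he : Odd (i + j) <;> cases b <;> simp [parityWeight, h, Nat.odd_add_one, he]

/-- Each invariant variable has a definite parity, so their span splits into its even and odd parts.
-/
theorem exists_mem_sector {x : LinearFunction D p q} (hx : x ∈ invariantVariables D p q) :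
    ∃ b, x ∈ sector D p q b := by
  rcases hx with (((⟨v, hv, rfl⟩ | ⟨h, der, μ, ν, rfl⟩) | ⟨v, hv, hi, hj, hder, rfl⟩) | ⟨h, μ, rfl⟩)
  · exact ⟨_, var_mem_sector v⟩
  · refine ⟨false, ?_⟩
    rw [curvature]
    refine Submodule.smul_mem _ _ (Submodule.smul_mem _ _
      (Submodule.sum_mem _ fun σ _ => Submodule.sum_mem _ fun τ _ =>
        sign_smul_mem _ _ (sign_smul_mem _ _ (Submodule.subset_span ⟨_, ?_, rfl⟩))))
    simp [JetVar.parity]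
  · exact ⟨_, var_mem_sector v⟩
  · refine ⟨decide (Odd q), ?_⟩
    rw [ghostCurl]
    refine Submodule.smul_mem _ _ (Submodule.smul_mem _ _
      (Submodule.sum_mem _ fun σ _ => sign_smul_mem _ _ (Submodule.subset_span ⟨_, ?_, rfl⟩)))
    simp [JetVar.parity]

theorem coe_mem_invariants {b : Bool} {x : sector D p q b} (hx : x ∈ invariantSector D p q b) :
    (x : LinearFunction D p q) ∈ invariants D p q := by
  have h : invariantSector D p q b ≤ (invariants D p q).comap (sector D p q b).subtype :=
    Submodule.span_le.2 fun w hw => Submodule.subset_span hw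
  exact h hx

theorem exists_invariantSector (b : Bool) {x : LinearFunction D p q} (hx : x ∈ invariants D p q) :
    ∃ y ∈ invariantSector D p q b, (y : LinearFunction D p q) = scale (parityWeight b) x := by
  induction hx using Submodule.span_induction with
  | zero => exact ⟨0, Submodule.zero_mem _, by simp⟩
  | add x x' _ _ hx hx' =>
    obtain ⟨y, hy, e⟩ := hx
    obtain ⟨y', hy', e'⟩ := hx'
    exact ⟨y + y', Submodule.add_mem _ hy hy', by rw [map_add, ← e, ← e']; rfl⟩
  | smul c x _ hx =>
    obtain ⟨y, hy, e⟩ := hx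
    exact ⟨c • y, Submodule.smul_mem _ _ hy, by rw [map_smul, ← e]; rfl⟩
  | mem x hx =>
    obtain ⟨b', hb⟩ := exists_mem_sector hx
    rw [scale_parityWeight_of_mem hb]
    by_cases h : b' = b
    · subst h
      exact ⟨⟨x, hb⟩, Submodule.subset_span hx, (if_pos rfl).symm⟩
    · exact ⟨0, Submodule.zero_mem _, (if_neg h).symm⟩

variable (D p q) in
/-- The action of `γ` on the even linear functions. -/
def gammaEven : sector D p q false →ₗ[ℝ] sector D p q true :=
  (gammaLinear D p q).restrict (gammaLinear_mem false)

variable (D p q) in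
/-- The action of `γ` on the odd linear functions. -/
def gammaOdd : sector D p q true →ₗ[ℝ] sector D p q false :=
  (gammaLinear D p q).restrict (gammaLinear_mem true)

theorem coe_gammaEven (v : sector D p q false) :
    (gammaEven D p q v : LinearFunction D p q) = gammaLinear D p q v := rfl

theorem coe_gammaOdd (v : sector D p q true) :
    (gammaOdd D p q v : LinearFunction D p q) = gammaLinear D p q v := rfl

theorem coe_gamma (f : LocalFunction D p q) :
    (gamma D p q f).1 = SuperFunction.odd (gammaEven D p q) (gammaOdd D p q) f.1 := rfl

/-- The parity projection intertwines with γ, so a representative and a primitive found without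
regard to parity can be projected to the right sectors. -/
theorem exists_of_gammaLinear_eq_zero (hpq : q < p) {b : Bool} (v : sector D p q b)
    (h : gammaLinear D p q v = 0) :
    ∃ i ∈ invariantSector D p q b, ∃ w : sector D p q (!b),
      (v : LinearFunction D p q) = i + gammaLinear D p q w := by
  obtain ⟨x, hx, y, ⟨w, rfl⟩, e⟩ := Submodule.mem_sup.1 (mem_of_gammaLinear_eq_zero hpq h)
  obtain ⟨i, hi, e'⟩ := exists_invariantSector b hx
  refine ⟨i, hi, ⟨_, scale_parityWeight_mem (!b) w⟩, ?_⟩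
  have := congrArg (scale (parityWeight b)) e
  rw [map_add, scale_parityWeight_of_mem v.2, if_pos rfl, scale_parityWeight_gamma] at this
  rw [e', ← this]

theorem gammaOdd_gammaEven (v : sector D p q false) : gammaOdd D p q (gammaEven D p q v) = 0 :=
  Subtype.ext (gammaLinear_gammaLinear (v : LinearFunction D p q))

theorem gammaEven_gammaOdd (v : sector D p q true) : gammaEven D p q (gammaOdd D p q v) = 0 :=
  Subtype.ext (gammaLinear_gammaLinear (v : LinearFunction D p q))

theorem gammaEven_eq_zero (v : sector D p q false) (hv : v ∈ invariantSector D p q false) :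
    gammaEven D p q v = 0 :=
  Subtype.ext (gammaLinear_eq_zero (coe_mem_invariants hv))

theorem gammaOdd_eq_zero (v : sector D p q true) (hv : v ∈ invariantSector D p q true) :
    gammaOdd D p q v = 0 :=
  Subtype.ext (gammaLinear_eq_zero (coe_mem_invariants hv))

theorem exists_isContraction (hpq : q < p) : ∃ ρ₀ ρ₁, SuperFunction.IsContraction
    (gammaEven D p q) (gammaOdd D p q) ρ₀ ρ₁
    (invariantSector D p q false) (invariantSector D p q true) := by
  refine SuperFunction.exists_isContraction gammaOdd_gammaEven gammaEven_gammaOdd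
    gammaEven_eq_zero gammaOdd_eq_zero (fun v hv => ?_) (fun v hv => ?_)
    (fun w hw => ?_) (fun w hw => ?_)
  · obtain ⟨i, hi, w, e⟩ := exists_of_gammaLinear_eq_zero hpq v (congrArg Subtype.val hv)
    exact ⟨i, hi, w, Subtype.ext e⟩
  · obtain ⟨i, hi, w, e⟩ := exists_of_gammaLinear_eq_zero hpq v (congrArg Subtype.val hv)
    exact ⟨i, hi, w, Subtype.ext e⟩
  · have h := coe_mem_invariants hw
    rw [coe_gammaOdd] at h
    exact Subtype.ext (gammaLinear_eq_zero_of_mem hpq h)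
  · have h := coe_mem_invariants hw
    rw [coe_gammaEven] at h
    exact Subtype.ext (gammaLinear_eq_zero_of_mem hpq h)

theorem gamma_gamma (f : LocalFunction D p q) : gamma D p q (gamma D p q f) = 0 := by
  refine Subtype.ext ?_
  rw [coe_gamma, coe_gamma]
  have h₀ : gammaOdd D p q ∘ₗ gammaEven D p q = 0 := LinearMap.ext gammaOdd_gammaEven
  have h₁ : gammaEven D p q ∘ₗ gammaOdd D p q = 0 := LinearMap.ext gammaEven_gammaOdd
  exact SuperFunction.odd_odd _ _ h₀ h₁ f.2

theorem invariantFunctions_le :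
    invariantFunctions D p q ≤ LinearMap.ker (gamma D p q) := by
  intro f hf
  refine LinearMap.mem_ker.2 (Subtype.ext ?_)
  rw [coe_gamma]
  exact SuperFunction.odd_eq_zero gammaEven_eq_zero gammaOdd_eq_zero hf

theorem eq_zero_of_eq_gamma (hpq : q < p) {f g : LocalFunction D p q}
    (hf : f ∈ invariantFunctions D p q) (h : gamma D p q g = f) : f = 0 := by
  obtain ⟨ρ₀, ρ₁, hρ⟩ := exists_isContraction (D := D) hpq
  refine Subtype.ext (hρ.poincare.2 f.1 hf g.1 g.2 ?_)
  rw [← coe_gamma, h]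

theorem exists_eq_add_gamma (hpq : q < p) {f : LocalFunction D p q} (hf : gamma D p q f = 0) :
    ∃ f₀ ∈ invariantFunctions D p q, ∃ g, f = f₀ + gamma D p q g := by
  obtain ⟨ρ₀, ρ₁, hρ⟩ := exists_isContraction (D := D) hpq
  obtain ⟨F₀, hF₀, H, hH, e⟩ := hρ.poincare.1 f.1 f.2 (by rw [← coe_gamma, hf]; rfl)
  exact ⟨⟨F₀, SuperFunction.space_mono le_top le_top hF₀⟩, hF₀, ⟨H, hH⟩, Subtype.ext e⟩

end

end TwoColumn

theorem mainTheorem2 (D p q : ℕ) (hpq : q < p) (hD : p + q + 2 ≤ D) :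
    TwoColumn.gamma D p q ∘ₗ TwoColumn.gamma D p q = 0 ∧
    ∃ (h : TwoColumn.invariantFunctions D p q ≤ LinearMap.ker (TwoColumn.gamma D p q))
      (e : TwoColumn.invariantFunctions D p q ≃ₗ[ℝ] TwoColumn.GammaCohomology D p q),
      ∀ f : TwoColumn.invariantFunctions D p q,
        e f = Submodule.Quotient.mk ⟨(f : TwoColumn.LocalFunction D p q), h f.2⟩ := by
  refine ⟨LinearMap.ext TwoColumn.gamma_gamma, TwoColumn.invariantFunctions_le, ?_⟩
  refine ⟨LinearEquiv.ofBijective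
    (((LinearMap.range (TwoColumn.gamma D p q)).submoduleOf
      (LinearMap.ker (TwoColumn.gamma D p q))).mkQ ∘ₗ
        Submodule.inclusion TwoColumn.invariantFunctions_le) ⟨?_, ?_⟩, fun f => rfl⟩
  · rw [← LinearMap.ker_eq_bot, LinearMap.ker_eq_bot']
    intro f hf
    obtain ⟨g, hg⟩ := (Submodule.Quotient.mk_eq_zero _).1 hf
    exact Subtype.ext (TwoColumn.eq_zero_of_eq_gamma hpq f.2 hg)
  · intro c
    obtain ⟨⟨f, hf⟩, rfl⟩ := Submodule.Quotient.mk_surjective _ c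
    obtain ⟨f₀, hf₀, g, e⟩ := TwoColumn.exists_eq_add_gamma hpq hf
    refine ⟨⟨f₀, hf₀⟩, (Submodule.Quotient.eq _).2 ⟨-g, ?_⟩⟩
    rw [map_neg, neg_eq_iff_eq_neg]
    change _ = -(f₀ - f)
    rw [e]
    abel
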